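/- **Conventions.** Let $\mathbb T=\mathbb R\cup\{-\infty\}=[-\infty,\infty)$. A tropical Laurent polynomial on $\mathbb R^N$ is a function $x\mapsto\max_{j\in A}(a_j+\langle j,x\rangle)$ with $A\subset\mathbb Z^N$ finite and nonempty and $a_j\in\mathbb R$. A function $g:W\to\mathbb T$ on an open set $W\subset\mathbb T^N$ is regular if it is continuous and its restriction to $W\cap\mathbb R^N$ is the restriction of a tropical Laurent polynomial. For $Y\subset\mathbb T^N$ let $\mathcal O_Y$ be the sheaf of $\mathbb T$-valued functions on $Y$ that are locally restrictions of regular functions. A $k$-dimensional polyhedral complex in $\mathbb R^N$ is given by finitely many nonempty $k$-dimensional convex polyhedra with integer slopes (its facets, all of weight one) such that the intersection of any number of them is a (possibly empty) common face; its underlying set in $\mathbb R^N$ is the union of the facets, and its underlying set in $\mathbb T^N$ is the closure of that union. Let $Y$ be the underlying set in $\mathbb R^N$, let $E$ be a $(k-1)$-dimensional face, and let $L\subset\mathbb R^N$ be an $(N-k)$-dimensional affine subspace with integer slope meeting the relative interior of $E$. For a facet $F$ let $\Lambda_F,\Lambda_L\subset\mathbb Z^N$ be the groups of integer vectors parallel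 to $F$ and to $L$. The vector $v$ is generic if $L+v$ meets the facets containing $E$ only transversally and in their relative interiors. The complex is balanced if for all such $E$ and $L$ the sum $\iota_L=\sum_F[\mathbb Z^N:\Lambda_F+\Lambda_L]$, over the facets $F\supset E$ with $F\cap(L+v)\neq\emptyset$, is the same for all sufficiently small generic $v$. It is simply balanced if, in addition, for every $(k-1)$-dimensional face $E$ and every facet $F\supset E$ one can choose $L$ such that $F\cap(L+v)\ne\emptyset$ for arbitrarily small generic $v$, $\iota_L=1$, and for every sufficiently small $v$ there is an affine hyperplane $H$ of $L+v$ such that $Y\cap(L+v)$ lies in one of the two closed half-spaces of $L+v$ bounded by $H$ and $Y\cap H$ is a single point. A smooth tropical variety of dimension $k$ is a topological space $X$ with a sheaf $\mathcal O_X$ of $\mathbb T$-valued functions such that every point has an open neighbourhood which, with the restricted sheaf, is isomorphic to an open subset of a simply balanced $k$-dimensional polyhedral complex in some $\mathbb T^N$ with its regular sheaf. A rational tropical curve with $n$ marked points is a finite tree with $n$ unbounded edges (leaves), labelled $1,\dots,n$, all of whose vertices have valence at least $3$ (the ends of the leaves at infinity are not counted as vertices), together with a positive length for every bounded edge. Let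 $\mathcal M_{0,n}$ be the set of isomorphism classes of such curves. A combinatorial type $\Gamma$ is a labelled tree as above without lengths. It defines a map $\mathbb R_{\ge0}^{\{\text{bounded edges of }\Gamma\}}\to\mathcal M_{0,n}$ by contracting the edges of length zero, and $\mathcal M_{0,n}$ carries the topology in which a set is open if and only if its preimages under all these maps are open. For two disjoint ordered pairs $(a,b)$, $(c,d)$ of distinct markings, the double ratio of a curve is the length of the intersection of the oriented paths from leaf $a$ to leaf $b$ and from leaf $c$ to leaf $d$, with sign $+$ if the orientations agree and $-$ otherwise. **Theorem.** Let $n\ge3$. There is a sheaf $\mathcal O$ of $\mathbb T$-valued functions on $\mathcal M_{0,n}$ such that: 1. $(\mathcal M_{0,n},\mathcal O)$ is a smooth tropical variety of dimension $n-3$. 2. For every combinatorial type $\Gamma$ and every bounded edge $e$ of $\Gamma$, the length of $e$ is a well-defined function on the set $U_\Gamma\subset\mathcal M_{0,n}$ of curves of type $\Gamma$, and it is regular there: near every point of $U_\Gamma$ it is the restriction to $U_\Gamma$ of a section of $\mathcal O$. 3. Let $S$ be any set of choices of two disjoint ordered pairs of markings that contains, for every unordered choice of two disjoint two-element subsets $\{a,b\}$,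 $\{c,d\}$ of the markings, at least one ordering of it, and let $N=|S|$. Then the map $\iota:\mathcal M_{0,n}\to\mathbb R^N$ whose coordinates are the double ratios in $S$ is a tropical embedding: it is a topological embedding, its image is a simply balanced $(n-3)$-dimensional polyhedral complex, whose facets are the images of the closed cones of the trivalent combinatorial types, and $\iota$ identifies $\mathcal O$ with the regular sheaf of the image. -/

import Mathlib

open scoped NNReal Topology

noncomputable section

namespace TropMod

/-! ### Tropical numbers, tropical Laurent polynomials, regular functions -/

/-- The tropical numbers `𝕋 = ℝ ∪ {-∞}` with the Euclidean topology of `[-∞, ∞)`. -/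
abbrev Trop : Type := {x : EReal // x ≠ ⊤}

/-- The inclusion `ℝ = 𝕋ˣ ⊆ 𝕋`. -/
def realToTrop (x : ℝ) : Trop := ⟨(x : EReal), EReal.coe_ne_top x⟩

/-- The inclusion `ℝ^ι ⊆ 𝕋^ι`. -/
def vecToTrop {ι : Type} (x : ι → ℝ) : ι → Trop := fun i => realToTrop (x i)

/-- `f` is a tropical Laurent polynomial: a maximum of finitely many (and at least one)
affine functions with integer slopes. -/
def IsLaurentPolynomial {ι : Type} [Fintype ι] (f : (ι → ℝ) → ℝ) : Prop :=
  ∃ (A : Finset (ι → ℤ)) (hA : A.Nonempty) (a : (ι → ℤ) → ℝ),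
    ∀ x, f x = A.sup' hA (fun j => a j + ∑ i, (j i : ℝ) * x i)

/-- `g` is a regular function on the open set `W ⊆ 𝕋^ι`: it is continuous there, and on the real
points of `W` it is the restriction of a tropical Laurent polynomial. -/
def IsRegularOn {ι : Type} [Fintype ι] (g : (ι → Trop) → Trop) (W : Set (ι → Trop)) : Prop :=
  IsOpen W ∧ ContinuousOn g W ∧
    ∃ p : (ι → ℝ) → ℝ, IsLaurentPolynomial p ∧
      ∀ x : ι → ℝ, vecToTrop x ∈ W → g (vecToTrop x) = realToTrop (p x)

/-- A sheaf of `𝕋`-valued functions on a topological space (a subsheaf of the sheaf of all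
`𝕋`-valued functions). -/
abbrev TropSheaf (X : Type*) [TopologicalSpace X] :=
  TopCat.LocalPredicate (X := TopCat.of X) (fun _ => Trop)

/-- The sheaf on `X` of the functions that are locally of the form `g ∘ φ` with `g` regular on an
open subset of `𝕋^ι`. For an embedding `φ`, this is the regular sheaf of the subset `φ(X)` of
`𝕋^ι`, transported to `X`. -/
def pullbackSheaf {X : Type*} [TopologicalSpace X] {ι : Type} [Fintype ι]
    (φ : X → (ι → Trop)) : TropSheaf X :=
  TopCat.PrelocalPredicate.sheafify
    { pred := fun {U} f => ∃ (W : Set (ι → Trop)) (g : (ι → Trop) → Trop),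
        IsRegularOn g W ∧ ∀ x : U, φ x.1 ∈ W ∧ f x = g (φ x.1)
      res := by
        rintro U V i f ⟨W, g, hg, h⟩
        exact ⟨W, g, hg, fun x => h ⟨x.1, i.le x.2⟩⟩ }

/-- The regular sheaf `𝒪_Y` of a subset `Y ⊆ 𝕋^ι`: functions which are locally restrictions of
regular functions on open subsets of `𝕋^ι`. -/
def regularSheaf {ι : Type} [Fintype ι] (Y : Set (ι → Trop)) : TropSheaf Y :=
  pullbackSheaf (Subtype.val : Y → (ι → Trop))

/-! ### Polyhedral complexes, balancing -/

/-- A convex polyhedron with integer slopes: a finite intersection of closed half-spaces whose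
normal vectors are integral. -/
def IsRationalPolyhedron {ι : Type} [Fintype ι] (F : Set (ι → ℝ)) : Prop :=
  ∃ A : Finset ((ι → ℤ) × ℝ), F = {x | ∀ p ∈ A, ∑ i, (p.1 i : ℝ) * x i ≤ p.2}

/-- The dimension of a (nonempty) polyhedron. -/
def polyDim {ι : Type} [Fintype ι] (F : Set (ι → ℝ)) : ℕ :=
  Module.finrank ℝ (vectorSpan ℝ F)

/-- A `k`-dimensional polyhedral complex in `ℝ^ι`, given by its facets: finitely many (possibly
unbounded) `k`-dimensional convex polyhedra such that the intersection of any number of them is a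
common face (possibly the empty face). All facets carry the weight one. -/
structure PolyComplex (ι : Type) [Fintype ι] (k : ℕ) where
  facets : Set (Set (ι → ℝ))
  finite_facets : facets.Finite
  isPolyhedron : ∀ F ∈ facets, IsRationalPolyhedron F
  nonempty : ∀ F ∈ facets, F.Nonempty
  dim_eq : ∀ F ∈ facets, polyDim F = k
  inter_isFace : ∀ T ⊆ facets, ∀ F ∈ T, IsExposed ℝ F (⋂₀ T)

/-- The integer vectors lying in a linear subspace, as a subgroup of `ℤ^ι`. -/
def integerPoints {ι : Type} [Fintype ι] (W : Submodule ℝ (ι → ℝ)) : AddSubgroup (ι → ℤ) :=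
  W.toAddSubgroup.comap ((Int.castAddHom ℝ).compLeft ι)

/-- A linear subspace is rational if it is spanned by its integer vectors. -/
def IsRationalSubspace {ι : Type} [Fintype ι] (W : Submodule ℝ (ι → ℝ)) : Prop :=
  Submodule.span ℝ ((fun z : ι → ℤ => fun i => (z i : ℝ)) '' (integerPoints W : Set (ι → ℤ))) = W

/-- The translate `L + v`. -/
def translate {ι : Type} [Fintype ι] (L : AffineSubspace ℝ (ι → ℝ)) (v : ι → ℝ) :
    Set (ι → ℝ) :=
  {x | x - v ∈ L}

/-- `L + v` is in general position to the facet `F`: if it meets `F` at all, then it does so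
transversally and only in the relative interior of `F`. For `dim F + dim L = dim ℝ^ι` this holds
for all `v` outside finitely many proper affine subspaces, and it implies that `F ∩ (L + v)` is
empty or a single point. -/
def IsGeneric {ι : Type} [Fintype ι] (F : Set (ι → ℝ)) (L : AffineSubspace ℝ (ι → ℝ))
    (v : ι → ℝ) : Prop :=
  (F ∩ translate L v).Nonempty →
    vectorSpan ℝ F ⊔ L.direction = ⊤ ∧ F ∩ translate L v ⊆ intrinsicInterior ℝ F

namespace PolyComplex

variable {ι : Type} [Fintype ι] {k : ℕ}

/-- The underlying set in `ℝ^ι`. -/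
def support (C : PolyComplex ι k) : Set (ι → ℝ) := ⋃₀ C.facets

/-- The underlying polyhedral complex in `𝕋^ι`: the closure of the underlying set in `ℝ^ι`. -/
def tropSupport (C : PolyComplex ι k) : Set (ι → Trop) := closure (vecToTrop '' C.support)

/-- `E` is a `(k-1)`-dimensional face. -/
def IsRidge (C : PolyComplex ι k) (E : Set (ι → ℝ)) : Prop :=
  E.Nonempty ∧ polyDim E + 1 = k ∧ ∃ F ∈ C.facets, IsExposed ℝ F E

/-- The facets adjacent to `E`. -/
def adjacent (C : PolyComplex ι k) (E : Set (ι → ℝ)) : Set (Set (ι → ℝ)) :=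
  {F | F ∈ C.facets ∧ E ⊆ F}

/-- `L` is an affine subspace with integer slope, of dimension complementary to `k`, which
meets (the relative interior of) the face `E`. -/
def IsTestSpace (_C : PolyComplex ι k) (E : Set (ι → ℝ)) (L : AffineSubspace ℝ (ι → ℝ)) : Prop :=
  Module.finrank ℝ L.direction + k = Fintype.card ι ∧ IsRationalSubspace L.direction ∧
    ((L : Set (ι → ℝ)) ∩ intrinsicInterior ℝ E).Nonempty

/-- `L + v` is in general position to all facets adjacent to `E`. -/
def IsGenericAt (C : PolyComplex ι k) (E : Set (ι → ℝ)) (L : AffineSubspace ℝ (ι → ℝ))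
    (v : ι → ℝ) : Prop :=
  ∀ F ∈ C.adjacent E, IsGeneric F L v

/-- The sum of the lattice indices `[ℤ^ι : Λ_F + Λ_L]` over the facets `F` adjacent to `E` that
meet `L + v`. -/
def intersectionSum (C : PolyComplex ι k) (E : Set (ι → ℝ)) (L : AffineSubspace ℝ (ι → ℝ))
    (v : ι → ℝ) : ℕ :=
  ∑ᶠ F ∈ {F | F ∈ C.adjacent E ∧ (F ∩ translate L v).Nonempty},
    (integerPoints (vectorSpan ℝ F) ⊔ integerPoints L.direction).index

/-- For all small generic `v` the intersection sum is equal to `d`. -/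
def HasIntersectionNumber (C : PolyComplex ι k) (E : Set (ι → ℝ))
    (L : AffineSubspace ℝ (ι → ℝ)) (d : ℕ) : Prop :=
  ∀ᶠ v in 𝓝 (0 : ι → ℝ), C.IsGenericAt E L v → C.intersectionSum E L v = d

/-- The balancing condition. -/
def IsBalanced (C : PolyComplex ι k) : Prop :=
  ∀ E, C.IsRidge E → ∀ L, C.IsTestSpace E L → ∃ d, C.HasIntersectionNumber E L d

/-- The complex is simply balanced. In the last clause the hyperplane of `L + v` is given by an
equation `f = c` with a linear form `f` that is not constant on `L`. -/
def IsSimplyBalanced (C : PolyComplex ι k) : Prop :=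
  C.IsBalanced ∧
  ∀ E, C.IsRidge E → ∀ F ∈ C.adjacent E, ∃ L, C.IsTestSpace E L ∧
    (∃ᶠ v in 𝓝 (0 : ι → ℝ), C.IsGenericAt E L v ∧ (F ∩ translate L v).Nonempty) ∧
    C.HasIntersectionNumber E L 1 ∧
    ∀ᶠ v in 𝓝 (0 : ι → ℝ), ∃ (f : (ι → ℝ) →ₗ[ℝ] ℝ) (c : ℝ),
      (∃ w ∈ L.direction, f w ≠ 0) ∧
      (∀ x ∈ C.support ∩ translate L v, c ≤ f x) ∧
      (∃! x, x ∈ C.support ∩ translate L v ∧ f x = c)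

end PolyComplex

/-! ### Tropical varieties and tropical embeddings -/

/-- `(X, 𝒪)` is a (smooth) tropical variety of dimension `k`: locally it is isomorphic, as a space
with a sheaf of functions, to an open subset of a simply balanced `k`-dimensional polyhedral
complex in some `𝕋^ι`. -/
def IsTropicalVariety (k : ℕ) {X : Type*} [TopologicalSpace X] (𝒪 : TropSheaf X) : Prop :=
  ∀ x : X, ∃ (ι : Type) (_ : Fintype ι) (C : PolyComplex ι k) (e : OpenPartialHomeomorph X
      C.tropSupport), C.IsSimplyBalanced ∧ x ∈ e.source ∧
    ∀ (W : TopologicalSpace.Opens C.tropSupport), (W : Set C.tropSupport) ⊆ e.target →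
      ∀ f : W → Trop, (regularSheaf C.tropSupport).pred (U := W) f ↔
        𝒪.pred (U := ⟨e.source ∩ e ⁻¹' W, e.isOpen_inter_preimage W.2⟩)
          (fun y => f ⟨e y.1, y.2.2⟩)

/-- `φ : X → ℝ^ι` is a tropical embedding of `(X, 𝒪)` whose image is the polyhedral complex `C`:
it is a topological embedding with image `C`, and it identifies `𝒪` with the regular sheaf of
the image. -/
def IsTropicalEmbedding {X : Type*} [TopologicalSpace X] (𝒪 : TropSheaf X) {ι : Type} [Fintype ι]
    {k : ℕ} (C : PolyComplex ι k) (φ : X → (ι → ℝ)) : Prop :=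
  Topology.IsEmbedding φ ∧ Set.range φ = C.support ∧
    ∀ (U : TopologicalSpace.Opens X) (f : U → Trop),
      𝒪.pred (U := U) f ↔ (pullbackSheaf (vecToTrop ∘ φ)).pred (U := U) f

/-! ### Rational tropical curves with marked points -/

/-- A combinatorial type of rational tropical curves with `n` marked leaves. The edges of `graph`
are the bounded edges; the `i`-th leaf is an unbounded edge attached at the vertex `mark i`. Every
vertex has valence at least three. -/
structure StableTree (n : ℕ) where
  V : Type
  finite : Finite V
  graph : SimpleGraph V
  isTree : graph.IsTree
  mark : Fin n → V
  stable : ∀ v, 3 ≤ (graph.neighborSet v).ncard + {i | mark i = v}.ncard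

namespace StableTree

variable {n : ℕ}

/-- The bounded edges. -/
abbrev Edge (Γ : StableTree n) : Type := Γ.graph.edgeSet

/-- All vertices are trivalent. -/
def IsTrivalent (Γ : StableTree n) : Prop :=
  ∀ v, (Γ.graph.neighborSet v).ncard + {i | Γ.mark i = v}.ncard = 3

/-- The embedded path between two vertices. -/
def path (Γ : StableTree n) (u v : Γ.V) : Γ.graph.Walk u v :=
  (Γ.isTree.existsUnique_path u v).choose

lemma path_isPath (Γ : StableTree n) (u v : Γ.V) : (Γ.path u v).IsPath :=
  (Γ.isTree.existsUnique_path u v).choose_spec.1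

lemma eq_path (Γ : StableTree n) {u v : Γ.V} {p : Γ.graph.Walk u v} (hp : p.IsPath) :
    p = Γ.path u v :=
  (Γ.isTree.existsUnique_path u v).unique hp (Γ.path_isPath u v)

end StableTree

/-- A rational tropical curve with `n` marked points: a tree with positive lengths of its bounded
edges. -/
structure Curve (n : ℕ) where
  type : StableTree n
  length : type.Edge → ℝ
  length_pos : ∀ e, 0 < length e

namespace Curve

variable {n : ℕ}

/-- Isomorphisms of marked tropical curves. -/
def Iso (X Y : Curve n) : Prop :=
  ∃ φ : X.type.graph ≃g Y.type.graph, (∀ i, φ (X.type.mark i) = Y.type.mark i) ∧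
    ∀ e, Y.length (φ.mapEdgeSet e) = X.length e

lemma Iso.refl (X : Curve n) : Iso X X := by
  refine ⟨SimpleGraph.Iso.refl, fun _ => rfl, fun e => congrArg _ ?_⟩
  ext1
  exact congrFun Sym2.map_id _

lemma Iso.symm {X Y : Curve n} : Iso X Y → Iso Y X := by
  rintro ⟨φ, h, h'⟩
  refine ⟨φ.symm, fun i => ?_, fun e => ?_⟩
  · rw [← h i]; exact φ.symm_apply_apply _
  · have := h' (φ.mapEdgeSet.symm e)
    rw [Equiv.apply_symm_apply] at this
    exact this.symm

lemma Iso.trans {X Y Z : Curve n} : Iso X Y → Iso Y Z → Iso X Z := by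
  rintro ⟨φ, h, h'⟩ ⟨ψ, g, g'⟩
  refine ⟨φ.trans ψ, fun i => ?_, fun e => ?_⟩
  · rw [← g i, ← h i]; rfl
  · rw [← h', ← g']
    refine congrArg _ ?_
    rcases e with ⟨e, he⟩
    induction e using Sym2.ind
    rfl

instance setoid (n : ℕ) : Setoid (Curve n) :=
  ⟨Iso, ⟨Iso.refl, Iso.symm, Iso.trans⟩⟩

end Curve

/-- The moduli space of rational tropical curves with `n` marked points, as a set. -/
def Moduli (n : ℕ) : Type 1 := Quotient (Curve.setoid n)

/-! ### Double ratios -/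

/-- Two disjoint ordered pairs of markings, `(q 0, q 1)` and `(q 2, q 3)`. -/
abbrev PairOfPairs (n : ℕ) : Type := Fin 4 ↪ Fin n

/-- The underlying unordered pair of unordered pairs. -/
def PairOfPairs.unordered {n : ℕ} (q : PairOfPairs n) : Sym2 (Sym2 (Fin n)) :=
  s(s(q 0, q 1), s(q 2, q 3))

open Classical in
/-- The double ratio of a curve: the length of the intersection of the oriented path from the
leaf `q 0` to the leaf `q 1` with the oriented path from the leaf `q 2` to the leaf `q 3`, taken
with positive sign where the orientations agree and with negative sign where they are opposite.
(The four leaves are distinct, so only bounded edges occur in the intersection.) -/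
def Curve.doubleRatio {n : ℕ} (X : Curve n) (q : PairOfPairs n) : ℝ :=
  ((X.type.path (X.type.mark (q 0)) (X.type.mark (q 1))).darts.map fun d =>
    if d ∈ (X.type.path (X.type.mark (q 2)) (X.type.mark (q 3))).darts then
      X.length ⟨d.edge, d.edge_mem⟩
    else if d.symm ∈ (X.type.path (X.type.mark (q 2)) (X.type.mark (q 3))).darts then
      - X.length ⟨d.edge, d.edge_mem⟩
    else 0).sum

lemma Curve.doubleRatio_eq_of_iso {n : ℕ} {X Y : Curve n} (h : Curve.Iso X Y) (q : PairOfPairs n) :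
    X.doubleRatio q = Y.doubleRatio q := by
  obtain ⟨φ, hm, hl⟩ := h
  have hp : ∀ i j, Y.type.path (Y.type.mark i) (Y.type.mark j) =
      ((X.type.path (X.type.mark i) (X.type.mark j)).map φ.toHom).copy (hm i) (hm j) := by
    intro i j
    refine (StableTree.eq_path _ ?_).symm
    rw [SimpleGraph.Walk.isPath_copy]
    exact SimpleGraph.Walk.IsPath.map (f := φ.toHom) φ.injective (X.type.path_isPath _ _)
  have hd : ∀ i j, (Y.type.path (Y.type.mark i) (Y.type.mark j)).darts =
      (X.type.path (X.type.mark i) (X.type.mark j)).darts.map φ.toHom.mapDart := by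
    intro i j
    rw [hp, SimpleGraph.Walk.darts_copy, SimpleGraph.Walk.darts_map]
  have hinj : Function.Injective φ.toHom.mapDart := by
    intro a b hab
    rw [SimpleGraph.Dart.ext_iff] at hab ⊢
    exact Function.Injective.prodMap φ.injective φ.injective hab
  have hmem : ∀ (d : X.type.graph.Dart) (l : List X.type.graph.Dart),
      φ.toHom.mapDart d ∈ l.map φ.toHom.mapDart ↔ d ∈ l :=
    fun d l => List.mem_map_of_injective hinj
  have hmem' : ∀ (d : X.type.graph.Dart) (l : List X.type.graph.Dart),
      (φ.toHom.mapDart d).symm ∈ l.map φ.toHom.mapDart ↔ d.symm ∈ l :=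
    fun d l => hmem d.symm l
  have hl' : ∀ d : X.type.graph.Dart,
      Y.length ⟨(φ.toHom.mapDart d).edge, (φ.toHom.mapDart d).edge_mem⟩ = X.length ⟨d.edge, d.edge_mem⟩ := by
    intro d
    rw [← hl]
    rfl
  unfold Curve.doubleRatio
  rw [hd, hd, List.map_map]
  congr 1
  refine List.map_congr_left fun d _ => ?_
  simp only [Function.comp, hl']
  by_cases h1 : d ∈ (X.type.path (X.type.mark (q 2)) (X.type.mark (q 3))).darts
  · rw [if_pos h1, if_pos ((hmem d _).2 h1)]
  by_cases h2 : d.symm ∈ (X.type.path (X.type.mark (q 2)) (X.type.mark (q 3))).darts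
  · rw [if_neg h1, if_neg (mt (hmem d _).1 h1), if_pos h2, if_pos ((hmem' d _).2 h2)]
  · rw [if_neg h1, if_neg (mt (hmem d _).1 h1), if_neg h2, if_neg (mt (hmem' d _).1 h2)]

/-- The double ratio functions on the moduli space. -/
def doubleRatio {n : ℕ} (q : PairOfPairs n) : Moduli n → ℝ :=
  Quotient.lift (fun X => X.doubleRatio q) fun _ _ h => Curve.doubleRatio_eq_of_iso h q

/-- The map to `ℝ^N` whose coordinates are the double ratios in the finite set `S`. -/
def doubleRatioMap {n : ℕ} (S : Finset (PairOfPairs n)) (x : Moduli n) : S → ℝ :=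
  fun q => doubleRatio q.1 x

/-! ### The cones of the moduli space and its topology -/

/-! The following lemmas show that contracting edges of a stable tree gives a stable tree. -/

section Contraction

variable {V : Type*} {G H : SimpleGraph V}

lemma le_deleteEdges (hHG : H ≤ G) {v w : V} (h : ¬ H.Adj v w) : H ≤ G.deleteEdges {s(v, w)} := by
  intro a b hab
  rw [SimpleGraph.deleteEdges_adj]
  refine ⟨hHG hab, fun h' => h ?_⟩
  rwa [← SimpleGraph.mem_edgeSet, ← Set.mem_singleton_iff.1 h', SimpleGraph.mem_edgeSet]

lemma reachable_lift (hHG : H ≤ G) {v₀ w₀ : V} (h₀ : ¬ H.Adj v₀ w₀)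
    {a b : H.ConnectedComponent}
    (p : ((G.map H.connectedComponentMk).deleteEdges
      {s(H.connectedComponentMk v₀, H.connectedComponentMk w₀)}).Walk a b) :
    ∀ v w, H.connectedComponentMk v = a → H.connectedComponentMk w = b →
      (G.deleteEdges {s(v₀, w₀)}).Reachable v w := by
  induction p with
  | nil =>
    intro v w hv hw
    exact (SimpleGraph.ConnectedComponent.exact (hv.trans hw.symm)).mono (le_deleteEdges hHG h₀)
  | cons hadj p ih =>
    intro v w hv hw
    rw [SimpleGraph.deleteEdges_adj, SimpleGraph.map_adj'] at hadj
    obtain ⟨⟨hne, x, y, hxy, hx, hy⟩, hd⟩ := hadj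
    have h1 : (G.deleteEdges {s(v₀, w₀)}).Reachable v x :=
      (SimpleGraph.ConnectedComponent.exact (hv.trans hx.symm)).mono (le_deleteEdges hHG h₀)
    have h2 : (G.deleteEdges {s(v₀, w₀)}).Adj x y := by
      rw [SimpleGraph.deleteEdges_adj]
      refine ⟨hxy, fun h => hd ?_⟩
      have := congrArg (Sym2.map H.connectedComponentMk) (Set.mem_singleton_iff.1 h)
      rw [Sym2.map_mk, Sym2.map_mk] at this
      rw [← hx, ← hy]
      exact this
    exact (h1.trans h2.reachable).trans (ih y w hy hw)

lemma isTree_map (hG : G.IsTree) (hHG : H ≤ G) : (G.map H.connectedComponentMk).IsTree := by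
  have := hG.connected.nonempty
  refine ⟨⟨?_⟩, ?_⟩
  · intro a b
    induction a using SimpleGraph.ConnectedComponent.ind with | _ v
    induction b using SimpleGraph.ConnectedComponent.ind with | _ w
    obtain ⟨p⟩ := hG.connected.preconnected v w
    induction p with
    | nil => exact SimpleGraph.Reachable.refl _
    | @cons x y z h p ih =>
      refine SimpleGraph.Reachable.trans ?_ ih
      by_cases hxy : H.connectedComponentMk x = H.connectedComponentMk y
      · rw [hxy]
      · exact SimpleGraph.Adj.reachable ((SimpleGraph.map_adj' _ _ _ _).2 ⟨hxy, x, y, h, rfl, rfl⟩)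
  · rw [SimpleGraph.isAcyclic_iff_forall_adj_isBridge]
    rintro a b ⟨hne, v, w, hvw, rfl, rfl⟩
    rw [SimpleGraph.isBridge_iff]
    rintro ⟨p⟩
    have hH : ¬ H.Adj v w := fun h => hne (SimpleGraph.ConnectedComponent.sound h.reachable)
    exact SimpleGraph.isBridge_iff.1 (SimpleGraph.isAcyclic_iff_forall_adj_isBridge.1
      hG.isAcyclic hvw) (reachable_lift hHG hH p v w rfl rfl)

lemma not_reachable_of_adj (hG : G.IsTree) (hHG : H ≤ G) {v w : V} (hvw : G.Adj v w)
    (hH : ¬ H.Adj v w) : H.connectedComponentMk v ≠ H.connectedComponentMk w := fun h =>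
  SimpleGraph.isBridge_iff.1 (SimpleGraph.isAcyclic_iff_forall_adj_isBridge.1 hG.isAcyclic hvw)
    ((SimpleGraph.ConnectedComponent.exact h).mono (le_deleteEdges hHG hH))

lemma eq_of_component_eq (hG : G.IsTree) (hHG : H ≤ G) {v w v' w' : V} (hvw : G.Adj v w)
    (hH : ¬ H.Adj v w) (hvw' : G.Adj v' w')
    (h1 : H.connectedComponentMk v = H.connectedComponentMk v')
    (h2 : H.connectedComponentMk w = H.connectedComponentMk w') : v = v' ∧ w = w' := by
  by_contra hcon
  have hd := le_deleteEdges hHG hH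
  have hadj : (G.deleteEdges {s(v, w)}).Adj v' w' := by
    rw [SimpleGraph.deleteEdges_adj]
    refine ⟨hvw', fun h => ?_⟩
    rcases Sym2.eq_iff.1 (Set.mem_singleton_iff.1 h) with ⟨rfl, rfl⟩ | ⟨rfl, rfl⟩
    · exact hcon ⟨rfl, rfl⟩
    · exact not_reachable_of_adj hG hHG hvw hH h1
  exact SimpleGraph.isBridge_iff.1 (SimpleGraph.isAcyclic_iff_forall_adj_isBridge.1 hG.isAcyclic hvw)
    ((((SimpleGraph.ConnectedComponent.exact h1).mono hd).trans hadj.reachable).trans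
      ((SimpleGraph.ConnectedComponent.exact h2).mono hd).symm)

lemma stable_map [Finite V] (hG : G.IsTree) (hHG : H ≤ G) {n : ℕ} (mark : Fin n → V)
    (hs : ∀ v, 3 ≤ (G.neighborSet v).ncard + {i | mark i = v}.ncard) (c : H.ConnectedComponent) :
    3 ≤ ((G.map H.connectedComponentMk).neighborSet c).ncard +
      {i | H.connectedComponentMk (mark i) = c}.ncard := by
  classical
  have := Fintype.ofFinite V
  have htree : c.toSimpleGraph.IsTree := (hG.isAcyclic.anti hHG).isTree_connectedComponent c
  -- the edges inside the component
  have e1 : ∑ v : c, (H.neighborSet v.1).ncard + 2 = 2 * Fintype.card c := by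
    have h1 := c.toSimpleGraph.sum_degrees_eq_twice_card_edges
    have h2 := htree.card_edgeFinset
    have h3 : ∀ v : c, (H.neighborSet v.1).ncard = c.toSimpleGraph.degree v := by
      intro v
      rw [← SimpleGraph.card_neighborSet_eq_degree, ← Nat.card_eq_fintype_card,
        ← Nat.card_coe_set_eq]
      refine Nat.card_congr ⟨fun w => ⟨⟨w.1, ?_⟩, ?_⟩, fun w => ⟨w.1.1, ?_⟩, fun _ => rfl,
        fun _ => rfl⟩
      · exact (SimpleGraph.ConnectedComponent.sound w.2.reachable.symm).trans v.2
      · exact w.2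
      · exact w.2
    rw [Finset.sum_congr rfl fun v _ => h3 v, h1]
    omega
  -- the edges leaving the component
  have e2 : ∑ v : c, (G.neighborSet v.1 \ H.neighborSet v.1).ncard ≤
      ((G.map H.connectedComponentMk).neighborSet c).ncard := by
    simp_rw [← Nat.card_coe_set_eq]
    rw [← Nat.card_sigma]
    refine Nat.card_le_card_of_injective (fun d => ⟨H.connectedComponentMk d.2.1, ?_⟩) ?_
    · have hv : H.connectedComponentMk d.1.1 = c := d.1.2
      have hne := not_reachable_of_adj hG hHG d.2.2.1 d.2.2.2
      rw [hv] at hne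
      exact ⟨hne, d.1.1, d.2.1, d.2.2.1, hv, rfl⟩
    · rintro ⟨⟨v, hv⟩, ⟨w, hw⟩⟩ ⟨⟨v', hv'⟩, ⟨w', hw'⟩⟩ h
      have h2 : H.connectedComponentMk w = H.connectedComponentMk w' := congrArg Subtype.val h
      have hv1 : H.connectedComponentMk v = c := hv
      have hv2 : H.connectedComponentMk v' = c := hv'
      obtain ⟨rfl, rfl⟩ := eq_of_component_eq hG hHG hw.1 hw.2 hw'.1 (hv1.trans hv2.symm) h2
      rfl
  -- the markings
  have e3 : ∑ v : c, {i | mark i = v.1}.ncard ≤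
      {i | H.connectedComponentMk (mark i) = c}.ncard := by
    simp_rw [← Nat.card_coe_set_eq]
    rw [← Nat.card_sigma]
    refine Nat.card_le_card_of_injective (fun d => ⟨d.2.1, ?_⟩) ?_
    · have h1 : mark d.2.1 = d.1.1 := d.2.2
      have hv : H.connectedComponentMk d.1.1 = c := d.1.2
      exact (congrArg _ h1).trans hv
    · rintro ⟨⟨v, hv⟩, ⟨i, hi⟩⟩ ⟨⟨v', hv'⟩, ⟨i', hi'⟩⟩ h
      obtain rfl : i = i' := congrArg Subtype.val h
      have h1 : mark i = v := hi
      have h2 : mark i = v' := hi'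
      subst h1
      subst h2
      rfl
  have e4 : ∀ v : c, 3 ≤ (H.neighborSet v.1).ncard + (G.neighborSet v.1 \ H.neighborSet v.1).ncard
      + {i | mark i = v.1}.ncard := by
    intro v
    have h1 : H.neighborSet v.1 ⊆ G.neighborSet v.1 := fun w hw => hHG hw
    have := Set.ncard_sdiff_add_ncard_of_subset h1
    have := hs v.1
    omega
  have e5 := Finset.sum_le_sum fun (v : c) (_ : v ∈ Finset.univ) => e4 v
  rw [Finset.sum_add_distrib, Finset.sum_add_distrib, Finset.sum_const, Finset.card_univ,
    smul_eq_mul] at e5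
  have e6 : 0 < Fintype.card c := by
    have := htree.connected.nonempty
    exact Fintype.card_pos
  omega

end Contraction

namespace StableTree

variable {n : ℕ} (Γ : StableTree n) (ℓ : Γ.Edge → ℝ≥0)

/-- The subgraph of the edges of length zero. -/
def zeroGraph : SimpleGraph Γ.V where
  Adj u v := ∃ h : Γ.graph.Adj u v, ℓ ⟨s(u, v), h⟩ = 0
  symm := ⟨by
    rintro u v ⟨h, h0⟩
    refine ⟨h.symm, ?_⟩
    rw [← h0]
    congr 2
    exact Sym2.eq_swap⟩
  loopless := ⟨fun u ⟨h, _⟩ => h.ne rfl⟩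

lemma zeroGraph_le : Γ.zeroGraph ℓ ≤ Γ.graph := fun _ _ h => h.1

/-- The map from the vertices of `Γ` to the vertices of the contracted tree, which are the
connected components of the subgraph of edges of length zero. -/
def collapse (v : Γ.V) : (Γ.zeroGraph ℓ).ConnectedComponent :=
  (Γ.zeroGraph ℓ).connectedComponentMk v

/-- The combinatorial type obtained by contracting all edges of length zero. -/
def contractType : StableTree n where
  V := (Γ.zeroGraph ℓ).ConnectedComponent
  finite := have := Γ.finite; inferInstance
  graph := Γ.graph.map (Γ.collapse ℓ)
  isTree := isTree_map Γ.isTree (Γ.zeroGraph_le ℓ)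
  mark i := Γ.collapse ℓ (Γ.mark i)
  stable := have := Γ.finite; stable_map Γ.isTree (Γ.zeroGraph_le ℓ) Γ.mark Γ.stable

/-- Every edge of the contracted tree comes from an edge of positive length. (This edge is unique,
because `Γ` is a tree.) -/
lemma exists_edge_contractType (e : (Γ.contractType ℓ).Edge) :
    ∃ e' : Γ.Edge, Sym2.map (Γ.collapse ℓ) e'.1 = e.1 ∧ 0 < ℓ e' := by
  obtain ⟨e, he⟩ := e
  induction e using Sym2.ind with | _ a b
  obtain ⟨hne, v, w, hvw, hv, hw⟩ := he
  refine ⟨⟨s(v, w), hvw⟩, ?_, pos_iff_ne_zero.2 fun h => hne ?_⟩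
  · exact congrArg₂ (fun x y => s(x, y)) hv hw
  · rw [← hv, ← hw]
    exact SimpleGraph.ConnectedComponent.sound
      (SimpleGraph.Adj.reachable (G := Γ.zeroGraph ℓ) ⟨hvw, h⟩)

/-- The tropical curve obtained from the tree `Γ` with edge lengths `ℓ ≥ 0` by contracting all
edges of length zero; the other edges keep their lengths. -/
def contract : Curve n where
  type := Γ.contractType ℓ
  length e := ℓ (Γ.exists_edge_contractType ℓ e).choose
  length_pos e := NNReal.coe_pos.2 (Γ.exists_edge_contractType ℓ e).choose_spec.2

/-- The closed cone `ℝ_{≥0}^M → M_{0,n}` of the combinatorial type `Γ`, where `M` is the number of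
bounded edges. -/
def cone : Moduli n := Quotient.mk (Curve.setoid n) (Γ.contract ℓ)

/-- The set of the curves of combinatorial type `Γ`. -/
def stratum : Set (Moduli n) :=
  {x | ∃ (ℓ : Γ.Edge → ℝ) (hℓ : ∀ e, 0 < ℓ e), x = Quotient.mk (Curve.setoid n) ⟨Γ, ℓ, hℓ⟩}

/-- `f` is, on the stratum of `Γ`, the function assigning to a curve the length of its edge `e`. -/
def IsEdgeLength (e : Γ.Edge) (f : Moduli n → ℝ) : Prop :=
  ∀ (ℓ : Γ.Edge → ℝ) (hℓ : ∀ e, 0 < ℓ e), f (Quotient.mk (Curve.setoid n) ⟨Γ, ℓ, hℓ⟩) = ℓ e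

end StableTree

/-- The topology of the moduli space: the cones of all combinatorial types are glued along their
faces, i.e. a set is open iff its preimage in every cone is open. -/
instance (n : ℕ) : TopologicalSpace (Moduli n) :=
  ⨆ Γ : StableTree n, TopologicalSpace.coinduced Γ.cone inferInstance

/-- `f` restricted to the subset `A` is regular: near every point of `A`, it is the restriction
of a section of the sheaf `𝒪`. -/
def IsRegularWithin {X : Type*} [TopologicalSpace X] (𝒪 : TropSheaf X) (A : Set X) (f : X → ℝ) :
    Prop :=
  ∀ x ∈ A, ∃ (U : TopologicalSpace.Opens X) (g : U → Trop), x ∈ U ∧ 𝒪.pred (U := U) g ∧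
    ∀ y : U, y.1 ∈ A → g y = realToTrop (f y.1)

end TropMod

end

noncomputable section

namespace TropMod

set_option linter.unusedSectionVars false

/-! ### Unimodular simplicial cones -/

section Cones

variable {ι : Type} [Fintype ι] {α : Type} [Fintype α] [DecidableEq α]

/-! Fix a marking `r`. Cutting a tree at a bounded edge, the markings on the side away from `r` form
a cluster, and the clusters of a tree form a hierarchy: any two are nested or disjoint. Every
hierarchy comes from a stable tree (`IsHierarchy.exists_stableTree`), and weighted clusters
determine the curve (`Curve.iso_of_edgeWeight_eq`). So a curve is a hierarchy with positive weights,
and contracting edges only lets weights vanish (`StableTree.edgeWeight_contract`). In every double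
ratio the edge with cluster `A` contributes its length times the integer `splitVec A`
(`Curve.doubleRatio_eq`). The map to ℝ^N is therefore linear on cones, and its image is the fan of
the cones spanned by the split vectors of hierarchies.

Two facts make this an embedding. For a fixed type every edge length is itself a double ratio
(`IsHierarchy.exists_dual_pairOfPairs`), so all cones are simplicial and unimodular. Globally,
differences of Gromov products based at `r` are integral combinations of double ratios, and the
length of the edge of `A` is the minimum of (a|b) - (b|c) over distinct a, b in `A` and c ≠ `r`
outside `A`; hence double ratios determine the curve (`IsWeight.eq_of_gram`). Only finitely many
cones occur, so the image is closed.

Balancing: a ridge is a maximal hierarchy without one cluster A ⊔ B, whose parent is P = A ⊔ B ⊔ C.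
The adjacent facets restore A ∪ B, A ∪ C or B ∪ C. The three new vectors add up to the vectors of A,
B, C and P, which lie in the lattice of the ridge, because singletons and the cluster of all
markings other than `r` have split vector zero (`IsTriple.sum_mem_closure`). For three facets this
relation is all that balancing needs (`exists_hasIntersectionNumber`).

Simple balancing: select for each cluster a pair of markings whose smallest cluster it is, and let
`L` fix the differences of the Gromov products of the selected pairs. By the ultrametric inequality,
a tree with a maximal hierarchy has the smallest possible Gromov products among all trees with the
same selected values (`IsMaxHierarchy.gram_le`). Exchanging a cluster along the ridge keeps the
selected pairs, so the sum of all Gromov products supports the slice at a single point on either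
side of the ridge.

For the sheaf, different choices of `S` give the same coordinates up to sign and repetition, hence
the same regular functions. Since the image is closed in ℝ^N, it is open in its closure in 𝕋^N, so
the moduli space is a tropical variety with a single chart. -/

/-- An integral vector, viewed as a real vector. -/
def rvec (z : ι → ℤ) : ι → ℝ := fun i => (z i : ℝ)

/-- The linear form with the integral coefficient vector `m`. -/
def pairing (m : ι → ℤ) : (ι → ℝ) →ₗ[ℝ] ℝ := ∑ i, (m i : ℝ) • LinearMap.proj i

lemma pairing_apply (m : ι → ℤ) (x : ι → ℝ) : pairing m x = ∑ i, (m i : ℝ) * x i := by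
  simp [pairing]

lemma pairing_rvec (m z : ι → ℤ) : pairing m (rvec z) = ((∑ i, m i * z i : ℤ) : ℝ) := by
  simp [pairing_apply, rvec]

lemma continuous_pairing (m : ι → ℤ) : Continuous (pairing m) :=
  LinearMap.continuous_of_finiteDimensional _

/-- The linear combinations of a family of integral vectors. -/
def comb (v : α → ι → ℤ) : (α → ℝ) →ₗ[ℝ] (ι → ℝ) :=
  Fintype.linearCombination ℝ (fun a => rvec (v a))

lemma comb_apply (v : α → ι → ℤ) (l : α → ℝ) : comb v l = ∑ a, l a • rvec (v a) :=
  Fintype.linearCombination_apply ..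

/-- The cone generated by the vectors `v a` with `a ∈ s`. -/
def coneOf (v : α → ι → ℤ) (s : Finset α) : Set (ι → ℝ) :=
  {x | ∃ l : α → ℝ, (∀ a, 0 ≤ l a) ∧ (∀ a, a ∉ s → l a = 0) ∧ comb v l = x}

/-- The linear span of the vectors `v a` with `a ∈ s`. -/
def spanOf (v : α → ι → ℤ) (s : Finset α) : Submodule ℝ (ι → ℝ) :=
  Submodule.span ℝ ((fun a => rvec (v a)) '' s)

/-- The integral linear forms `m a` are dual to the vectors `v a`, for `a ∈ s`. -/
def IsDual (v : α → ι → ℤ) (s : Finset α) (m : α → ι → ℤ) : Prop :=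
  ∀ a ∈ s, ∀ b ∈ s, ∑ i, m a i * v b i = if a = b then 1 else 0

/-- The coordinates of a vector with respect to dual linear forms. -/
def coords (m : α → ι → ℤ) (s : Finset α) (x : ι → ℝ) : α → ℝ :=
  fun a => if a ∈ s then pairing (m a) x else 0

variable {v : α → ι → ℤ} {s t : Finset α} {m : α → ι → ℤ}

lemma pairing_comb (z : ι → ℤ) (l : α → ℝ) :
    pairing z (comb v l) = ∑ a, l a * ((∑ i, z i * v a i : ℤ) : ℝ) := by
  rw [comb_apply, map_sum]
  simp only [map_smul, pairing_rvec, smul_eq_mul]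

lemma IsDual.mono (h : IsDual v s m) (hts : t ⊆ s) : IsDual v t m :=
  fun a ha b hb => h a (hts ha) b (hts hb)

lemma IsDual.pairing_comb (h : IsDual v s m) {l : α → ℝ} (hl : ∀ a, a ∉ s → l a = 0) {a : α}
    (ha : a ∈ s) : pairing (m a) (comb v l) = l a := by
  rw [TropMod.pairing_comb, Finset.sum_eq_single a]
  · rw [h a ha a ha]; simp
  · intro b _ hb
    by_cases hbs : b ∈ s
    · rw [h a ha b hbs, if_neg hb.symm]; simp
    · rw [hl b hbs, zero_mul]
  · simp

lemma IsDual.coords_comb (h : IsDual v s m) {l : α → ℝ} (hl : ∀ a, a ∉ s → l a = 0) :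
    coords m s (comb v l) = l := by
  ext a
  unfold coords
  split_ifs with ha
  · exact h.pairing_comb hl ha
  · exact (hl a ha).symm

lemma coords_of_notMem {x : ι → ℝ} {a : α} (ha : a ∉ s) : coords m s x a = 0 := if_neg ha

lemma coords_of_mem {x : ι → ℝ} {a : α} (ha : a ∈ s) : coords m s x a = pairing (m a) x :=
  if_pos ha

lemma comb_mem_spanOf {l : α → ℝ} (hl : ∀ a, a ∉ s → l a = 0) : comb v l ∈ spanOf v s := by
  rw [comb_apply]
  refine Submodule.sum_mem _ fun a _ => ?_
  by_cases ha : a ∈ s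
  · exact Submodule.smul_mem _ _ (Submodule.subset_span ⟨a, ha, rfl⟩)
  · rw [hl a ha, zero_smul]; exact Submodule.zero_mem _

lemma comb_single (a : α) (c : ℝ) : comb v (Pi.single a c) = c • rvec (v a) := by
  rw [comb, Fintype.linearCombination_apply_single]

/-- Taking coordinates and recombining is the projection onto the span along the common kernel of
the dual forms, and the span is its set of fixed points. -/
lemma IsDual.mem_spanOf_iff (h : IsDual v s m) {x : ι → ℝ} :
    x ∈ spanOf v s ↔ comb v (coords m s x) = x := by
  constructor
  · intro hx
    induction hx using Submodule.span_induction with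
    | mem x hx =>
      obtain ⟨a, ha, rfl⟩ := hx
      have h1 : ∀ b, b ∉ s → (Pi.single a 1 : α → ℝ) b = 0 := fun b hb =>
        Pi.single_eq_of_ne (ne_of_mem_of_not_mem ha hb).symm _
      have h2 := h.coords_comb h1
      rw [comb_single, one_smul] at h2
      simp only [h2, comb_single, one_smul]
    | zero =>
      have : coords m s 0 = 0 := by ext a; simp [coords]
      rw [this, map_zero]
    | add x y _ _ hx hy =>
      have : coords m s (x + y) = coords m s x + coords m s y := by
        ext a; simp only [coords, Pi.add_apply]; split_ifs <;> simp
      rw [this, map_add, hx, hy]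
    | smul c x _ hx =>
      have : coords m s (c • x) = c • coords m s x := by
        ext a; simp only [coords, Pi.smul_apply]; split_ifs <;> simp
      rw [this, map_smul, hx]
  · intro hx
    rw [← hx]
    exact comb_mem_spanOf fun a ha => coords_of_notMem ha

lemma coneOf_subset_spanOf : coneOf v s ⊆ spanOf v s := by
  rintro x ⟨l, -, hl, rfl⟩
  exact comb_mem_spanOf hl

lemma IsDual.mem_coneOf_iff (h : IsDual v s m) {x : ι → ℝ} :
    x ∈ coneOf v s ↔ x ∈ spanOf v s ∧ ∀ a ∈ s, 0 ≤ pairing (m a) x := by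
  constructor
  · rintro ⟨l, h0, hl, rfl⟩
    exact ⟨comb_mem_spanOf hl, fun a ha => by rw [h.pairing_comb hl ha]; exact h0 a⟩
  · rintro ⟨hx, h0⟩
    refine ⟨coords m s x, fun a => ?_, fun a ha => coords_of_notMem ha, h.mem_spanOf_iff.1 hx⟩
    by_cases ha : a ∈ s
    · rw [coords_of_mem ha]; exact h0 a ha
    · rw [coords_of_notMem ha]

lemma zero_mem_coneOf : (0 : ι → ℝ) ∈ coneOf v s := ⟨0, by simp, by simp, by simp⟩

lemma coneOf_mono (hts : t ⊆ s) : coneOf v t ⊆ coneOf v s := by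
  rintro x ⟨l, h0, hl, rfl⟩
  exact ⟨l, h0, fun a ha => hl a fun h => ha (hts h), rfl⟩

lemma rvec_mem_coneOf {a : α} (ha : a ∈ s) : rvec (v a) ∈ coneOf v s := by
  refine ⟨Pi.single a 1, fun b => ?_, fun b hb => Pi.single_eq_of_ne (ne_of_mem_of_not_mem ha hb).symm _, ?_⟩
  · rw [Pi.single_apply]; split_ifs <;> norm_num
  · rw [comb_single, one_smul]

lemma span_coneOf : Submodule.span ℝ (coneOf v s) = spanOf v s := by
  refine le_antisymm (Submodule.span_le.2 coneOf_subset_spanOf) (Submodule.span_mono ?_)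
  rintro _ ⟨a, ha, rfl⟩
  exact rvec_mem_coneOf ha

lemma vectorSpan_coneOf : vectorSpan ℝ (coneOf v s) = spanOf v s := by
  rw [vectorSpan_eq_span_vsub_set_right ℝ (zero_mem_coneOf (v := v) (s := s))]
  simp [span_coneOf]

lemma coe_affineSpan_coneOf : (affineSpan ℝ (coneOf v s) : Set (ι → ℝ)) = spanOf v s := by
  ext x
  have h0 : (0 : ι → ℝ) ∈ affineSpan ℝ (coneOf v s) := subset_affineSpan _ _ zero_mem_coneOf
  rw [SetLike.mem_coe, SetLike.mem_coe, ← AffineSubspace.vsub_right_mem_direction_iff_mem h0,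
    direction_affineSpan, vectorSpan_coneOf, vsub_eq_sub, sub_zero]

lemma IsDual.linearIndependent (h : IsDual v s m) :
    LinearIndependent ℝ (fun a : s => rvec (v a.1)) := by
  rw [Fintype.linearIndependent_iff]
  intro g hg a
  have h1 := congrArg (pairing (m a.1)) hg
  rw [map_sum, map_zero] at h1
  simp only [map_smul, pairing_rvec, smul_eq_mul] at h1
  rw [Finset.sum_eq_single a] at h1
  · rw [h a.1 a.2 a.1 a.2] at h1
    simpa using h1
  · intro b _ hb
    rw [h a.1 a.2 b.1 b.2, if_neg fun e => hb (Subtype.ext e.symm)]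
    simp
  · simp

lemma IsDual.finrank_spanOf (h : IsDual v s m) : Module.finrank ℝ (spanOf v s) = s.card := by
  have h1 := finrank_span_eq_card h.linearIndependent
  rw [Fintype.card_coe] at h1
  rw [← h1, spanOf, Set.image_eq_range]
  rfl

lemma IsDual.polyDim_coneOf (h : IsDual v s m) : polyDim (coneOf v s) = s.card := by
  rw [polyDim, vectorSpan_coneOf, h.finrank_spanOf]

lemma IsDual.isRationalPolyhedron (h : IsDual v s m) : IsRationalPolyhedron (coneOf v s) := by
  classical
  -- Row `i` of the integral matrix "projection minus identity". The vanishing of all rows cuts out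
  -- the span, and each equation is written as two inequalities.
  let c : ι → ι → ℤ := fun i j => ∑ a ∈ s, v a i * m a j - if i = j then 1 else 0
  have hc : ∀ x : ι → ℝ, x ∈ spanOf v s ↔ ∀ i, pairing (c i) x = 0 := by
    intro x
    rw [h.mem_spanOf_iff, funext_iff]
    refine forall_congr' fun i => ?_
    have : pairing (c i) x = comb v (coords m s x) i - x i := by
      rw [pairing_apply, comb_apply, Finset.sum_apply]
      simp only [c, Int.cast_sub, Int.cast_sum, Int.cast_mul, sub_mul, Finset.sum_sub_distrib]
      congr 1
      · simp only [Finset.sum_mul]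
        rw [Finset.sum_comm, ← Finset.sum_subset (Finset.subset_univ s)]
        · refine Finset.sum_congr rfl fun a ha => ?_
          rw [coords_of_mem ha, pairing_apply, Pi.smul_apply, smul_eq_mul, Finset.sum_mul]
          refine Finset.sum_congr rfl fun j _ => ?_
          simp only [rvec]; ring
        · intro a _ ha
          rw [coords_of_notMem ha, zero_smul, Pi.zero_apply]
      · simp
    rw [this, sub_eq_zero]
  refine ⟨s.image (fun a => (-m a, 0)) ∪ Finset.univ.image (fun i => (c i, 0)) ∪
    Finset.univ.image (fun i => (-c i, 0)), ?_⟩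
  ext x
  rw [h.mem_coneOf_iff, hc]
  have key : ∀ (z : ι → ℤ), ∑ i, (((-z) i : ℤ) : ℝ) * x i = - pairing z x := by
    intro z; simp [pairing_apply]
  simp only [Set.mem_ofPred_eq, Finset.mem_union, Finset.mem_image, Finset.mem_univ, true_and]
  constructor
  · rintro ⟨h1, h2⟩ p ((⟨a, ha, rfl⟩ | ⟨i, rfl⟩) | ⟨i, rfl⟩)
    · have := h2 a ha
      rw [key]; simpa using this
    · rw [← pairing_apply]; exact (h1 i).le
    · rw [key, h1 i, neg_zero]
  · intro hp
    refine ⟨fun i => le_antisymm ?_ ?_, fun a ha => ?_⟩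
    · have := hp _ (Or.inl (Or.inr ⟨i, rfl⟩))
      rwa [← pairing_apply] at this
    · have := hp _ (Or.inr ⟨i, rfl⟩)
      rw [key] at this; simpa using this
    · have := hp _ (Or.inl (Or.inl ⟨a, ha, rfl⟩))
      rw [key] at this; simpa using this

/-- The dual forms are integral, so an integral vector of the span has integral coordinates: the
generators are a lattice basis, which is the unimodularity of the cone. -/
lemma IsDual.mem_integerPoints_iff (h : IsDual v s m) {z : ι → ℤ} :
    z ∈ integerPoints (spanOf v s) ↔ z ∈ AddSubgroup.closure (v '' s) := by
  have hmem : ∀ z : ι → ℤ, z ∈ integerPoints (spanOf v s) ↔ rvec z ∈ spanOf v s := fun z => Iff.rfl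
  constructor
  · intro hz
    have h1 := h.mem_spanOf_iff.1 ((hmem z).1 hz)
    have h2 : z = ∑ a ∈ s, (∑ i, m a i * z i) • v a := by
      ext i
      have h3 := congrFun h1 i
      rw [comb_apply, Finset.sum_apply, ← Finset.sum_subset (Finset.subset_univ s)] at h3
      · rw [Finset.sum_apply]
        have h4 : ((z i : ℤ) : ℝ) = ((∑ a ∈ s, (∑ j, m a j * z j) * v a i : ℤ) : ℝ) := by
          rw [show ((z i : ℤ) : ℝ) = rvec z i from rfl, ← h3]
          push_cast
          refine Finset.sum_congr rfl fun a ha => ?_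
          rw [coords_of_mem ha, pairing_rvec]
          simp [rvec]
        exact_mod_cast h4
      · intro a _ ha
        rw [coords_of_notMem ha, zero_smul, Pi.zero_apply]
    rw [h2]
    refine AddSubgroup.sum_mem _ fun a ha => AddSubgroup.zsmul_mem _ ?_ _
    exact AddSubgroup.subset_closure ⟨a, ha, rfl⟩
  · intro hz
    have : AddSubgroup.closure (v '' s) ≤ integerPoints (spanOf v s) := by
      rw [AddSubgroup.closure_le]
      rintro _ ⟨a, ha, rfl⟩
      exact (hmem _).2 (Submodule.subset_span ⟨a, ha, rfl⟩)
    exact this hz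

lemma IsDual.integerPoints_spanOf (h : IsDual v s m) :
    integerPoints (spanOf v s) = AddSubgroup.closure (v '' s) :=
  AddSubgroup.ext fun _ => h.mem_integerPoints_iff

/-! ### Relative interiors and exposed faces of simplicial cones -/

lemma mem_intrinsicInterior_iff {F : Set (ι → ℝ)} {x : ι → ℝ} :
    x ∈ intrinsicInterior ℝ F ↔
      ∃ U : Set (ι → ℝ), IsOpen U ∧ x ∈ U ∧ x ∈ affineSpan ℝ F ∧ U ∩ affineSpan ℝ F ⊆ F := by
  rw [mem_intrinsicInterior]
  constructor
  · rintro ⟨y, hy, rfl⟩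
    rw [mem_interior] at hy
    obtain ⟨V, hVF, hV, hyV⟩ := hy
    obtain ⟨U, hU, rfl⟩ := isOpen_induced_iff.1 hV
    exact ⟨U, hU, hyV, y.2, fun z hz => hVF (show (⟨z, hz.2⟩ : affineSpan ℝ F) ∈ _ from hz.1)⟩
  · rintro ⟨U, hU, hxU, hx, hUF⟩
    refine ⟨⟨x, hx⟩, ?_, rfl⟩
    rw [mem_interior]
    exact ⟨Subtype.val ⁻¹' U, fun z hz => hUF ⟨hz, z.2⟩, hU.preimage continuous_subtype_val, hxU⟩

lemma IsDual.mem_intrinsicInterior_iff (h : IsDual v s m) {x : ι → ℝ} :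
    x ∈ intrinsicInterior ℝ (coneOf v s) ↔ x ∈ spanOf v s ∧ ∀ a ∈ s, 0 < pairing (m a) x := by
  rw [TropMod.mem_intrinsicInterior_iff]
  simp only [← SetLike.mem_coe, coe_affineSpan_coneOf]
  constructor
  · rintro ⟨U, hU, hxU, hx, hUF⟩
    refine ⟨hx, fun a ha => ?_⟩
    -- A relatively interior point can be moved a little along `-v a` without leaving the cone, so
    -- its `a`-coordinate has room to decrease.
    have hcont : Continuous fun ε : ℝ => x - ε • rvec (v a) := by fun_prop
    have h0 : (fun ε : ℝ => x - ε • rvec (v a)) ⁻¹' U ∈ 𝓝 (0 : ℝ) :=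
      hcont.continuousAt.preimage_mem_nhds (hU.mem_nhds (by simpa using hxU))
    obtain ⟨δ, hδ, hball⟩ := Metric.mem_nhds_iff.1 h0
    have h1 : (δ / 2) ∈ Metric.ball (0 : ℝ) δ := by
      rw [Metric.mem_ball, Real.dist_eq, sub_zero, abs_of_pos (half_pos hδ)]; linarith
    have h2 := hUF ⟨hball h1, Submodule.sub_mem _ hx
      (Submodule.smul_mem _ _ (Submodule.subset_span ⟨a, ha, rfl⟩))⟩
    have h3 := (h.mem_coneOf_iff.1 h2).2 a ha
    rw [map_sub, map_smul, pairing_rvec, h a ha a ha] at h3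
    simp at h3
    linarith
  · rintro ⟨hx, h0⟩
    refine ⟨⋂ a ∈ s, {y | 0 < pairing (m a) y}, ?_, ?_, hx, ?_⟩
    · exact isOpen_biInter_finset fun a _ => isOpen_lt continuous_const (continuous_pairing _)
    · simpa using h0
    · rintro y ⟨hy, hys⟩
      simp only [Set.mem_iInter, Set.mem_ofPred_eq] at hy
      exact h.mem_coneOf_iff.2 ⟨hys, fun a ha => (hy a ha).le⟩

/-- A subcone on a subset of the generators is an exposed face. -/
lemma IsDual.isExposed_coneOf (h : IsDual v s m) (hts : t ⊆ s) :
    IsExposed ℝ (coneOf v s) (coneOf v t) := by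
  intro _
  -- Minus the sum of the coordinates outside `t`: at most zero on the cone, and zero exactly on the
  -- subcone.
  let l : (ι → ℝ) →ₗ[ℝ] ℝ := - ∑ a ∈ s \ t, pairing (m a)
  have hl : ∀ x, l x = - ∑ a ∈ s \ t, pairing (m a) x := fun x => by simp [l]
  refine ⟨LinearMap.toContinuousLinearMap l, ?_⟩
  ext x
  simp only [LinearMap.coe_toContinuousLinearMap', Set.mem_ofPred_eq]
  have hle : ∀ y ∈ coneOf v s, l y ≤ 0 := fun y hy => by
    rw [hl, neg_nonpos]
    exact Finset.sum_nonneg fun a ha => (h.mem_coneOf_iff.1 hy).2 a (Finset.mem_sdiff.1 ha).1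
  constructor
  · rintro ⟨c, h0, hc, rfl⟩
    refine ⟨⟨c, h0, fun a ha => hc a fun h => ha (hts h), rfl⟩, fun y hy => ?_⟩
    refine (hle y hy).trans ?_
    rw [hl, Finset.sum_eq_zero, neg_zero]
    intro a ha
    rw [Finset.mem_sdiff] at ha
    rw [h.pairing_comb (fun a ha => hc a fun h => ha (hts h)) ha.1, hc a ha.2]
  · rintro ⟨hx, hmax⟩
    have h0 := hmax 0 zero_mem_coneOf
    rw [map_zero, hl, neg_nonneg] at h0
    have h1 := (Finset.sum_eq_zero_iff_of_nonneg fun a ha =>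
      (h.mem_coneOf_iff.1 hx).2 a (Finset.mem_sdiff.1 ha).1).1
      (le_antisymm h0 (Finset.sum_nonneg fun a ha =>
      (h.mem_coneOf_iff.1 hx).2 a (Finset.mem_sdiff.1 ha).1))
    obtain ⟨c, hc0, hc, rfl⟩ := hx
    refine ⟨c, hc0, fun a ha => ?_, rfl⟩
    by_cases has : a ∈ s
    · rw [← h.pairing_comb hc has]
      exact h1 a (Finset.mem_sdiff.2 ⟨has, ha⟩)
    · exact hc a has

/-- Every nonempty exposed face is a subcone on a subset of the generators. -/
lemma exists_of_isExposed_coneOf {E : Set (ι → ℝ)}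
    (hE : IsExposed ℝ (coneOf v s) E) (hne : E.Nonempty) : ∃ t ⊆ s, E = coneOf v t := by
  obtain ⟨l, rfl⟩ := hE hne
  obtain ⟨x, hx, hmax⟩ := hne
  -- The cone is closed under addition, so a linear form attaining its maximum on it has maximum 0.
  -- The face is then spanned by the generators on which the form vanishes.
  have hadd : ∀ y ∈ coneOf v s, ∀ z ∈ coneOf v s, y + z ∈ coneOf v s := by
    rintro _ ⟨c, h0, hc, rfl⟩ _ ⟨d, h0', hd, rfl⟩
    exact ⟨c + d, fun a => add_nonneg (h0 a) (h0' a), fun a ha => by simp [hc a ha, hd a ha],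
      map_add _ _ _⟩
  have hneg : ∀ y ∈ coneOf v s, l y ≤ 0 := by
    intro y hy
    have := hmax _ (hadd x hx y hy)
    rw [map_add] at this
    linarith
  have hx0 : l x = 0 := le_antisymm (hneg x hx) (by simpa using hmax 0 zero_mem_coneOf)
  classical
  have hlc : ∀ c : α → ℝ, l (comb v c) = ∑ a, c a * l (rvec (v a)) := fun c => by
    rw [comb_apply, map_sum]; simp
  refine ⟨s.filter fun a => l (rvec (v a)) = 0, Finset.filter_subset _ _, ?_⟩
  ext y
  constructor
  · rintro ⟨⟨c, h0, hc, rfl⟩, hy⟩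
    have hy0 : l (comb v c) = 0 := le_antisymm (hneg _ ⟨c, h0, hc, rfl⟩) (hx0 ▸ hy x hx)
    rw [hlc, Finset.sum_eq_zero_iff_of_nonpos] at hy0
    · refine ⟨c, h0, fun a ha => ?_, rfl⟩
      by_cases has : a ∈ s
      · have : l (rvec (v a)) ≠ 0 := fun e => ha (Finset.mem_filter.2 ⟨has, e⟩)
        exact (mul_eq_zero.1 (hy0 a (Finset.mem_univ a))).resolve_right this
      · exact hc a has
    · intro a _
      by_cases has : a ∈ s
      · exact mul_nonpos_of_nonneg_of_nonpos (h0 a) (hneg _ (rvec_mem_coneOf has))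
      · rw [hc a has, zero_mul]
  · rintro ⟨c, h0, hc, rfl⟩
    have hcs : comb v c ∈ coneOf v s := coneOf_mono (Finset.filter_subset _ _) ⟨c, h0, hc, rfl⟩
    refine ⟨hcs, fun z hz => ?_⟩
    have : l (comb v c) = 0 := by
      rw [hlc]
      refine Finset.sum_eq_zero fun a _ => ?_
      by_cases has : a ∈ s.filter fun a => l (rvec (v a)) = 0
      · rw [(Finset.mem_filter.1 has).2, mul_zero]
      · rw [hc a has, zero_mul]
    rw [this]
    exact hneg z hz

end Cones

/-! ### Lattice indices and the balancing of three facets -/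

section Balancing

/-- The index of `K + ℤu` splits along `h`. Inside the kernel of `h` only `K` remains, since `h u ≠
0`; the image of `h` contributes the index of `(h u)ℤ` in `gℤ`. Hence for varying `u` the index is
proportional to `|h u|`. -/
lemma index_sup_zmultiples {A : Type*} [AddCommGroup A] {K : AddSubgroup A} {h : A →+ ℤ}
    (hK : K ≤ h.ker) {g : ℤ} (hg : h.range = AddSubgroup.zmultiples g) {u : A} (hu : h u ≠ 0) :
    (K ⊔ AddSubgroup.zmultiples u).index * g.natAbs = K.relIndex h.ker * (h u).natAbs := by
  set Z := AddSubgroup.zmultiples u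
  have h1 : (K ⊔ Z) ⊓ h.ker = K := by
    refine le_antisymm ?_ (le_inf le_sup_left hK)
    rintro x ⟨hx, hx0⟩
    obtain ⟨y, hy, z, hz, rfl⟩ := AddSubgroup.mem_sup.1 hx
    obtain ⟨c, rfl⟩ := AddSubgroup.mem_zmultiples_iff.1 hz
    have hy0 : h y = 0 := hK hy
    have hx1 : h (y + c • u) = 0 := hx0
    rw [map_add, hy0, zero_add, map_zsmul, smul_eq_mul, mul_eq_zero] at hx1
    rw [hx1.resolve_right hu, zero_smul, add_zero]
    exact hy
  have h2 : (K ⊔ Z).relIndex (h.ker ⊔ Z) = K.relIndex h.ker := by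
    have : h.ker ⊔ Z = h.ker ⊔ (K ⊔ Z) := by rw [← sup_assoc, sup_eq_left.2 hK]
    rw [this, AddSubgroup.relIndex_sup_right, ← AddSubgroup.inf_relIndex_right, h1]
  have h3 : (h.ker ⊔ Z).index * g.natAbs = (h u).natAbs := by
    have : h.ker ⊔ Z = (AddSubgroup.zmultiples (h u)).comap h := by
      rw [← AddMonoidHom.map_zmultiples, AddSubgroup.comap_map_eq, sup_comm]
    rw [this, AddSubgroup.index_comap, hg, ← Int.index_zmultiples g,
      AddSubgroup.relIndex_mul_index, Int.index_zmultiples]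
    rw [AddSubgroup.zmultiples_le, ← hg]
    exact ⟨u, rfl⟩
  rw [← AddSubgroup.relIndex_mul_index (sup_le_sup_right hK Z), h2, mul_assoc, h3]

variable {ι : Type} [Fintype ι] {α : Type} [Fintype α] [DecidableEq α]
variable {v : α → ι → ℤ} {s t : Finset α} {m : α → ι → ℤ} {k : ℕ}

/-- A proper rational subspace is contained in the kernel of a nonzero integral form. -/
lemma exists_integral_form (T : Set (ι → ℤ)) (hT : Submodule.span ℝ (rvec '' T) ≠ ⊤) :
    ∃ h : ι → ℤ, h ≠ 0 ∧ ∀ z ∈ T, ∑ i, h i * z i = 0 := by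
  classical
  let q : (ι → ℤ) → (ι → ℚ) := fun z i => z i
  -- Over ℚ the span is still proper, since a rational spanning set would also span over ℝ. A
  -- rational form vanishing on it exists, and clearing denominators makes it integral.
  have hq : Submodule.span ℚ (q '' T) < ⊤ := by
    rw [lt_top_iff_ne_top]
    intro htop
    refine hT (eq_top_iff.2 fun x _ => ?_)
    let c : (ι → ℚ) →ₗ[ℚ] (ι → ℝ) :=
      LinearMap.pi fun i => (Algebra.linearMap ℚ ℝ).comp (LinearMap.proj i)
    have hc : ∀ y : ι → ℚ, c y ∈ Submodule.span ℝ (rvec '' T) := by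
      intro y
      have hy : y ∈ Submodule.span ℚ (q '' T) := htop ▸ Submodule.mem_top
      induction hy using Submodule.span_induction with
      | mem y hy =>
        obtain ⟨z, hz, rfl⟩ := hy
        refine Submodule.subset_span ⟨z, hz, ?_⟩
        ext i; simp [c, q, rvec]
      | zero => simp
      | add y z _ _ hy hz => rw [map_add]; exact Submodule.add_mem _ hy hz
      | smul a y _ hy =>
        rw [map_smul, ← algebraMap_smul ℝ a]
        exact Submodule.smul_mem _ _ hy
    have hx : x = ∑ i, x i • c (Pi.single i 1) := by
      ext j
      simp [c, Pi.single_apply]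
    rw [hx]
    exact Submodule.sum_mem _ fun i _ => Submodule.smul_mem _ _ (hc _)
  obtain ⟨f, hf0, hf⟩ := Submodule.exists_le_ker_of_lt_top _ hq
  obtain ⟨b, hb⟩ := IsLocalization.exist_integer_multiples_of_finset (nonZeroDivisors ℤ)
    (Finset.univ.image fun i : ι => f (Pi.single i 1))
  have hb0 : (b : ℤ) ≠ 0 := nonZeroDivisors.coe_ne_zero b
  have hb' : ∀ i, ∃ a : ℤ, (a : ℚ) = (b : ℤ) * f (Pi.single i 1) := by
    intro i
    obtain ⟨a, ha⟩ := hb _ (Finset.mem_image_of_mem _ (Finset.mem_univ i))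
    exact ⟨a, by simpa using ha⟩
  choose h hh using hb'
  have hfsum : ∀ y : ι → ℚ, f y = ∑ i, y i * f (Pi.single i 1) := by
    intro y
    conv_lhs => rw [pi_eq_sum_univ y]
    rw [map_sum]
    refine Finset.sum_congr rfl fun i _ => ?_
    rw [map_smul, smul_eq_mul]
    congr 2
    ext j; simp [Pi.single_apply, eq_comm]
  refine ⟨h, fun h0 => hf0 ?_, fun z hz => ?_⟩
  · refine LinearMap.ext fun y => ?_
    rw [hfsum, LinearMap.zero_apply]
    refine Finset.sum_eq_zero fun i _ => ?_
    have := hh i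
    rw [h0] at this
    have h1 : f (Pi.single i 1) = 0 := by
      have h2 : ((b : ℤ) : ℚ) * f (Pi.single i 1) = 0 := by rw [← this]; simp
      exact (mul_eq_zero.1 h2).resolve_left (Int.cast_ne_zero.2 hb0)
    rw [h1, mul_zero]
  · have h1 : f (q z) = 0 := hf (Submodule.subset_span ⟨z, hz, rfl⟩)
    have h2 : ((∑ i, h i * z i : ℤ) : ℚ) = (b : ℤ) * f (q z) := by
      rw [hfsum, Finset.mul_sum]
      push_cast
      refine Finset.sum_congr rfl fun i _ => ?_
      rw [hh]; simp only [q]; ring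
    rw [h1, mul_zero] at h2
    exact_mod_cast h2

/-- The additive homomorphism on integral vectors given by an integral form. -/
def intPairing (h : ι → ℤ) : (ι → ℤ) →+ ℤ :=
  AddMonoidHom.mk' (fun z => ∑ i, h i * z i) fun a b => by
    simp [mul_add, Finset.sum_add_distrib]

lemma intPairing_apply (h z : ι → ℤ) : intPairing h z = ∑ i, h i * z i := rfl

lemma pairing_rvec' (h z : ι → ℤ) : pairing h (rvec z) = (intPairing h z : ℝ) := pairing_rvec h z

lemma spanOf_insert (u : α) (t : Finset α) :
    spanOf v (insert u t) = Submodule.span ℝ {rvec (v u)} ⊔ spanOf v t := by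
  rw [spanOf, spanOf, Finset.coe_insert, Set.image_insert_eq, Submodule.span_insert]

/-- For small translations, a facet that is transversal to `L` meets `L + w` according to the sign
of an integral form vanishing on `L` and on the ridge. -/
lemma IsDual.eventually_meets {u : α} (hd : IsDual v (insert u t) m)
    {L : AffineSubspace ℝ (ι → ℝ)} (hc : IsCompl (spanOf v (insert u t)) L.direction)
    {p : ι → ℝ} (hpL : p ∈ L) (hp : p ∈ intrinsicInterior ℝ (coneOf v t))
    {h : ι → ℤ} (hL : ∀ x ∈ L.direction, pairing h x = 0) (ht : ∀ x ∈ spanOf v t, pairing h x = 0)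
    (hhu : intPairing h (v u) ≠ 0) :
    ∀ᶠ w in 𝓝 (0 : ι → ℝ),
      ((coneOf v (insert u t) ∩ translate L w).Nonempty ↔
        0 ≤ pairing h w * (intPairing h (v u) : ℝ)) ∧
      (IsGeneric (coneOf v (insert u t)) L w → (coneOf v (insert u t) ∩ translate L w).Nonempty →
        0 < pairing h w * (intPairing h (v u) : ℝ)) := by
  set c : ℝ := (intPairing h (v u) : ℝ) with hcdef
  have hc0 : c ≠ 0 := Int.cast_ne_zero.2 hhu
  have hdt : IsDual v t m := hd.mono (Finset.subset_insert _ _)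
  obtain ⟨hps, hp0⟩ := hdt.mem_intrinsicInterior_iff.1 hp
  -- Projection onto the span of the facet along `L`. The translate `L + w` meets this span in the
  -- single point `p + π w`.
  let π := Submodule.projection _ _ hc
  have hπs : ∀ w, π w ∈ spanOf v (insert u t) := fun w => Submodule.projection_apply_mem hc w
  have hπL : ∀ w, w - π w ∈ L.direction := fun w => by
    rw [← Submodule.projection_eq_self_sub_projection hc]
    exact Submodule.projection_apply_mem hc.symm w
  have hps' : p ∈ spanOf v (insert u t) := by
    rw [spanOf_insert]; exact Submodule.mem_sup_right hps
  have hmem : ∀ w, p + π w ∈ spanOf v (insert u t) := fun w => Submodule.add_mem _ hps' (hπs w)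
  have htr : ∀ w, p + π w ∈ translate L w := by
    intro w
    have : p + π w - w = -(w - π w) +ᵥ p := by rw [vadd_eq_add]; abel
    show p + π w - w ∈ L
    rw [this]
    exact AffineSubspace.vadd_mem_of_mem_direction (Submodule.neg_mem _ (hπL w)) hpL
  have huniq : ∀ w, ∀ x ∈ spanOf v (insert u t), x ∈ translate L w → x = p + π w := by
    intro w x hx hxw
    have h1 : x - w - p ∈ L.direction := AffineSubspace.vsub_mem_direction hxw hpL
    have h2 : x - (p + π w) ∈ L.direction := by
      have : x - (p + π w) = (x - w - p) + (w - π w) := by abel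
      rw [this]; exact Submodule.add_mem _ h1 (hπL w)
    have h3 := Submodule.disjoint_def.1 hc.disjoint _ (Submodule.sub_mem _ hx (hmem w)) h2
    exact sub_eq_zero.1 h3
  -- the coordinate in the direction `u`
  have hcoord : ∀ w, pairing (m u) (p + π w) * c = pairing h w := by
    intro w
    have h1 : pairing h (p + π w) = pairing h w := by
      rw [map_add, ht p hps, zero_add]
      have := hL _ (hπL w)
      rw [map_sub] at this; linarith
    rw [← h1]
    conv_rhs => rw [← hd.mem_spanOf_iff.1 (hmem w)]
    rw [TropMod.pairing_comb, Finset.sum_eq_single u]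
    · rw [coords_of_mem (Finset.mem_insert_self _ _)]; rfl
    · intro b _ hb
      by_cases hbt : b ∈ t
      · have := ht (rvec (v b)) (Submodule.subset_span ⟨b, hbt, rfl⟩)
        rw [pairing_rvec] at this
        rw [this, mul_zero]
      · rw [coords_of_notMem (by simp [hb, hbt]), zero_mul]
    · simp
  have hπ : Continuous π := LinearMap.continuous_of_finiteDimensional _
  -- The point `p` is interior to the ridge, so for small `w` the coordinates in `t` stay positive.
  -- Whether the facet is met depends only on the coordinate of `u`.
  have hpos : ∀ᶠ w in 𝓝 (0 : ι → ℝ), ∀ a ∈ t, 0 < pairing (m a) (p + π w) := by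
    rw [Filter.eventually_all_finset]
    intro a ha
    have hcont : Continuous fun w => pairing (m a) (p + π w) :=
      (continuous_pairing _).comp (continuous_const.add hπ)
    refine hcont.continuousAt.eventually (lt_mem_nhds ?_)
    simpa using hp0 a ha
  filter_upwards [hpos] with w hw
  have hiff : (coneOf v (insert u t) ∩ translate L w).Nonempty ↔ 0 ≤ pairing h w * c := by
    have h1 : (coneOf v (insert u t) ∩ translate L w).Nonempty ↔ p + π w ∈ coneOf v (insert u t) := by
      constructor
      · rintro ⟨x, hx, hxw⟩
        rwa [← huniq w x (coneOf_subset_spanOf hx) hxw]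
      · intro hx
        exact ⟨_, hx, htr w⟩
    rw [h1, hd.mem_coneOf_iff, Finset.forall_mem_insert, ← hcoord w, mul_assoc,
      mul_nonneg_iff_of_pos_right (mul_self_pos.2 hc0)]
    exact ⟨fun hx => hx.2.1, fun hx => ⟨hmem w, hx, fun a ha => (hw a ha).le⟩⟩
  refine ⟨hiff, fun hgen hne => ?_⟩
  obtain ⟨x, hx, hxw⟩ := hne
  have h2 := (hgen ⟨x, hx, hxw⟩).2 ⟨hx, hxw⟩
  rw [huniq w x (coneOf_subset_spanOf hx) hxw] at h2
  have h3 := (hd.mem_intrinsicInterior_iff.1 h2).2 u (Finset.mem_insert_self _ _)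
  rw [← hcoord w, mul_assoc]
  exact mul_pos h3 (mul_self_pos.2 hc0)

lemma intersectionSum_eq (C : PolyComplex ι k) {E : Set (ι → ℝ)} {F : Fin 3 → Set (ι → ℝ)}
    (hF : Function.Injective F) (hadj : C.adjacent E = Set.range F)
    (L : AffineSubspace ℝ (ι → ℝ)) (w : ι → ℝ) (P : Fin 3 → Prop) [DecidablePred P]
    (hP : ∀ i, (F i ∩ translate L w).Nonempty ↔ P i) :
    C.intersectionSum E L w = ∑ i, if P i then
      (integerPoints (vectorSpan ℝ (F i)) ⊔ integerPoints L.direction).index else 0 := by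
  have h1 : {G | G ∈ C.adjacent E ∧ (G ∩ translate L w).Nonempty} = F '' {i | P i} := by
    ext G
    rw [hadj]
    constructor
    · rintro ⟨⟨i, rfl⟩, hi⟩
      exact ⟨i, (hP i).1 hi, rfl⟩
    · rintro ⟨i, hi, rfl⟩
      exact ⟨⟨i, rfl⟩, (hP i).2 hi⟩
  rw [PolyComplex.intersectionSum, h1, finsum_mem_image hF.injOn,
    finsum_mem_eq_finite_toFinset_sum _ (Set.toFinite _), ← Finset.sum_filter]
  refine Finset.sum_congr ?_ fun _ _ => rfl
  ext i; simp

/-- The balancing condition at a ridge with three adjacent facets: if the sum of the three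
generators lies in the lattice of the ridge, all intersection numbers are well-defined. -/
theorem exists_hasIntersectionNumber (C : PolyComplex ι k) {u : Fin 3 → α} {m : Fin 3 → α → ι → ℤ}
    (hu : ∀ i, u i ∉ t) (hd : ∀ i, IsDual v (insert (u i) t) (m i)) (hcard : t.card + 1 = k)
    (hinj : Function.Injective fun i => coneOf v (insert (u i) t))
    (hadj : C.adjacent (coneOf v t) = Set.range fun i => coneOf v (insert (u i) t))
    (hbal : ∑ i, v (u i) ∈ AddSubgroup.closure (v '' t)) (L : AffineSubspace ℝ (ι → ℝ))
    (hL : C.IsTestSpace (coneOf v t) L) :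
    ∃ d, C.HasIntersectionNumber (coneOf v t) L d := by
  obtain ⟨hdim, hrat, p, hpL, hp⟩ := hL
  have hfin : ∀ i, Module.finrank ℝ (spanOf v (insert (u i) t)) = k := fun i => by
    rw [(hd i).finrank_spanOf, Finset.card_insert_of_notMem (hu i), hcard]
  have hvs : ∀ i, vectorSpan ℝ (coneOf v (insert (u i) t)) = spanOf v (insert (u i) t) :=
    fun i => vectorSpan_coneOf
  have hcompl : ∀ i, spanOf v (insert (u i) t) ⊔ L.direction = ⊤ →
      IsCompl (spanOf v (insert (u i) t)) L.direction := by
    intro i hi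
    refine ⟨?_, codisjoint_iff.2 hi⟩
    have := Submodule.finrank_sup_add_finrank_inf_eq (spanOf v (insert (u i) t)) L.direction
    rw [hi, finrank_top, Module.finrank_fintype_fun_eq_card, hfin i] at this
    rw [disjoint_iff]
    apply Submodule.finrank_eq_zero.1
    omega
  by_cases htrans : ∃ i, spanOf v (insert (u i) t) ⊔ L.direction = ⊤
  swap
  -- If no facet is transversal to `L`, a generic translate meets none of them and the sum is empty.
  · refine ⟨0, Filter.Eventually.of_forall fun w hw => ?_⟩
    rw [intersectionSum_eq C hinj hadj L w (fun _ => False)]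
    · simp
    · intro i
      refine iff_false_intro fun hne => htrans ⟨i, ?_⟩
      have := (hw _ (by rw [hadj]; exact ⟨i, rfl⟩) hne).1
      rwa [hvs] at this
  obtain ⟨i₀, hi₀⟩ := htrans
  -- the integral form vanishing on the ridge and on `L`
  set W : Submodule ℝ (ι → ℝ) := spanOf v t ⊔ L.direction with hW
  have hspan : W = Submodule.span ℝ (rvec '' (v '' t ∪ integerPoints L.direction)) := by
    rw [Set.image_union, Submodule.span_union, hW]
    congr 1
    · rw [Set.image_image]; rfl
    · exact hrat.symm
  have hsup : ∀ i, spanOf v (insert (u i) t) ⊔ L.direction =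
      W ⊔ Submodule.span ℝ {rvec (v (u i))} := fun i => by
    rw [spanOf_insert, hW]; ac_rfl
  have hWfin : Module.finrank ℝ W + 1 ≤ Fintype.card ι := by
    have h1 := Submodule.finrank_sup_add_finrank_inf_eq (spanOf v t) L.direction
    rw [((hd i₀).mono (Finset.subset_insert _ _)).finrank_spanOf, ← hW] at h1
    omega
  have hWtop : W ≠ ⊤ := fun h => by
    rw [h, finrank_top, Module.finrank_fintype_fun_eq_card] at hWfin
    omega
  obtain ⟨h, h0, hT⟩ := exists_integral_form _ (hspan ▸ hWtop)
  have hWle : W ≤ LinearMap.ker (pairing h) := by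
    rw [hspan, Submodule.span_le]
    rintro _ ⟨z, hz, rfl⟩
    rw [SetLike.mem_coe, LinearMap.mem_ker, pairing_rvec, hT z hz, Int.cast_zero]
  have hker0 : pairing h ≠ 0 := fun e => h0 (funext fun i => by
    classical
    have := LinearMap.congr_fun e (Pi.single i 1)
    rw [pairing_apply] at this
    simpa [Pi.single_apply] using this)
  -- One transversal facet exists, so `W` has codimension one. A facet is then transversal to `L`
  -- precisely when `h` does not vanish on its generator outside the ridge.
  have hWker : W = LinearMap.ker (pairing h) := by
    refine Submodule.eq_of_le_of_finrank_le hWle ?_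
    have h1 := Module.finrank_fintype_fun_eq_card (η := ι) ℝ
    have h2 : Module.finrank ℝ (LinearMap.ker (pairing h)) + 1 = Fintype.card ι := by
      rw [← h1, ← LinearMap.finrank_range_add_finrank_ker (pairing h),
        LinearMap.range_eq_top.2 (LinearMap.surjective hker0), finrank_top, Module.finrank_self,
        add_comm]
    have h3 : Fintype.card ι ≤ Module.finrank ℝ W + 1 := by
      rw [← h1, ← finrank_top ℝ (ι → ℝ), ← hi₀, hsup]
      refine (Submodule.finrank_add_le_finrank_add_finrank _ _).trans ?_
      gcongr
      exact (finrank_span_le_card _).trans (by simp)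
    omega
  have htr : ∀ i, intPairing h (v (u i)) ≠ 0 → spanOf v (insert (u i) t) ⊔ L.direction = ⊤ := by
    intro i hi
    rw [hsup, eq_top_iff]
    intro x _
    have hi' : (intPairing h (v (u i)) : ℝ) ≠ 0 := Int.cast_ne_zero.2 hi
    refine Submodule.mem_sup.2 ⟨x - (pairing h x / intPairing h (v (u i))) • rvec (v (u i)), ?_, _,
      Submodule.smul_mem _ _ (Submodule.mem_span_singleton_self _), sub_add_cancel _ _⟩
    rw [hWker, LinearMap.mem_ker, map_sub, map_smul, pairing_rvec', smul_eq_mul,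
      div_mul_cancel₀ _ hi', sub_self]
  have htr' : ∀ i, spanOf v (insert (u i) t) ⊔ L.direction = ⊤ → intPairing h (v (u i)) ≠ 0 := by
    intro i hi e
    rw [hsup, sup_eq_left.2, hWker] at hi
    · exact hker0 (LinearMap.ker_eq_top.1 hi)
    · rw [Submodule.span_le, Set.singleton_subset_iff, hWker, SetLike.mem_coe, LinearMap.mem_ker,
        pairing_rvec', e, Int.cast_zero]
  have hLz : ∀ x ∈ L.direction, pairing h x = 0 := fun x hx => hWle (Submodule.mem_sup_right hx)
  have htz : ∀ x ∈ spanOf v t, pairing h x = 0 := fun x hx => hWle (Submodule.mem_sup_left hx)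
  -- the lattice indices
  set idx : Fin 3 → ℕ := fun i => (integerPoints (vectorSpan ℝ (coneOf v (insert (u i) t))) ⊔
    integerPoints L.direction).index with hidx
  obtain ⟨g, hg⟩ : ∃ g, (intPairing h).range = AddSubgroup.zmultiples g := by
    obtain ⟨g, hg⟩ := Int.subgroup_cyclic (intPairing h).range
    exact ⟨g, by rw [hg, AddSubgroup.zmultiples_eq_closure]⟩
  set K : AddSubgroup (ι → ℤ) := AddSubgroup.closure (v '' t) ⊔ integerPoints L.direction with hK
  have hKker : K ≤ (intPairing h).ker := by
    refine sup_le ((AddSubgroup.closure_le _).2 ?_) fun z hz => ?_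
    · rintro z hz
      exact hT z (Or.inl hz)
    · exact hT z (Or.inr hz)
  -- All indices are multiples of `|h (v (u i))|` with one common factor, because the ridge and `L`
  -- contribute the same lattice `K` each time.
  have hindex : ∀ i, intPairing h (v (u i)) ≠ 0 → idx i * g.natAbs =
      K.relIndex (intPairing h).ker * (intPairing h (v (u i))).natAbs := by
    intro i hi
    rw [← index_sup_zmultiples hKker hg hi, hidx]
    simp only
    rw [hvs, (hd i).integerPoints_spanOf, Finset.coe_insert, Set.image_insert_eq,
      ← Set.singleton_union, AddSubgroup.closure_union, ← AddSubgroup.zmultiples_eq_closure, hK]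
    congr 2
    ac_rfl
  have hg0 : g.natAbs ≠ 0 := by
    intro e
    rw [Int.natAbs_eq_zero] at e
    have : intPairing h (v (u i₀)) ∈ (intPairing h).range := ⟨_, rfl⟩
    rw [hg, e] at this
    exact htr' i₀ hi₀ (by simpa using this)
  have hsum : ∑ i, intPairing h (v (u i)) = 0 := by
    rw [← map_sum]
    exact hKker (le_sup_left (a := AddSubgroup.closure (v '' t)) hbal)
  -- The common value is read off on the side where `h` is positive; the other side will give the
  -- same total since the three values of `h` add up to zero.
  refine ⟨∑ i, if 0 < intPairing h (v (u i)) then idx i else 0, ?_⟩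
  have hmeets : ∀ᶠ w in 𝓝 (0 : ι → ℝ), ∀ i, intPairing h (v (u i)) ≠ 0 →
      ((coneOf v (insert (u i) t) ∩ translate L w).Nonempty ↔
        0 ≤ pairing h w * (intPairing h (v (u i)) : ℝ)) ∧
      (IsGeneric (coneOf v (insert (u i) t)) L w →
        (coneOf v (insert (u i) t) ∩ translate L w).Nonempty →
        0 < pairing h w * (intPairing h (v (u i)) : ℝ)) := by
    rw [Filter.eventually_all]
    intro i
    by_cases hi : intPairing h (v (u i)) = 0
    · exact Filter.Eventually.of_forall fun w hi' => absurd hi hi'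
    · filter_upwards [(hd i).eventually_meets (hcompl i (htr i hi)) hpL hp hLz htz hi]
        with w hw _ using hw
  filter_upwards [hmeets] with w hw hgen
  have hgen' : ∀ i, IsGeneric (coneOf v (insert (u i) t)) L w := fun i =>
    hgen _ (by rw [hadj]; exact ⟨i, rfl⟩)
  -- If `h` vanished at `w`, the translate would meet the transversal facet `i₀` on its boundary,
  -- which genericity forbids.
  have hw0 : pairing h w ≠ 0 := by
    intro e
    obtain ⟨h1, h2⟩ := hw i₀ (htr' i₀ hi₀)
    rw [e, zero_mul] at h1 h2
    exact lt_irrefl _ (h2 (hgen' i₀) (h1.2 le_rfl))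
  have hP : ∀ i, (coneOf v (insert (u i) t) ∩ translate L w).Nonempty ↔
      0 < pairing h w * (intPairing h (v (u i)) : ℝ) := by
    intro i
    by_cases hi : intPairing h (v (u i)) = 0
    · rw [hi, Int.cast_zero, mul_zero]
      refine iff_of_false (fun hne => ?_) (lt_irrefl _)
      have := (hgen' i hne).1
      rw [hvs] at this
      exact htr' i this hi
    · exact ⟨fun hne => (hw i hi).2 (hgen' i) hne, fun hlt => (hw i hi).1.2 hlt.le⟩
  classical
  rw [intersectionSum_eq C hinj hadj L w _ hP]
  refine Nat.eq_of_mul_eq_mul_right (Nat.pos_of_ne_zero hg0) ?_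
  rw [Finset.sum_mul, Finset.sum_mul]
  have hterm : ∀ (i : Fin 3) (Q : Prop) [Decidable Q], (Q → intPairing h (v (u i)) ≠ 0) →
      (if Q then idx i else 0) * g.natAbs = K.relIndex (intPairing h).ker *
        (if Q then (intPairing h (v (u i))).natAbs else 0) := by
    intro i Q _ hQ
    split_ifs with hq
    · exact hindex i (hQ hq)
    · simp
  rw [Finset.sum_congr rfl fun i _ => hterm i _ fun hq e => by simp [e] at hq,
    Finset.sum_congr rfl fun i _ => hterm i _ fun hq => hq.ne', ← Finset.mul_sum, ← Finset.mul_sum]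
  congr 1
  rw [Fin.sum_univ_three] at hsum
  rcases lt_or_gt_of_ne hw0 with hneg | hpos
  -- On the negative side the sum of the absolute values of the negative terms equals the sum of the
  -- positive terms.
  · have hsign : ∀ z : ℤ, 0 < pairing h w * (z : ℝ) ↔ z < 0 := fun z => by
      rw [← neg_mul_neg, mul_pos_iff_of_pos_left (neg_pos.2 hneg), neg_pos, Int.cast_lt_zero]
    simp only [hsign, Fin.sum_univ_three]
    split_ifs <;> omega
  · simp only [mul_pos_iff_of_pos_left hpos, Int.cast_pos]

/-! ### Test spaces cut out by dual forms -/

/-- The subspace cut out by the linear forms `m a` with `a ∈ s`. -/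
def coordKer (m : α → ι → ℤ) (s : Finset α) : Submodule ℝ (ι → ℝ) :=
  ⨅ a ∈ s, LinearMap.ker (pairing (m a))

lemma mem_coordKer {x : ι → ℝ} : x ∈ coordKer m s ↔ ∀ a ∈ s, pairing (m a) x = 0 := by
  simp [coordKer, Submodule.mem_iInf]

lemma IsDual.sub_comb_mem_coordKer (h : IsDual v s m) (x : ι → ℝ) :
    x - comb v (coords m s x) ∈ coordKer m s := by
  rw [mem_coordKer]
  intro a ha
  rw [map_sub, h.pairing_comb (fun a ha => coords_of_notMem ha) ha, coords_of_mem ha, sub_self]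

lemma IsDual.isCompl_coordKer (h : IsDual v s m) : IsCompl (spanOf v s) (coordKer m s) := by
  constructor
  · rw [Submodule.disjoint_def]
    intro x hx hx'
    rw [← h.mem_spanOf_iff.1 hx]
    have : coords m s x = 0 := by
      ext a
      by_cases ha : a ∈ s
      · rw [coords_of_mem ha]; exact mem_coordKer.1 hx' a ha
      · exact coords_of_notMem ha
    rw [this, map_zero]
  · rw [codisjoint_iff, eq_top_iff]
    intro x _
    refine Submodule.mem_sup.2 ⟨comb v (coords m s x), comb_mem_spanOf fun a ha => coords_of_notMem ha, _,
      h.sub_comb_mem_coordKer x, ?_⟩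
    abel

/-- The projection onto the kernel of the dual forms preserves integral vectors. -/
lemma IsDual.sub_sum_mem_integerPoints (h : IsDual v s m) (z : ι → ℤ) :
    z - ∑ a ∈ s, intPairing (m a) z • v a ∈ integerPoints (coordKer m s) := by
  show rvec (z - ∑ a ∈ s, intPairing (m a) z • v a) ∈ coordKer m s
  have : rvec (z - ∑ a ∈ s, intPairing (m a) z • v a) =
      rvec z - comb v (coords m s (rvec z)) := by
    ext i
    rw [Pi.sub_apply, comb_apply, ← Finset.sum_subset (Finset.subset_univ s)
      (fun a _ ha => by rw [coords_of_notMem ha, zero_smul]), Finset.sum_apply]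
    simp only [rvec, Pi.sub_apply, Finset.sum_apply, Int.cast_sub, Int.cast_sum]
    congr 1
    refine Finset.sum_congr rfl fun a ha => ?_
    rw [coords_of_mem ha]
    show _ = pairing (m a) (rvec z) * _
    rw [pairing_rvec']
    simp [rvec]
  rw [this]
  exact h.sub_comb_mem_coordKer _

lemma IsDual.isRationalSubspace_coordKer (h : IsDual v s m) :
    IsRationalSubspace (coordKer m s) := by
  classical
  refine le_antisymm (Submodule.span_le.2 ?_) fun x hx => ?_
  · rintro _ ⟨z, hz, rfl⟩
    exact hz
  -- A vector of the kernel equals its own projection, so it is a combination of the projected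
  -- standard basis vectors, which are integral.
  · have hx' : x = ∑ i, x i • rvec (Pi.single i 1 - ∑ a ∈ s, intPairing (m a) (Pi.single i 1) • v a) := by
      have h1 : ∀ i, rvec (Pi.single i 1 - ∑ a ∈ s, intPairing (m a) (Pi.single i 1) • v a) =
          Pi.single i 1 - ∑ a ∈ s, (m a i : ℝ) • rvec (v a) := by
        intro i
        ext j
        simp [rvec, intPairing_apply, Pi.single_apply]
      have h2 : ∑ i, x i • ∑ a ∈ s, (m a i : ℝ) • rvec (v a) = 0 := by
        simp only [Finset.smul_sum, smul_smul]
        rw [Finset.sum_comm]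
        refine Finset.sum_eq_zero fun a ha => ?_
        have h3 := mem_coordKer.1 hx a ha
        rw [← Finset.sum_smul]
        rw [pairing_apply] at h3
        simp_rw [mul_comm (x _)]
        rw [h3, zero_smul]
      simp only [h1, smul_sub, Finset.sum_sub_distrib, h2, sub_zero]
      ext j
      simp [Pi.single_apply]
    rw [hx']
    exact Submodule.sum_mem _ fun i _ => Submodule.smul_mem _ _
      (Submodule.subset_span ⟨_, h.sub_sum_mem_integerPoints _, rfl⟩)

/-- Every integral vector splits into its integral coordinates along the generators and an integral
vector of the kernel. -/
lemma IsDual.index_eq_one (h : IsDual v s m) :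
    (integerPoints (spanOf v s) ⊔ integerPoints (coordKer m s)).index = 1 := by
  rw [AddSubgroup.index_eq_one, eq_top_iff]
  intro z _
  rw [h.integerPoints_spanOf, AddSubgroup.mem_sup]
  refine ⟨∑ a ∈ s, intPairing (m a) z • v a, ?_, _,
    h.sub_sum_mem_integerPoints z, add_sub_cancel _ _⟩
  refine AddSubgroup.sum_mem _ fun a ha => AddSubgroup.zsmul_mem _ ?_ _
  exact AddSubgroup.subset_closure ⟨a, ha, rfl⟩

/-- At a ridge with three adjacent facets, a test space that meets the first two facets with
intersection number one and is parallel to the third facet. -/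
theorem exists_testSpace (C : PolyComplex ι k) {u₀ u₁ u₂ : α} (hu : u₀ ∉ t)
    (hd : IsDual v (insert u₀ t) m) (hcard : t.card + 1 = k)
    (hmem : coneOf v (insert u₀ t) ∈ C.adjacent (coneOf v t))
    (hadj : ∀ G ∈ C.adjacent (coneOf v t), G = coneOf v (insert u₀ t) ∨
      G = coneOf v (insert u₁ t) ∨ G = coneOf v (insert u₂ t))
    (h₁ : intPairing (m u₀) (v u₁) = -1) (h₂ : intPairing (m u₀) (v u₂) = 0)
    (hbal : ∀ L, C.IsTestSpace (coneOf v t) L → ∃ d, C.HasIntersectionNumber (coneOf v t) L d) :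
    ∃ L : AffineSubspace ℝ (ι → ℝ), C.IsTestSpace (coneOf v t) L ∧
      (∃ᶠ w in 𝓝 (0 : ι → ℝ), C.IsGenericAt (coneOf v t) L w ∧
        (coneOf v (insert u₀ t) ∩ translate L w).Nonempty) ∧
      C.HasIntersectionNumber (coneOf v t) L 1 ∧ L.direction = coordKer m (insert u₀ t) ∧
      ∀ᶠ w in 𝓝 (0 : ι → ℝ), ∃ x ∈ coneOf v (insert u₀ t) ∪ coneOf v (insert u₁ t),
        x ∈ translate L w := by
  set s := insert u₀ t with hs
  have hus : u₀ ∈ s := Finset.mem_insert_self _ _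
  have hts : ∀ a ∈ t, a ∈ s := fun a ha => Finset.mem_insert_of_mem ha
  have hdt : IsDual v t m := hd.mono (Finset.subset_insert _ _)
  -- The sum of the generators of the ridge, a convenient interior point.
  set p : ι → ℝ := comb v (fun a => if a ∈ t then 1 else 0) with hp
  have hpa : ∀ a ∈ s, pairing (m a) p = if a ∈ t then 1 else 0 := fun a ha =>
    hd.pairing_comb (fun a ha => if_neg fun h => ha (hts a h)) ha
  have hpt : ∀ a ∈ t, pairing (m a) p = 1 := fun a ha => by rw [hpa a (hts a ha), if_pos ha]
  have hpu : pairing (m u₀) p = 0 := by rw [hpa _ hus, if_neg hu]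
  have hpspan : p ∈ spanOf v t := comb_mem_spanOf fun a ha => if_neg ha
  have hpint : p ∈ intrinsicInterior ℝ (coneOf v t) :=
    hdt.mem_intrinsicInterior_iff.2 ⟨hpspan, fun a ha => by rw [hpt a ha]; exact one_pos⟩
  have hpspan' : p ∈ spanOf v s := by
    rw [hs, spanOf_insert]; exact Submodule.mem_sup_right hpspan
  set L := AffineSubspace.mk' p (coordKer m s) with hL
  have hdir : L.direction = coordKer m s := AffineSubspace.direction_mk' _ _
  have htr : ∀ w x, x ∈ translate L w ↔ ∀ a ∈ s, pairing (m a) x = pairing (m a) (p + w) := by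
    intro w x
    have : x ∈ translate L w ↔ x - w - p ∈ coordKer m s := by
      show x - w ∈ L ↔ _
      rw [hL, AffineSubspace.mem_mk']; rfl
    rw [this, mem_coordKer]
    refine forall₂_congr fun a _ => ?_
    rw [map_sub, map_sub, map_add]
    constructor <;> intro h <;> linarith
  have htest : C.IsTestSpace (coneOf v t) L := by
    refine ⟨?_, ?_, p, AffineSubspace.self_mem_mk' _ _, hpint⟩
    · have := Submodule.finrank_add_eq_of_isCompl hd.isCompl_coordKer
      rw [hd.finrank_spanOf, Finset.card_insert_of_notMem hu, hcard,
        Module.finrank_fintype_fun_eq_card] at this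
      rw [hdir]; omega
    · rw [hdir]; exact hd.isRationalSubspace_coordKer
  have hmu : ∀ a ∈ t, intPairing (m u₀) (v a) = 0 := fun a ha => by
    rw [intPairing_apply, hd u₀ hus a (hts a ha), if_neg]
    rintro rfl; exact hu ha
  -- The facets of `u₁` and `u₂` lie in the half-space where `m u₀` is nonpositive, so a shift in
  -- the direction `v u₀` avoids both.
  have hother : ∀ u, intPairing (m u₀) (v u) ≤ 0 → ∀ x ∈ coneOf v (insert u t),
      pairing (m u₀) x ≤ 0 := by
    rintro u hle x ⟨l, hl0, hl, rfl⟩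
    rw [TropMod.pairing_comb]
    refine Finset.sum_nonpos fun a _ => ?_
    by_cases hat : a ∈ t
    · have := hmu a hat
      rw [intPairing_apply] at this
      rw [this, Int.cast_zero, mul_zero]
    by_cases hau : a = u
    · subst hau
      exact mul_nonpos_of_nonneg_of_nonpos (hl0 a) (by exact_mod_cast hle)
    · rw [hl a (by simp [hat, hau]), zero_mul]
  have hgen : ∀ ε : ℝ, 0 < ε → C.IsGenericAt (coneOf v t) L (ε • rvec (v u₀)) ∧
      (coneOf v s ∩ translate L (ε • rvec (v u₀))).Nonempty ∧
      C.intersectionSum (coneOf v t) L (ε • rvec (v u₀)) = 1 := by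
    intro ε hε
    set w := ε • rvec (v u₀) with hw
    have hwa : ∀ a ∈ s, pairing (m a) w = if a = u₀ then ε else 0 := fun a ha => by
      rw [hw, map_smul, pairing_rvec, hd a ha u₀ hus]
      split_ifs <;> simp
    have hxspan : p + w ∈ spanOf v s := Submodule.add_mem _ hpspan'
      (Submodule.smul_mem _ _ (Submodule.subset_span ⟨u₀, hus, rfl⟩))
    have hxpos : ∀ a ∈ s, 0 < pairing (m a) (p + w) := by
      intro a ha
      rw [map_add, hwa a ha]
      split_ifs with hau
      · subst hau; rw [hpu, zero_add]; exact hε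
      · rw [hpt a ((Finset.mem_insert.1 ha).resolve_left hau)]; norm_num
    have hxmem : p + w ∈ coneOf v s ∩ translate L w :=
      ⟨hd.mem_coneOf_iff.2 ⟨hxspan, fun a ha => (hxpos a ha).le⟩, (htr w _).2 fun _ _ => rfl⟩
    have hempty : ∀ u, intPairing (m u₀) (v u) ≤ 0 →
        ¬ (coneOf v (insert u t) ∩ translate L w).Nonempty := by
      rintro u hle ⟨x, hx, hxw⟩
      have h3 := hother u hle x hx
      rw [(htr w x).1 hxw u₀ hus] at h3
      exact absurd (hxpos u₀ hus) (not_lt.2 h3)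
    have hmeet : ∀ G ∈ C.adjacent (coneOf v t), (G ∩ translate L w).Nonempty → G = coneOf v s := by
      intro G hG hne
      rcases hadj G hG with rfl | rfl | rfl
      · rfl
      · exact absurd hne (hempty u₁ (by rw [h₁]; norm_num))
      · exact absurd hne (hempty u₂ h₂.le)
    refine ⟨fun G hG hne => ?_, ⟨_, hxmem⟩, ?_⟩
    · obtain rfl := hmeet G hG hne
      refine ⟨?_, ?_⟩
      · rw [vectorSpan_coneOf, hdir]
        exact hd.isCompl_coordKer.sup_eq_top
      · rintro x ⟨hx, hxw⟩
        refine hd.mem_intrinsicInterior_iff.2 ⟨coneOf_subset_spanOf hx, fun a ha => ?_⟩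
        rw [(htr w x).1 hxw a ha]
        exact hxpos a ha
    · have : {G | G ∈ C.adjacent (coneOf v t) ∧ (G ∩ translate L w).Nonempty} = {coneOf v s} := by
        ext G
        constructor
        · rintro ⟨hG, hne⟩
          exact hmeet G hG hne
        · rintro rfl
          exact ⟨hmem, _, hxmem⟩
      rw [PolyComplex.intersectionSum, this, finsum_mem_singleton, vectorSpan_coneOf, hdir]
      exact hd.index_eq_one
  have hfreq : ∃ᶠ w in 𝓝 (0 : ι → ℝ), C.IsGenericAt (coneOf v t) L w ∧
      (coneOf v s ∩ translate L w).Nonempty ∧ C.intersectionSum (coneOf v t) L w = 1 := by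
    have hten : Filter.Tendsto (fun ε : ℝ => ε • rvec (v u₀)) (𝓝[>] 0) (𝓝 0) := by
      have : Continuous fun ε : ℝ => ε • rvec (v u₀) := by fun_prop
      have h0 := this.tendsto 0
      rw [zero_smul] at h0
      exact h0.mono_left nhdsWithin_le_nhds
    refine hten.frequently (Filter.Eventually.frequently ?_)
    filter_upwards [self_mem_nhdsWithin] with ε hε using hgen ε hε
  refine ⟨L, htest, hfreq.mono fun w hw => ⟨hw.1, hw.2.1⟩, ?_, hdir, ?_⟩
  -- Balancing makes the intersection number independent of the shift, so the value 1 found for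
  -- shifts along `v u₀` is the value for all small generic shifts.
  · obtain ⟨d, hdd⟩ := hbal L htest
    obtain ⟨w, hw, hw'⟩ := (hfreq.and_eventually hdd).exists
    have h1 := hw' hw.1
    rw [hw.2.2] at h1
    rwa [h1]
  · have hcont : ∀ z : ι → ℤ, Continuous fun w => pairing z (p + w) := fun z =>
      (continuous_pairing z).comp (continuous_const.add continuous_id)
    have hev : ∀ᶠ w in 𝓝 (0 : ι → ℝ), ∀ a ∈ t, 0 < pairing (m a) (p + w) ∧
        0 < pairing (m a) (p + w) + pairing (m u₀) (p + w) * intPairing (m a) (v u₁) := by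
      rw [Filter.eventually_all_finset]
      intro a ha
      refine Filter.Eventually.and ((hcont _).continuousAt.eventually (lt_mem_nhds ?_))
        (((hcont _).add ((hcont _).mul continuous_const)).continuousAt.eventually (lt_mem_nhds ?_))
      · simp [hpt a ha]
      · simp [hpt a ha, hpu]
    filter_upwards [hev] with w hw
    -- The sign of the `u₀`-coordinate of `p + w` decides whether the point of `L + w` is taken in
    -- the facet of `u₀` or in that of `u₁`.
    by_cases hsgn : 0 ≤ pairing (m u₀) (p + w)
    · refine ⟨comb v (coords m s (p + w)), Or.inl ⟨_, fun a => ?_, fun a ha => coords_of_notMem ha,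
        rfl⟩, (htr _ _).2 fun a ha => ?_⟩
      · by_cases ha : a ∈ s
        · rw [coords_of_mem ha]
          rcases Finset.mem_insert.1 ha with rfl | hat
          · exact hsgn
          · exact (hw a hat).1.le
        · rw [coords_of_notMem ha]
      · rw [hd.pairing_comb (fun a ha => coords_of_notMem ha) ha, coords_of_mem ha]
    · rw [not_le] at hsgn
      set c := pairing (m u₀) (p + w) with hc
      -- Prescribing all dual forms determines the point: as `m u₀` is `-1` on `v u₁`, the
      -- coefficient of `v u₁` must be `-c`, and the coefficients in `t` absorb its effect on the
      -- other forms. They stay positive because `c` is small.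
      let l : α → ℝ := fun a => if a ∈ t then pairing (m a) (p + w) + c * intPairing (m a) (v u₁)
        else 0
      have hlt : ∀ a, a ∉ s → l a = 0 := fun a ha => if_neg fun h => ha (hts a h)
      refine ⟨comb v (l + Pi.single u₁ (-c)), Or.inr ⟨_, fun a => ?_, fun a ha => ?_, rfl⟩,
        (htr _ _).2 fun a ha => ?_⟩
      · refine add_nonneg ?_ ?_
        · simp only [l]
          split_ifs with hat
          · exact (hw a hat).2.le
          · exact le_rfl
        · rw [Pi.single_apply]
          split_ifs
          · linarith
          · exact le_rfl
      · rw [Finset.mem_insert, not_or] at ha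
        simp [l, ha.1, ha.2]
      · rw [map_add, map_add, hd.pairing_comb hlt ha, comb_single, map_smul, pairing_rvec',
          smul_eq_mul]
        rcases Finset.mem_insert.1 ha with rfl | hat
        · rw [h₁]; simp [l, hu, hc]
        · simp only [l, if_pos hat]; ring

end Balancing

/-! ### Hierarchies of clusters -/

section Hierarchies

variable {n : ℕ}

/-- Two clusters are compatible if they are nested or disjoint. -/
def Compat (A B : Finset (Fin n)) : Prop := A ⊆ B ∨ B ⊆ A ∨ Disjoint A B

lemma Compat.symm {A B : Finset (Fin n)} (h : Compat A B) : Compat B A := by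
  rcases h with h | h | h
  · exact Or.inr (Or.inl h)
  · exact Or.inl h
  · exact Or.inr (Or.inr h.symm)

lemma compat_singleton (A : Finset (Fin n)) (b : Fin n) : Compat A {b} := by
  by_cases h : b ∈ A
  · exact Or.inr (Or.inl (Finset.singleton_subset_iff.2 h))
  · exact Or.inr (Or.inr (Finset.disjoint_singleton_right.2 h))

lemma Compat.of_mem {A B : Finset (Fin n)} (h : Compat A B) {i : Fin n} (hA : i ∈ A) (hB : i ∈ B) :
    A ⊆ B ∨ B ⊆ A := by
  rcases h with h | h | h
  · exact Or.inl h
  · exact Or.inr h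
  · exact absurd hB (Finset.disjoint_left.1 h hA)

lemma not_compat {A B : Finset (Fin n)} (h : ¬ Compat A B) :
    (∃ b, b ∈ A ∧ b ∈ B) ∧ (∃ a, a ∈ A ∧ a ∉ B) ∧ ∃ c, c ∈ B ∧ c ∉ A := by
  simp only [Compat, not_or] at h
  exact ⟨Finset.not_disjoint_iff.1 h.2.2, Finset.not_subset.1 h.1, Finset.not_subset.1 h.2.1⟩

/-- The cluster of all markings different from the root marking. -/
def topCluster (r : Fin n) : Finset (Fin n) := Finset.univ.erase r

lemma mem_topCluster {r i : Fin n} : i ∈ topCluster r ↔ i ≠ r := by simp [topCluster]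

lemma card_topCluster (r : Fin n) : (topCluster r).card = n - 1 := by simp [topCluster]

/-- A hierarchy of clusters: the combinatorial structure of a tree whose leaves are the markings,
rooted at the marking `r`. -/
structure IsHierarchy (r : Fin n) (𝒜 : Finset (Finset (Fin n))) : Prop where
  root_notMem : ∀ A ∈ 𝒜, r ∉ A
  one_lt_card : ∀ A ∈ 𝒜, 1 < A.card
  proper : ∀ A ∈ 𝒜, ∃ c, c ≠ r ∧ c ∉ A
  compat : ∀ A ∈ 𝒜, ∀ B ∈ 𝒜, Compat A B

/-- The hierarchy together with the cluster of all markings different from the root. -/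
def withTop (r : Fin n) (𝒜 : Finset (Finset (Fin n))) : Finset (Finset (Fin n)) :=
  insert (topCluster r) 𝒜

variable {r : Fin n} {𝒜 ℬ : Finset (Finset (Fin n))} {A B C D P : Finset (Fin n)}

lemma top_mem_withTop : topCluster r ∈ withTop r 𝒜 := Finset.mem_insert_self _ _

lemma mem_withTop_of_mem (h : A ∈ 𝒜) : A ∈ withTop r 𝒜 := Finset.mem_insert_of_mem h

lemma subset_topCluster (h : r ∉ A) : A ⊆ topCluster r := fun _ hi =>
  mem_topCluster.2 fun e => h (e ▸ hi)

namespace IsHierarchy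

lemma mono (h : IsHierarchy r 𝒜) (hB : ℬ ⊆ 𝒜) : IsHierarchy r ℬ :=
  ⟨fun A hA => h.root_notMem A (hB hA), fun A hA => h.one_lt_card A (hB hA),
    fun A hA => h.proper A (hB hA), fun A hA B hB' => h.compat A (hB hA) B (hB hB')⟩

lemma subset_top (h : IsHierarchy r 𝒜) (hA : A ∈ withTop r 𝒜) : A ⊆ topCluster r := by
  rcases Finset.mem_insert.1 hA with rfl | hA
  · exact subset_rfl
  · exact subset_topCluster (h.root_notMem A hA)

lemma ne_root (h : IsHierarchy r 𝒜) (hA : A ∈ withTop r 𝒜) {i : Fin n} (hi : i ∈ A) : i ≠ r :=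
  mem_topCluster.1 (h.subset_top hA hi)

lemma top_notMem (h : IsHierarchy r 𝒜) : topCluster r ∉ 𝒜 := fun hm => by
  obtain ⟨c, hc, hc'⟩ := h.proper _ hm
  exact hc' (mem_topCluster.2 hc)

lemma compat_withTop (h : IsHierarchy r 𝒜) (hA : A ∈ withTop r 𝒜) (hB : B ∈ withTop r 𝒜) :
    Compat A B := by
  rcases Finset.mem_insert.1 hA with rfl | hA'
  · exact Or.inr (Or.inl (h.subset_top hB))
  rcases Finset.mem_insert.1 hB with rfl | hB'
  · exact Or.inl (h.subset_top hA)
  exact h.compat A hA' B hB'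

lemma one_lt_card_withTop (hn : 3 ≤ n) (h : IsHierarchy r 𝒜) (hA : A ∈ withTop r 𝒜) :
    1 < A.card := by
  rcases Finset.mem_insert.1 hA with rfl | hA
  · rw [card_topCluster]; omega
  · exact h.one_lt_card A hA

lemma nonempty_withTop (hn : 3 ≤ n) (h : IsHierarchy r 𝒜) (hA : A ∈ withTop r 𝒜) : A.Nonempty :=
  Finset.card_pos.1 (zero_lt_one.trans (h.one_lt_card_withTop hn hA))

lemma insert (h : IsHierarchy r 𝒜) (hr : r ∉ D) (hD : 1 < D.card) (hp : ∃ c, c ≠ r ∧ c ∉ D)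
    (hc : ∀ A ∈ 𝒜, Compat D A) : IsHierarchy r (insert D 𝒜) := by
  refine ⟨?_, ?_, ?_, ?_⟩
  · exact Finset.forall_mem_insert _ _ _ |>.2 ⟨hr, h.root_notMem⟩
  · exact Finset.forall_mem_insert _ _ _ |>.2 ⟨hD, h.one_lt_card⟩
  · exact Finset.forall_mem_insert _ _ _ |>.2 ⟨hp, h.proper⟩
  · intro A hA B hB
    rcases Finset.mem_insert.1 hA with rfl | hA'
    · rcases Finset.mem_insert.1 hB with rfl | hB'
      · exact Or.inl subset_rfl
      · exact hc B hB'
    · rcases Finset.mem_insert.1 hB with rfl | hB'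
      · exact (hc A hA').symm
      · exact h.compat A hA' B hB'

end IsHierarchy

/-- `B` is the branch of the cluster `A` that contains the marking `b`. -/
structure IsBranch (𝒜 : Finset (Finset (Fin n))) (A : Finset (Fin n)) (b : Fin n)
    (B : Finset (Fin n)) : Prop where
  mem : b ∈ B
  ssubset : B ⊂ A
  node : B ∈ 𝒜 ∨ B = {b}
  max : ∀ D ∈ 𝒜, b ∈ D → D ⊂ A → D ⊆ B

lemma IsBranch.compat (hB : IsBranch 𝒜 A b B) (h : IsHierarchy r 𝒜) (hD : D ∈ withTop r 𝒜) :
    Compat D B := by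
  rcases hB.node with h' | rfl
  · exact h.compat_withTop hD (mem_withTop_of_mem h')
  · exact compat_singleton _ _

/-- The clusters containing `b` form a chain, so there is a largest one properly inside `A`; if
there is none, the branch is the leaf `b` alone. -/
lemma IsHierarchy.exists_isBranch (h : IsHierarchy r 𝒜) (hA : 1 < A.card) {b : Fin n}
    (hb : b ∈ A) : ∃ B, IsBranch 𝒜 A b B := by
  classical
  by_cases hne : (𝒜.filter fun D => b ∈ D ∧ D ⊂ A).Nonempty
  · obtain ⟨B, hB, hmax⟩ := Finset.exists_max_image _ Finset.card hne
    rw [Finset.mem_filter] at hB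
    refine ⟨B, hB.2.1, hB.2.2, Or.inl hB.1, fun D hD hbD hDA => ?_⟩
    rcases (h.compat D hD B hB.1).of_mem hbD hB.2.1 with h' | h'
    · exact h'
    · exact (Finset.eq_of_subset_of_card_le h' (hmax D (Finset.mem_filter.2 ⟨hD, hbD, hDA⟩))).ge
  · refine ⟨{b}, Finset.mem_singleton_self b, ?_, Or.inr rfl, fun D hD hbD hDA => ?_⟩
    · refine (Finset.ssubset_iff_subset_ne).2 ⟨Finset.singleton_subset_iff.2 hb, fun e => ?_⟩
      rw [← e, Finset.card_singleton] at hA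
      exact lt_irrefl _ hA
    · exact absurd ⟨D, Finset.mem_filter.2 ⟨hD, hbD, hDA⟩⟩ hne

/-- `A` is the smallest cluster containing the two markings `p.1` and `p.2`. -/
structure IsMeet (𝒜 : Finset (Finset (Fin n))) (A : Finset (Fin n)) (p : Fin n × Fin n) :
    Prop where
  ne : p.1 ≠ p.2
  fst_mem : p.1 ∈ A
  snd_mem : p.2 ∈ A
  min : ∀ B ∈ 𝒜, p.1 ∈ B → p.2 ∈ B → A ⊆ B

lemma IsMeet.swap {p : Fin n × Fin n} (h : IsMeet 𝒜 A p) : IsMeet 𝒜 A p.swap :=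
  ⟨h.ne.symm, h.snd_mem, h.fst_mem, fun B hB h1 h2 => h.min B hB h2 h1⟩

/-- Two markings in different branches of `A` work: a cluster properly inside `A` that contains the
first one lies in its branch and misses the second. -/
lemma IsHierarchy.exists_isMeet (hn : 3 ≤ n) (h : IsHierarchy r 𝒜) (hA : A ∈ withTop r 𝒜) :
    ∃ p, IsMeet 𝒜 A p := by
  obtain ⟨b, hb⟩ := h.nonempty_withTop hn hA
  obtain ⟨B, hB⟩ := h.exists_isBranch (h.one_lt_card_withTop hn hA) hb
  obtain ⟨c, hcA, hcB⟩ := Finset.exists_of_ssubset hB.ssubset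
  refine ⟨(b, c), fun e => hcB ?_, hb, hcA, fun D hD hbD hcD => ?_⟩
  · simp only at e; rw [← e]; exact hB.mem
  · rcases (h.compat_withTop (mem_withTop_of_mem hD) hA).of_mem hbD hb with h' | h'
    · by_contra hAD
      exact hcB (hB.max D hD hbD (Finset.ssubset_iff_subset_ne.2 ⟨h', fun e => hAD e.ge⟩) hcD)
    · exact h'

/-- The smallest cluster containing two given markings. -/
lemma IsHierarchy.exists_meet (h : IsHierarchy r 𝒜) {i j : Fin n} (hij : i ≠ j) (hi : i ≠ r)
    (hj : j ≠ r) : ∃ A ∈ withTop r 𝒜, IsMeet 𝒜 A (i, j) := by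
  classical
  obtain ⟨A, hA, hmin⟩ := Finset.exists_min_image ((withTop r 𝒜).filter fun D => i ∈ D ∧ j ∈ D)
    Finset.card ⟨topCluster r, Finset.mem_filter.2 ⟨top_mem_withTop, mem_topCluster.2 hi,
      mem_topCluster.2 hj⟩⟩
  rw [Finset.mem_filter] at hA
  refine ⟨A, hA.1, hij, hA.2.1, hA.2.2, fun B hB hiB hjB => ?_⟩
  rcases (h.compat_withTop hA.1 (mem_withTop_of_mem hB)).of_mem hA.2.1 hiB with h' | h'
  · exact h'
  · exact (Finset.eq_of_subset_of_card_le h'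
      (hmin B (Finset.mem_filter.2 ⟨mem_withTop_of_mem hB, hiB, hjB⟩))).ge

/-- `P` is the smallest cluster that contains `A` properly. -/
structure IsParent (r : Fin n) (𝒜 : Finset (Finset (Fin n))) (A P : Finset (Fin n)) : Prop where
  mem : P ∈ withTop r 𝒜
  ssubset : A ⊂ P
  min : ∀ D ∈ withTop r 𝒜, A ⊂ D → P ⊆ D

lemma IsHierarchy.ssubset_top (h : IsHierarchy r 𝒜) (hA : A ∈ 𝒜) : A ⊂ topCluster r := by
  refine Finset.ssubset_iff_subset_ne.2 ⟨h.subset_top (mem_withTop_of_mem hA), ?_⟩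
  rintro rfl
  exact h.top_notMem hA

lemma IsHierarchy.exists_isParent (h : IsHierarchy r 𝒜) (hA : A ∈ 𝒜) : ∃ P, IsParent r 𝒜 A P := by
  classical
  obtain ⟨P, hP, hmin⟩ := Finset.exists_min_image ((withTop r 𝒜).filter fun D => A ⊂ D)
    Finset.card ⟨topCluster r, Finset.mem_filter.2 ⟨top_mem_withTop, h.ssubset_top hA⟩⟩
  rw [Finset.mem_filter] at hP
  refine ⟨P, hP.1, hP.2, fun D hD hAD => ?_⟩
  obtain ⟨i, hi⟩ := Finset.card_pos.1 (zero_lt_one.trans (h.one_lt_card A hA))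
  rcases (h.compat_withTop hP.1 hD).of_mem (hP.2.1 hi) (hAD.1 hi) with h' | h'
  · exact h'
  · exact (Finset.eq_of_subset_of_card_le h' (hmin D (Finset.mem_filter.2 ⟨hD, hAD⟩))).ge

/-- A choice, for every cluster, of two markings with this smallest cluster. -/
def IsSelection (r : Fin n) (𝒜 : Finset (Finset (Fin n))) (e : Finset (Fin n) → Fin n × Fin n) :
    Prop :=
  ∀ A ∈ withTop r 𝒜, IsMeet 𝒜 A (e A)

lemma IsHierarchy.exists_isSelection (hn : 3 ≤ n) (h : IsHierarchy r 𝒜) :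
    ∃ e, IsSelection r 𝒜 e := by
  classical
  have : ∀ A : Finset (Fin n), ∃ p : Fin n × Fin n, A ∈ withTop r 𝒜 → IsMeet 𝒜 A p := by
    intro A
    by_cases hA : A ∈ withTop r 𝒜
    · obtain ⟨p, hp⟩ := h.exists_isMeet hn hA
      exact ⟨p, fun _ => hp⟩
    · exact ⟨(r, r), fun h => absurd h hA⟩
  choose e he using this
  exact ⟨e, he⟩

/-! ### Maximal hierarchies -/

/-- A hierarchy that cannot be enlarged. -/
def IsMaxHierarchy (r : Fin n) (𝒜 : Finset (Finset (Fin n))) : Prop :=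
  IsHierarchy r 𝒜 ∧ ∀ D, IsHierarchy r (insert D 𝒜) → D ∈ 𝒜

lemma IsHierarchy.exists_isMaxHierarchy (h : IsHierarchy r 𝒜) :
    ∃ ℬ, 𝒜 ⊆ ℬ ∧ IsMaxHierarchy r ℬ := by
  obtain ⟨ℬ, hle, hmax⟩ := (Set.toFinite {ℬ | IsHierarchy r ℬ}).exists_le_maximal h
  refine ⟨ℬ, hle, hmax.1, fun D hD => ?_⟩
  exact hmax.2 hD (Finset.subset_insert _ _) (Finset.mem_insert_self _ _)

/-- In a maximal hierarchy, every cluster is the union of two branches. -/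
lemma IsMaxHierarchy.exists_branches (hn : 3 ≤ n) (hM : IsMaxHierarchy r 𝒜)
    (hA : A ∈ withTop r 𝒜) {p : Fin n × Fin n} (hp : IsMeet 𝒜 A p) :
    ∃ B C, IsBranch 𝒜 A p.1 B ∧ IsBranch 𝒜 A p.2 C ∧ Disjoint B C ∧ B ∪ C = A := by
  obtain ⟨h, hmax⟩ := hM
  have hcard := h.one_lt_card_withTop hn hA
  obtain ⟨B, hB⟩ := h.exists_isBranch hcard hp.fst_mem
  obtain ⟨C, hC⟩ := h.exists_isBranch hcard hp.snd_mem
  have hnB : p.2 ∉ B := by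
    intro hm
    rcases hB.node with h' | rfl
    · exact hB.ssubset.2 (hp.min B h' hB.mem hm)
    · exact hp.ne (Finset.mem_singleton.1 hm).symm
  have hnC : p.1 ∉ C := by
    intro hm
    rcases hC.node with h' | rfl
    · exact hC.ssubset.2 (hp.min C h' hm hC.mem)
    · exact hp.ne (Finset.mem_singleton.1 hm)
  have hdisj : Disjoint B C := by
    have : Compat B C := by
      rcases hB.node with h' | rfl
      · exact hC.compat h (mem_withTop_of_mem h')
      · exact (compat_singleton _ _).symm
    rcases this with h' | h' | h'
    · exact absurd (h' hB.mem) hnC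
    · exact absurd (h' hC.mem) hnB
    · exact h'
  refine ⟨B, C, hB, hC, hdisj, ?_⟩
  have hsub : B ∪ C ⊆ A := Finset.union_subset hB.ssubset.1 hC.ssubset.1
  by_contra hne
  have hss : B ∪ C ⊂ A := Finset.ssubset_iff_subset_ne.2 ⟨hsub, hne⟩
  -- If the two branches did not fill `A`, their union would be compatible with every cluster, hence
  -- belong to the maximal hierarchy. It contains both markings of `p`, against the minimality of
  -- `A`.
  have hmem : B ∪ C ∈ 𝒜 := by
    refine hmax _ (h.insert ?_ ?_ ?_ ?_)
    · exact fun hr => h.ne_root hA (hsub hr) rfl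
    · refine Finset.one_lt_card.2 ⟨p.1, Finset.mem_union_left _ hB.mem, p.2,
        Finset.mem_union_right _ hC.mem, hp.ne⟩
    · obtain ⟨c, hc, hc'⟩ := Finset.exists_of_ssubset hss
      exact ⟨c, h.ne_root hA hc, hc'⟩
    · intro D hD
      refine Compat.symm ?_
      have key : ∀ b B', IsBranch 𝒜 A b B' → D ⊆ B' ∨ Disjoint D B' ∨ B ∪ C ⊆ D := by
        intro b B' hB'
        rcases hB'.compat h (mem_withTop_of_mem hD) with h' | h' | h'
        · exact Or.inl h'
        · have hbD : b ∈ D := h' hB'.mem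
          rcases (h.compat_withTop (mem_withTop_of_mem hD) hA).of_mem hbD
            (hB'.ssubset.1 hB'.mem) with h'' | h''
          · by_cases hDA : D = A
            · exact Or.inr (Or.inr (hDA ▸ hsub))
            · exact Or.inl (hB'.max D hD hbD (Finset.ssubset_iff_subset_ne.2 ⟨h'', hDA⟩))
          · exact Or.inr (Or.inr (hsub.trans h''))
        · exact Or.inr (Or.inl h')
      rcases key _ _ hB with h1 | h1 | h1
      · exact Or.inl (h1.trans Finset.subset_union_left)
      · rcases key _ _ hC with h2 | h2 | h2
        · exact Or.inl (h2.trans Finset.subset_union_right)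
        · exact Or.inr (Or.inr (Finset.disjoint_union_right.2 ⟨h1, h2⟩))
        · exact Or.inr (Or.inl h2)
      · exact Or.inr (Or.inl h1)
  exact hss.2 (hp.min _ hmem (Finset.mem_union_left _ hB.mem) (Finset.mem_union_right _ hC.mem))

/-- The number of clusters of a maximal hierarchy. -/
lemma IsMaxHierarchy.card_eq (hn : 3 ≤ n) (hM : IsMaxHierarchy r 𝒜) : 𝒜.card = n - 3 := by
  classical
  have h := hM.1
  -- A cluster with `k` markings contains `k - 1` clusters including itself, as a binary tree with
  -- `k` leaves has `k - 1` inner vertices. For the top cluster, with `n - 1` markings, this gives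
  -- `n - 2`, and the top itself is not in `𝒜`.
  have key : ∀ k, ∀ A ∈ withTop r 𝒜, A.card = k →
      ((withTop r 𝒜).filter (· ⊆ A)).card + 1 = k := by
    intro k
    induction k using Nat.strong_induction_on with
    | _ k ih =>
    intro A hA hk
    obtain ⟨p, hp⟩ := h.exists_isMeet hn hA
    obtain ⟨B, C, hB, hC, hdisj, hunion⟩ := hM.exists_branches hn hA hp
    have hbr : ∀ b B, IsBranch 𝒜 A b B →
        ((withTop r 𝒜).filter (· ⊆ B)).card + 1 = B.card := by
      intro b B hB
      rcases hB.node with h' | rfl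
      · exact ih _ (hk ▸ Finset.card_lt_card hB.ssubset) B (mem_withTop_of_mem h') rfl
      · rw [Finset.card_singleton, Nat.add_eq_right, Finset.card_eq_zero,
          Finset.filter_eq_empty_iff]
        intro D hD hDb
        have := Finset.card_le_card hDb
        have := h.one_lt_card_withTop hn hD
        rw [Finset.card_singleton] at *
        omega
    have hsplit : (withTop r 𝒜).filter (· ⊆ A) = insert A
        ((withTop r 𝒜).filter (· ⊆ B) ∪ (withTop r 𝒜).filter (· ⊆ C)) := by
      ext D
      simp only [Finset.mem_filter, Finset.mem_insert, Finset.mem_union]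
      constructor
      · rintro ⟨hD, hDA⟩
        by_cases hDA' : D = A
        · exact Or.inl hDA'
        refine Or.inr ?_
        have hDss : D ⊂ A := Finset.ssubset_iff_subset_ne.2 ⟨hDA, hDA'⟩
        have hD𝒜 : D ∈ 𝒜 := by
          rcases Finset.mem_insert.1 hD with rfl | h'
          · exact absurd (h.subset_top hA) hDss.2
          · exact h'
        have hcase : ∀ b B, IsBranch 𝒜 A b B → D ⊆ B ∨ Disjoint D B := by
          intro b B hB
          rcases hB.compat h hD with h' | h' | h'
          · exact Or.inl h'
          · exact Or.inl (hB.max D hD𝒜 (h' hB.mem) hDss)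
          · exact Or.inr h'
        rcases hcase _ _ hB with h1 | h1
        · exact Or.inl ⟨hD, h1⟩
        · rcases hcase _ _ hC with h2 | h2
          · exact Or.inr ⟨hD, h2⟩
          · obtain ⟨i, hi⟩ := h.nonempty_withTop hn hD
            have := hDA hi
            rw [← hunion, Finset.mem_union] at this
            rcases this with h' | h'
            · exact absurd h' (Finset.disjoint_left.1 h1 hi)
            · exact absurd h' (Finset.disjoint_left.1 h2 hi)
      · rintro (rfl | ⟨hD, h'⟩ | ⟨hD, h'⟩)
        · exact ⟨hA, subset_rfl⟩
        · exact ⟨hD, h'.trans hB.ssubset.1⟩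
        · exact ⟨hD, h'.trans hC.ssubset.1⟩
    rw [hsplit, Finset.card_insert_of_notMem, Finset.card_union_of_disjoint]
    · have h1 := hbr _ _ hB
      have h2 := hbr _ _ hC
      have h3 := Finset.card_union_of_disjoint hdisj
      rw [hunion, hk] at h3
      omega
    · rw [Finset.disjoint_left]
      intro D hD hD'
      rw [Finset.mem_filter] at hD hD'
      obtain ⟨i, hi⟩ := h.nonempty_withTop hn hD.1
      exact Finset.disjoint_left.1 hdisj (hD.2 hi) (hD'.2 hi)
    · simp only [Finset.mem_union, Finset.mem_filter, not_or]
      exact ⟨fun h' => hB.ssubset.2 h'.2, fun h' => hC.ssubset.2 h'.2⟩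
  have h1 := key _ _ top_mem_withTop (card_topCluster r)
  rw [Finset.filter_true_of_mem fun D hD => h.subset_top hD, withTop,
    Finset.card_insert_of_notMem h.top_notMem] at h1
  omega

lemma IsHierarchy.card_le (hn : 3 ≤ n) (h : IsHierarchy r 𝒜) : 𝒜.card ≤ n - 3 := by
  obtain ⟨ℬ, hle, hM⟩ := h.exists_isMaxHierarchy
  rw [← hM.card_eq hn]
  exact Finset.card_le_card hle

lemma IsHierarchy.isMaxHierarchy (hn : 3 ≤ n) (h : IsHierarchy r 𝒜) (hc : 𝒜.card = n - 3) :
    IsMaxHierarchy r 𝒜 := by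
  refine ⟨h, fun D hD => ?_⟩
  by_contra hD'
  have := hD.card_le hn
  rw [Finset.card_insert_of_notMem hD', hc] at this
  omega

end Hierarchies

/-! ### Exchanging a cluster of a maximal hierarchy -/

section Exchange

variable {n : ℕ} {r : Fin n} {𝒜 ℬ : Finset (Finset (Fin n))} {A₀ A B C D P : Finset (Fin n)}

/-- The cluster `A₀` is the union of the branches `A` and `B`, and its parent `P` is the union of
`A₀` and `C`. -/
structure IsTriple (r : Fin n) (𝒜 : Finset (Finset (Fin n))) (A₀ P A B C : Finset (Fin n)) :
    Prop where
  mem : A₀ ∈ 𝒜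
  parent : IsParent r 𝒜 A₀ P
  node_left : A ∈ 𝒜 ∨ ∃ b, A = {b}
  node_right : B ∈ 𝒜 ∨ ∃ b, B = {b}
  node_out : C ∈ 𝒜 ∨ ∃ b, C = {b}
  nonempty_left : A.Nonempty
  nonempty_right : B.Nonempty
  nonempty_out : C.Nonempty
  disjoint : Disjoint A B
  disjoint_out : Disjoint A₀ C
  union : A ∪ B = A₀
  union_out : A₀ ∪ C = P
  max_left : ∀ D ∈ 𝒜, A ⊆ D → D ⊂ A₀ → D ⊆ A
  max_right : ∀ D ∈ 𝒜, B ⊆ D → D ⊂ A₀ → D ⊆ B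

/-- The two markings of `p` lie in `A` and `B`. -/
def Separates (p : Fin n × Fin n) (A B : Finset (Fin n)) : Prop :=
  (p.1 ∈ A ∧ p.2 ∈ B) ∨ (p.2 ∈ A ∧ p.1 ∈ B)

/-- Maximality gives two branches at `A₀` and at its parent. The names `A` and `B` are distributed
so that the selected pair of `P` has its marking inside `A₀` in `A`; this breaks the symmetry and
decides which adjacent facet shares the selected pairs. -/
lemma IsMaxHierarchy.exists_isTriple (hn : 3 ≤ n) (hM : IsMaxHierarchy r 𝒜) (hA₀ : A₀ ∈ 𝒜)
    (hP : IsParent r 𝒜 A₀ P) {e : Finset (Fin n) → Fin n × Fin n} (he : IsSelection r 𝒜 e) :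
    ∃ A B C, IsTriple r 𝒜 A₀ P A B C ∧ Separates (e A₀) A B ∧ Separates (e P) A C := by
  have h := hM.1
  have hA₀' := mem_withTop_of_mem (r := r) hA₀
  obtain ⟨A, B, hA, hB, hdisj, hunion⟩ := hM.exists_branches hn hA₀' (he A₀ hA₀')
  -- the parent is the union of `A₀` and another branch
  have hout : ∃ C x c, (C ∈ 𝒜 ∨ ∃ b, C = {b}) ∧ Disjoint A₀ C ∧ A₀ ∪ C = P ∧ x ∈ A₀ ∧ c ∈ C ∧
      (e P = (x, c) ∨ e P = (c, x)) := by
    -- A branch of `P` that meets `A₀` equals `A₀`, since no cluster lies strictly between `A₀` and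
    -- its parent.
    have hkey : ∀ (p : Fin n × Fin n) (B' C' : Finset (Fin n)), IsMeet 𝒜 P p →
        IsBranch 𝒜 P p.1 B' → IsBranch 𝒜 P p.2 C' → Disjoint B' C' → B' ∪ C' = P →
        (∃ a ∈ A₀, a ∈ B') → B' = A₀ := by
      rintro p B' C' - hB' - - - ⟨a, ha, haB⟩
      rcases hB'.node with h' | h'
      · have hsub : A₀ ⊆ B' := by
          rcases (h.compat A₀ hA₀ B' h').of_mem ha haB with h'' | h''
          · exact h''
          · exact hB'.max A₀ hA₀ (h'' hB'.mem) hP.ssubset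
        by_contra hne
        exact hB'.ssubset.2 (hP.min B' (mem_withTop_of_mem h')
          (Finset.ssubset_iff_subset_ne.2 ⟨hsub, Ne.symm hne⟩))
      · rw [h', Finset.mem_singleton] at haB
        subst haB
        have h1 := Finset.card_le_card (hB'.max A₀ hA₀ ha hP.ssubset)
        have h2 := h.one_lt_card A₀ hA₀
        rw [h', Finset.card_singleton] at h1
        omega
    obtain ⟨B', C', hB', hC', hd', hu'⟩ := hM.exists_branches hn hP.mem (he P hP.mem)
    obtain ⟨a, ha⟩ := h.nonempty_withTop hn hA₀'
    have haP := hP.ssubset.1 ha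
    rw [← hu', Finset.mem_union] at haP
    rcases haP with haB | haC
    · obtain rfl := hkey _ _ _ (he P hP.mem) hB' hC' hd' hu' ⟨a, ha, haB⟩
      exact ⟨C', _, _, hC'.node.imp_right fun h => ⟨_, h⟩, hd', hu', hB'.mem, hC'.mem, Or.inl rfl⟩
    · obtain rfl := hkey _ _ _ (he P hP.mem).swap hC' hB' hd'.symm
        (by rw [Finset.union_comm, hu']) ⟨a, ha, haC⟩
      exact ⟨B', _, _, hB'.node.imp_right fun h => ⟨_, h⟩, hd'.symm,
        by rw [Finset.union_comm, hu'], hC'.mem, hB'.mem, Or.inr rfl⟩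
  obtain ⟨C, x, c, hCn, hCd, hCu, hx, hc, hex⟩ := hout
  have hbmax : ∀ b B, IsBranch 𝒜 A₀ b B → ∀ D ∈ 𝒜, B ⊆ D → D ⊂ A₀ → D ⊆ B :=
    fun b B hB D hD hBD hDA => hB.max D hD (hBD hB.mem) hDA
  have hnode : ∀ b B, IsBranch 𝒜 A₀ b B → (B ∈ 𝒜 ∨ ∃ b, B = {b}) :=
    fun b B hB => hB.node.imp_right fun h => ⟨_, h⟩
  rw [← hunion, Finset.mem_union] at hx
  rcases hx with hx | hx
  · refine ⟨A, B, C, ⟨hA₀, hP, hnode _ _ hA, hnode _ _ hB, hCn, ⟨_, hA.mem⟩, ⟨_, hB.mem⟩, ⟨_, hc⟩,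
      hdisj, hCd, hunion, hCu, hbmax _ _ hA, hbmax _ _ hB⟩, Or.inl ⟨hA.mem, hB.mem⟩, ?_⟩
    rcases hex with h' | h' <;> rw [h']
    · exact Or.inl ⟨hx, hc⟩
    · exact Or.inr ⟨hx, hc⟩
  · refine ⟨B, A, C, ⟨hA₀, hP, hnode _ _ hB, hnode _ _ hA, hCn, ⟨_, hB.mem⟩, ⟨_, hA.mem⟩, ⟨_, hc⟩,
      hdisj.symm, hCd, by rw [Finset.union_comm, hunion], hCu, hbmax _ _ hB, hbmax _ _ hA⟩,
      Or.inr ⟨hB.mem, hA.mem⟩, ?_⟩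
    rcases hex with h' | h' <;> rw [h']
    · exact Or.inl ⟨hx, hc⟩
    · exact Or.inr ⟨hx, hc⟩

namespace IsTriple

lemma symm (hT : IsTriple r 𝒜 A₀ P A B C) : IsTriple r 𝒜 A₀ P B A C :=
  ⟨hT.mem, hT.parent, hT.node_right, hT.node_left, hT.node_out, hT.nonempty_right,
    hT.nonempty_left, hT.nonempty_out, hT.disjoint.symm, hT.disjoint_out,
    by rw [Finset.union_comm, hT.union], hT.union_out, hT.max_right, hT.max_left⟩

lemma left_subset (hT : IsTriple r 𝒜 A₀ P A B C) : A ⊆ A₀ :=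
  hT.union ▸ Finset.subset_union_left

lemma right_subset (hT : IsTriple r 𝒜 A₀ P A B C) : B ⊆ A₀ := hT.symm.left_subset

lemma out_subset (hT : IsTriple r 𝒜 A₀ P A B C) : C ⊆ P :=
  hT.union_out ▸ Finset.subset_union_right

lemma disjoint_left_out (hT : IsTriple r 𝒜 A₀ P A B C) : Disjoint A C :=
  hT.disjoint_out.mono_left hT.left_subset

lemma exchange_subset (hT : IsTriple r 𝒜 A₀ P A B C) : A ∪ C ⊆ P :=
  Finset.union_subset (hT.left_subset.trans hT.parent.ssubset.1) hT.out_subset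

/-- Elements of `A`, `B` and `C` respectively witness that the two clusters overlap without
inclusion. -/
lemma not_compat_exchange (hT : IsTriple r 𝒜 A₀ P A B C) : ¬ Compat (A ∪ C) A₀ := by
  obtain ⟨a, ha⟩ := hT.nonempty_left
  obtain ⟨b, hb⟩ := hT.nonempty_right
  obtain ⟨c, hc⟩ := hT.nonempty_out
  rintro (h' | h' | h')
  · exact Finset.disjoint_right.1 hT.disjoint_out hc (h' (Finset.mem_union_right _ hc))
  · rcases Finset.mem_union.1 (h' (hT.right_subset hb)) with h'' | h''
    · exact Finset.disjoint_left.1 hT.disjoint h'' hb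
    · exact Finset.disjoint_left.1 hT.disjoint_out (hT.right_subset hb) h''
  · exact Finset.disjoint_left.1 h' (Finset.mem_union_left _ ha) (hT.left_subset ha)

lemma exchange_notMem (hT : IsTriple r 𝒜 A₀ P A B C) (h : IsHierarchy r 𝒜) : A ∪ C ∉ 𝒜 :=
  fun hm => hT.not_compat_exchange (h.compat _ hm _ hT.mem)

lemma exchange_ne (hT : IsTriple r 𝒜 A₀ P A B C) : A ∪ C ≠ B ∪ C := by
  intro e
  obtain ⟨a, ha⟩ := hT.nonempty_left
  have : a ∈ B ∪ C := e ▸ Finset.mem_union_left _ ha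
  rcases Finset.mem_union.1 this with h' | h'
  · exact Finset.disjoint_left.1 hT.disjoint ha h'
  · exact Finset.disjoint_left.1 hT.disjoint_left_out ha h'

/-- A cluster inside `P` and different from `A₀` either contains `A₀` and is then `P`, or lies in
`C`, or lies properly in `A₀`, where it is inside `A` or disjoint from `A`. -/
lemma compat_exchange (hT : IsTriple r 𝒜 A₀ P A B C) (h : IsHierarchy r 𝒜) (hD : D ∈ 𝒜)
    (hne : D ≠ A₀) : Compat (A ∪ C) D := by
  have hDt := mem_withTop_of_mem (r := r) hD
  obtain ⟨a, ha⟩ := hT.nonempty_left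
  rcases h.compat_withTop hDt hT.parent.mem with h' | h' | h'
  · rcases h.compat D hD A₀ hT.mem with h2 | h2 | h2
    · have hss : D ⊂ A₀ := Finset.ssubset_iff_subset_ne.2 ⟨h2, hne⟩
      have hcA : Compat D A := by
        rcases hT.node_left with h3 | ⟨b, rfl⟩
        · exact h.compat D hD A h3
        · exact compat_singleton _ _
      rcases hcA with h3 | h3 | h3
      · exact Or.inr (Or.inl (h3.trans Finset.subset_union_left))
      · exact Or.inr (Or.inl ((hT.max_left D hD h3 hss).trans Finset.subset_union_left))
      · exact Or.inr (Or.inr (Finset.disjoint_union_left.2 ⟨h3.symm,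
          (hT.disjoint_out.mono_left h2).symm⟩))
    · have hss : A₀ ⊂ D := Finset.ssubset_iff_subset_ne.2 ⟨h2, hne.symm⟩
      exact Or.inl (hT.exchange_subset.trans (hT.parent.min D hDt hss))
    · refine Or.inr (Or.inl fun i hi => Finset.mem_union_right _ ?_)
      have := h' hi
      rw [← hT.union_out, Finset.mem_union] at this
      exact this.resolve_left (Finset.disjoint_left.1 h2 hi)
  · exact Or.inl (hT.exchange_subset.trans h')
  · exact Or.inr (Or.inr (h'.symm.mono_left hT.exchange_subset))

lemma isHierarchy_exchange (hT : IsTriple r 𝒜 A₀ P A B C) (h : IsHierarchy r 𝒜) :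
    IsHierarchy r (insert (A ∪ C) (𝒜.erase A₀)) := by
  have hPtop := h.subset_top hT.parent.mem
  obtain ⟨a, ha⟩ := hT.nonempty_left
  obtain ⟨b, hb⟩ := hT.nonempty_right
  obtain ⟨c, hc⟩ := hT.nonempty_out
  refine (h.mono (Finset.erase_subset _ _)).insert ?_ ?_ ?_ ?_
  · exact fun hr => mem_topCluster.1 (hPtop (hT.exchange_subset hr)) rfl
  · refine Finset.one_lt_card.2 ⟨a, Finset.mem_union_left _ ha, c, Finset.mem_union_right _ hc, ?_⟩
    rintro rfl
    exact Finset.disjoint_left.1 hT.disjoint_left_out ha hc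
  · refine ⟨b, mem_topCluster.1 (hPtop (hT.parent.ssubset.1 (hT.right_subset hb))), fun hm => ?_⟩
    rcases Finset.mem_union.1 hm with h' | h'
    · exact Finset.disjoint_left.1 hT.disjoint h' hb
    · exact Finset.disjoint_left.1 hT.symm.disjoint_left_out hb h'
  · intro D hD
    rw [Finset.mem_erase] at hD
    exact hT.compat_exchange h hD.2 hD.1

lemma isMaxHierarchy_exchange (hn : 3 ≤ n) (hT : IsTriple r 𝒜 A₀ P A B C)
    (hM : IsMaxHierarchy r 𝒜) : IsMaxHierarchy r (insert (A ∪ C) (𝒜.erase A₀)) := by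
  refine (hT.isHierarchy_exchange hM.1).isMaxHierarchy hn ?_
  rw [Finset.card_insert_of_notMem fun hm => hT.exchange_notMem hM.1 (Finset.mem_of_mem_erase hm),
    Finset.card_erase_add_one hT.mem, hM.card_eq hn]

/-- There are exactly three ways to complete a maximal hierarchy without one of its clusters. -/
lemma eq_or_eq_or_eq (hT : IsTriple r 𝒜 A₀ P A B C) (hM : IsMaxHierarchy r 𝒜)
    (hD : IsHierarchy r (insert D (𝒜.erase A₀))) (hD' : D ∉ 𝒜.erase A₀) :
    D = A₀ ∨ D = A ∪ C ∨ D = B ∪ C := by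
  have h := hM.1
  have hDm : D ∈ insert D (𝒜.erase A₀) := Finset.mem_insert_self _ _
  have hcomp : ∀ E ∈ 𝒜, E ≠ A₀ → Compat D E := fun E hE hne =>
    hD.compat D hDm E (Finset.mem_insert_of_mem (Finset.mem_erase.2 ⟨hne, hE⟩))
  -- If `D` is compatible with `A₀` as well, maximality puts `D` into `𝒜`. Otherwise `D` overlaps
  -- `A₀`; then it lies in `P`, contains `C`, and contains exactly one of the two branches of `A₀`.
  by_cases hc : Compat D A₀
  · refine Or.inl ?_
    by_contra hne
    refine hD' (Finset.mem_erase.2 ⟨hne, hM.2 D ?_⟩)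
    refine h.insert (hD.root_notMem D hDm) (hD.one_lt_card D hDm) (hD.proper D hDm) fun E hE => ?_
    by_cases hEA : E = A₀
    · rwa [hEA]
    · exact hcomp E hE hEA
  refine Or.inr ?_
  obtain ⟨⟨x, hxD, hxA⟩, ⟨y, hyD, hyA⟩, ⟨z, hzA, hzD⟩⟩ := not_compat hc
  have hDP : D ⊆ P := by
    have : Compat D P := by
      rcases Finset.mem_insert.1 hT.parent.mem with h' | h'
      · rw [h']; exact Or.inl (subset_topCluster (hD.root_notMem D hDm))
      · exact hcomp P h' fun e => hT.parent.ssubset.ne e.symm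
    rcases this.of_mem hxD (hT.parent.ssubset.1 hxA) with h' | h'
    · exact h'
    · exact absurd (h' (hT.parent.ssubset.1 hzA)) hzD
  have hnode : ∀ E, (E ∈ 𝒜 ∨ ∃ b, E = {b}) → E ≠ A₀ → Compat D E := by
    rintro E (h' | ⟨b, rfl⟩) hne
    · exact hcomp E h' hne
    · exact compat_singleton _ _
  have hCD : C ⊆ D := by
    have hyC : y ∈ C := by
      have := hDP hyD
      rw [← hT.union_out, Finset.mem_union] at this
      exact this.resolve_left hyA
    rcases (hnode C hT.node_out fun e => hyA (e ▸ hyC)).of_mem hyD hyC with h' | h'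
    · exact absurd (h' hxD) (Finset.disjoint_left.1 hT.disjoint_out hxA)
    · exact h'
  have hside : ∀ A B, IsTriple r 𝒜 A₀ P A B C → x ∈ A → D = A ∪ C := by
    intro A B hT hxA'
    have hneA : A ≠ A₀ := by
      rintro rfl
      obtain ⟨b, hb⟩ := hT.nonempty_right
      exact Finset.disjoint_right.1 hT.disjoint hb (hT.right_subset hb)
    have hneB : B ≠ A₀ := by
      rintro rfl
      exact Finset.disjoint_left.1 hT.disjoint hxA' hxA
    have hAD : A ⊆ D := by
      rcases (hnode A hT.node_left hneA).of_mem hxD hxA' with h' | h'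
      · exact absurd (hT.left_subset (h' hyD)) hyA
      · exact h'
    have hBD : Disjoint D B := by
      rcases hnode B hT.node_right hneB with h' | h' | h'
      · exact absurd (hT.right_subset (h' hyD)) hyA
      · have : A₀ ⊆ D := by rw [← hT.union]; exact Finset.union_subset hAD h'
        exact absurd (this hzA) hzD
      · exact h'
    refine subset_antisymm (fun i hi => ?_) (Finset.union_subset hAD hCD)
    have := hDP hi
    rw [← hT.union_out, ← hT.union, Finset.mem_union, Finset.mem_union] at this
    rcases this with (h' | h') | h'
    · exact Finset.mem_union_left _ h'
    · exact absurd h' (Finset.disjoint_left.1 hBD hi)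
    · exact Finset.mem_union_right _ h'
  have hx := hxA
  rw [← hT.union, Finset.mem_union] at hx
  rcases hx with hx | hx
  · exact Or.inl (hside A B hT hx)
  · exact Or.inr (hside B A hT.symm hx)

/-- A selection for the exchanged hierarchy with the same chosen pairs. -/
lemma exists_isSelection_exchange (hT : IsTriple r 𝒜 A₀ P A B C) (h : IsHierarchy r 𝒜)
    {e : Finset (Fin n) → Fin n × Fin n} (he : IsSelection r 𝒜 e) (h₀ : Separates (e A₀) A B)
    (hP : Separates (e P) A C) :
    ∃ e', IsSelection r (insert (A ∪ C) (𝒜.erase A₀)) e' ∧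
      ∀ D ∈ withTop r (insert (A ∪ C) (𝒜.erase A₀)), ∃ D' ∈ withTop r 𝒜, e' D = e D' := by
  classical
  have hA₀t := mem_withTop_of_mem (r := r) hT.mem
  -- The pair of `P` joins `A` to `C` and so now meets at `A ∪ C`; the pair of `A₀` joins `A` to `B`
  -- and now meets only at `P`. The two pairs are swapped and all others are kept.
  refine ⟨fun D => if D = A ∪ C then e P else if D = P then e A₀ else e D, ?_, ?_⟩
  · have hmin : ∀ B' ∈ insert (A ∪ C) (𝒜.erase A₀), B' = A ∪ C ∨ B' ∈ 𝒜 ∧ B' ≠ A₀ := by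
      intro B' hB'
      rw [Finset.mem_insert, Finset.mem_erase] at hB'
      exact hB'.imp_right And.symm
    intro D hD
    simp only
    split_ifs with h1 h2
    · subst h1
      refine ⟨(he P hT.parent.mem).ne, ?_, ?_, fun B' hB' hx hc => ?_⟩
      · rcases hP with h' | h'
        · exact Finset.mem_union_left _ h'.1
        · exact Finset.mem_union_right _ h'.2
      · rcases hP with h' | h'
        · exact Finset.mem_union_right _ h'.2
        · exact Finset.mem_union_left _ h'.1
      · rcases hmin B' hB' with rfl | ⟨h', -⟩
        · exact subset_rfl
        · exact hT.exchange_subset.trans ((he P hT.parent.mem).min B' h' hx hc)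
    · subst h2
      have hm := he A₀ hA₀t
      refine ⟨hm.ne, hT.parent.ssubset.1 hm.fst_mem, hT.parent.ssubset.1 hm.snd_mem,
        fun B' hB' hx hc => ?_⟩
      rcases hmin B' hB' with rfl | ⟨h', hne⟩
      · exfalso
        have hb : ∀ b ∈ B, b ∉ A ∪ C := fun b hb hm => by
          rcases Finset.mem_union.1 hm with h' | h'
          · exact Finset.disjoint_left.1 hT.disjoint h' hb
          · exact Finset.disjoint_left.1 hT.symm.disjoint_left_out hb h'
        rcases h₀ with h' | h'
        · exact hb _ h'.2 hc
        · exact hb _ h'.2 hx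
      · exact hT.parent.min B' (mem_withTop_of_mem h')
          (Finset.ssubset_iff_subset_ne.2 ⟨hm.min B' h' hx hc, hne.symm⟩)
    · have hD𝒜 : D ∈ withTop r 𝒜 ∧ D ≠ A₀ := by
        rcases Finset.mem_insert.1 hD with rfl | hD'
        · exact ⟨top_mem_withTop, fun e => h.top_notMem (e ▸ hT.mem)⟩
        · obtain ⟨h', h''⟩ := (hmin D hD').resolve_left h1
          exact ⟨mem_withTop_of_mem h', h''⟩
      have hm := he D hD𝒜.1
      refine ⟨hm.ne, hm.fst_mem, hm.snd_mem, fun B' hB' hx hc => ?_⟩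
      rcases hmin B' hB' with rfl | ⟨h', -⟩
      · -- `D` is contained in the parent
        have hDP : D ⊆ P := by
          rcases Finset.mem_insert.1 hT.parent.mem with h' | h'
          · rw [h']; exact h.subset_top hD𝒜.1
          · exact hm.min P h' (hT.exchange_subset hx) (hT.exchange_subset hc)
        -- The remaining danger is a cluster `D` whose pair lies in `A ∪ C`. If it contained `A ∪
        -- C`, it would either be contained in `A₀`, impossible because of `C`, or contain the
        -- parent `P` and be equal to it.
        have hDm : D ∈ 𝒜 := by
          rcases Finset.mem_insert.1 hD𝒜.1 with h' | h'
          · exact absurd (subset_antisymm hDP (h'.symm ▸ h.subset_top hT.parent.mem)) h2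
          · exact h'
        rcases (hT.compat_exchange h hDm hD𝒜.2).of_mem hx hm.fst_mem with h' | h'
        · exfalso
          obtain ⟨a, ha⟩ := hT.nonempty_left
          obtain ⟨c, hc⟩ := hT.nonempty_out
          rcases (h.compat D hDm A₀ hT.mem).of_mem (h' (Finset.mem_union_left _ ha))
            (hT.left_subset ha) with h'' | h''
          · exact Finset.disjoint_right.1 hT.disjoint_out hc
              (h'' (h' (Finset.mem_union_right _ hc)))
          · refine h2 (subset_antisymm hDP (hT.parent.min D hD𝒜.1
              (Finset.ssubset_iff_subset_ne.2 ⟨h'', hD𝒜.2.symm⟩)))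
        · exact h'
      · exact hm.min B' h' hx hc
  · intro D hD
    simp only
    split_ifs with h1 h2
    · exact ⟨P, hT.parent.mem, rfl⟩
    · exact ⟨A₀, hA₀t, rfl⟩
    · refine ⟨D, ?_, rfl⟩
      rcases Finset.mem_insert.1 hD with rfl | hD'
      · exact top_mem_withTop
      · exact mem_withTop_of_mem (Finset.mem_of_mem_erase
          ((Finset.mem_insert.1 hD').resolve_left h1))

end IsTriple

end Exchange

/-! ### Split vectors, Gromov products and their ultrametric property -/

section Splits

variable {n : ℕ} {r : Fin n} {𝒜 ℬ : Finset (Finset (Fin n))} {A₀ A B C D P : Finset (Fin n)}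

/-- The indicator function of a cluster. -/
def ind (A : Finset (Fin n)) (i : Fin n) : ℤ := if i ∈ A then 1 else 0

lemma ind_of_mem {i : Fin n} (h : i ∈ A) : ind A i = 1 := if_pos h

lemma ind_of_notMem {i : Fin n} (h : i ∉ A) : ind A i = 0 := if_neg h

lemma ind_nonneg (A : Finset (Fin n)) (i : Fin n) : 0 ≤ ind A i := by
  unfold ind; split_ifs <;> norm_num

lemma ind_union (h : Disjoint A B) (i : Fin n) : ind (A ∪ B) i = ind A i + ind B i := by
  unfold ind
  by_cases hA : i ∈ A
  · have := Finset.disjoint_left.1 h hA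
    simp [hA, this]
  · simp [hA]

/-- The double ratio of the tree with a single bounded edge of length one that separates the
cluster `A` from its complement. -/
def splitVec (A : Finset (Fin n)) (q : PairOfPairs n) : ℤ :=
  (ind A (q 0) - ind A (q 1)) * (ind A (q 2) - ind A (q 3))

lemma exists_pairOfPairs {a b c d : Fin n} (hab : a ≠ b) (hac : a ≠ c) (had : a ≠ d) (hbc : b ≠ c)
    (hbd : b ≠ d) (hcd : c ≠ d) :
    ∃ q : PairOfPairs n, q 0 = a ∧ q 1 = b ∧ q 2 = c ∧ q 3 = d := by
  refine ⟨⟨![a, b, c, d], ?_⟩, rfl, rfl, rfl, rfl⟩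
  intro i j hij
  fin_cases i <;> fin_cases j <;> simp_all

/-- The four markings are distinct, so `b` occurs in at most one of the two factors and the other
factor vanishes. -/
lemma splitVec_singleton (b : Fin n) (q : PairOfPairs n) : splitVec {b} q = 0 := by
  have h : ∀ i j : Fin 4, i ≠ j → q i = b → q j ≠ b := fun i j hij hi hj =>
    hij (q.injective (hi.trans hj.symm))
  unfold splitVec ind
  simp only [Finset.mem_singleton]
  by_cases h0 : q 0 = b
  · simp [h 0 2 (by decide) h0, h 0 3 (by decide) h0]
  by_cases h1 : q 1 = b
  · simp [h 1 2 (by decide) h1, h 1 3 (by decide) h1]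
  simp [h0, h1]

/-- Passing to the complement changes the sign of both factors, and the complement of the top
cluster is `{r}`. -/
lemma splitVec_top (q : PairOfPairs n) : splitVec (topCluster r) q = 0 := by
  have h := splitVec_singleton r q
  have hi : ∀ i, ind (topCluster r) i = 1 - ind {r} i := by
    intro i
    unfold ind
    simp only [mem_topCluster, Finset.mem_singleton]
    split_ifs <;> simp_all
  unfold splitVec at *
  rw [hi, hi, hi, hi]
  linarith

/-- Different orderings of two pairs give the same double ratio up to sign. -/
lemma exists_sign {q q' : PairOfPairs n} (h : q'.unordered = q.unordered) :
    ∃ ε : ℤ, (ε = 1 ∨ ε = -1) ∧ ∀ A : Finset (Fin n), splitVec A q = ε * splitVec A q' := by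
  simp only [PairOfPairs.unordered, Sym2.eq_iff] at h
  rcases h with ⟨h1 | h1, h2 | h2⟩ | ⟨h1 | h1, h2 | h2⟩
  · exact ⟨1, Or.inl rfl, fun A => by unfold splitVec; rw [h1.1, h1.2, h2.1, h2.2]; ring⟩
  · exact ⟨-1, Or.inr rfl, fun A => by unfold splitVec; rw [h1.1, h1.2, h2.1, h2.2]; ring⟩
  · exact ⟨-1, Or.inr rfl, fun A => by unfold splitVec; rw [h1.1, h1.2, h2.1, h2.2]; ring⟩
  · exact ⟨1, Or.inl rfl, fun A => by unfold splitVec; rw [h1.1, h1.2, h2.1, h2.2]; ring⟩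
  · exact ⟨1, Or.inl rfl, fun A => by unfold splitVec; rw [h1.1, h1.2, h2.1, h2.2]; ring⟩
  · exact ⟨-1, Or.inr rfl, fun A => by unfold splitVec; rw [h1.1, h1.2, h2.1, h2.2]; ring⟩
  · exact ⟨-1, Or.inr rfl, fun A => by unfold splitVec; rw [h1.1, h1.2, h2.1, h2.2]; ring⟩
  · exact ⟨1, Or.inl rfl, fun A => by unfold splitVec; rw [h1.1, h1.2, h2.1, h2.2]; ring⟩

/-- A double ratio that is equal to the length of the edge of the cluster `A`, for all trees with
the given hierarchy. -/
lemma IsHierarchy.exists_dual_pairOfPairs (hn : 3 ≤ n) (h : IsHierarchy r 𝒜) (hA : A ∈ 𝒜) :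
    ∃ q : PairOfPairs n, ∀ B ∈ 𝒜, splitVec B q = if B = A then 1 else 0 := by
  obtain ⟨p, hp⟩ := h.exists_isMeet hn (mem_withTop_of_mem hA)
  obtain ⟨P, hP⟩ := h.exists_isParent hA
  obtain ⟨c, hcP, hcA⟩ := Finset.exists_of_ssubset hP.ssubset
  have hrA := h.root_notMem A hA
  -- For the pairs (`p.1`, `c`) and (`p.2`, `r`), a cluster contributes only if it contains `p.2`
  -- and separates `p.1` from `c`. The meeting pair excludes clusters properly below `A`, and the
  -- choice of `c` in the parent excludes those above.
  obtain ⟨q, h0, h1, h2, h3⟩ := exists_pairOfPairs (a := p.1) (b := c) (c := p.2) (d := r)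
    (fun e => hcA (e ▸ hp.fst_mem)) hp.ne (fun e => hrA (e ▸ hp.fst_mem))
    (fun e => hcA (e ▸ hp.snd_mem)) (h.ne_root hP.mem hcP) (fun e => hrA (e ▸ hp.snd_mem))
  refine ⟨q, fun B hB => ?_⟩
  unfold splitVec
  rw [h0, h1, h2, h3, ind_of_notMem (h.root_notMem B hB)]
  split_ifs with hBA
  · subst hBA
    rw [ind_of_mem hp.fst_mem, ind_of_mem hp.snd_mem, ind_of_notMem hcA]; norm_num
  · by_cases h2B : p.2 ∈ B
    swap
    · rw [ind_of_notMem h2B]; ring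
    rcases (h.compat B hB A hA).of_mem h2B hp.snd_mem with h' | h'
    · have h1B : p.1 ∉ B := fun h1B => hBA (subset_antisymm h' (hp.min B hB h1B h2B))
      rw [ind_of_notMem h1B, ind_of_notMem fun hc => hcA (h' hc)]; ring
    · have hcB : c ∈ B := hP.min B (mem_withTop_of_mem hB)
        (Finset.ssubset_iff_subset_ne.2 ⟨h', Ne.symm hBA⟩) hcP
      rw [ind_of_mem (h' hp.fst_mem), ind_of_mem hcB]; ring

/-! ### Gromov products -/

/-- The Gromov product of two markings with respect to the root, for the tree with edge lengths
`l`. -/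
def gram (l : Finset (Fin n) → ℝ) (i j : Fin n) : ℝ := ∑ A, l A * ((ind A i * ind A j : ℤ) : ℝ)

lemma gram_comm (l : Finset (Fin n) → ℝ) (i j : Fin n) : gram l i j = gram l j i := by
  unfold gram
  refine Finset.sum_congr rfl fun A _ => ?_
  rw [mul_comm (ind A i)]

/-- Nonnegative edge lengths on a hierarchy. -/
structure IsWeight (𝒜 : Finset (Finset (Fin n))) (l : Finset (Fin n) → ℝ) : Prop where
  nonneg : ∀ A, 0 ≤ l A
  support : ∀ A, A ∉ 𝒜 → l A = 0

variable {l m : Finset (Fin n) → ℝ}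

lemma IsWeight.gram_le (hl : IsWeight 𝒜 l) {i j i' j' : Fin n}
    (h : ∀ D ∈ 𝒜, i ∈ D → j ∈ D → i' ∈ D ∧ j' ∈ D) : gram l i j ≤ gram l i' j' := by
  refine Finset.sum_le_sum fun D _ => ?_
  by_cases hD : D ∈ 𝒜
  · refine mul_le_mul_of_nonneg_left (Int.cast_le.2 ?_) (hl.nonneg D)
    by_cases hi : i ∈ D
    · by_cases hj : j ∈ D
      · rw [ind_of_mem hi, ind_of_mem hj, ind_of_mem (h D hD hi hj).1, ind_of_mem (h D hD hi hj).2]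
      · rw [ind_of_notMem hj, mul_zero]
        exact mul_nonneg (ind_nonneg _ _) (ind_nonneg _ _)
    · rw [ind_of_notMem hi, zero_mul]
      exact mul_nonneg (ind_nonneg _ _) (ind_nonneg _ _)
  · rw [hl.support D hD, zero_mul, zero_mul]

/-- Gromov products are ultrametric. -/
lemma IsWeight.gram_ultra (h : IsHierarchy r 𝒜) (hl : IsWeight 𝒜 l) (i j k : Fin n) :
    gram l i j ≤ gram l i k ∨ gram l j k ≤ gram l i k := by
  by_cases hc : ∀ D ∈ 𝒜, i ∈ D → j ∈ D → k ∈ D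
  · exact Or.inl (hl.gram_le fun D hD hi hj => ⟨hi, hc D hD hi hj⟩)
  · push Not at hc
    obtain ⟨D, hD, hi, hj, hk⟩ := hc
    refine Or.inr (hl.gram_le fun E hE hj' hk' => ⟨?_, hk'⟩)
    rcases (h.compat E hE D hD).of_mem hj' hj with h' | h'
    · exact absurd (h' hk') hk
    · exact h' hi

lemma gram_sub_gram (l : Finset (Fin n) → ℝ) (a b c : Fin n) :
    gram l a b - gram l b c = ∑ D, l D * ((ind D b * (ind D a - ind D c) : ℤ) : ℝ) := by
  unfold gram
  rw [← Finset.sum_sub_distrib]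
  refine Finset.sum_congr rfl fun D _ => ?_
  rw [← mul_sub, ← Int.cast_sub]
  congr 2; ring

/-- Only a cluster with `b` and `c` but without `a` could contribute negatively. It would share `b`
with `A`, so it would lie inside `A` or contain it, and both are impossible. The cluster `A` itself
contributes `l A`. -/
lemma IsWeight.le_gram_sub_gram (h : IsHierarchy r 𝒜) (hl : IsWeight 𝒜 l) (hA : A ∈ 𝒜)
    {a b c : Fin n} (ha : a ∈ A) (hb : b ∈ A) (hc : c ∉ A) :
    l A ≤ gram l a b - gram l b c := by
  rw [gram_sub_gram]
  have hterm : ∀ D ∈ Finset.univ, 0 ≤ l D * ((ind D b * (ind D a - ind D c) : ℤ) : ℝ) := by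
    intro D _
    by_cases hD : D ∈ 𝒜
    swap
    · rw [hl.support D hD, zero_mul]
    refine mul_nonneg (hl.nonneg D) (Int.cast_nonneg ?_)
    by_cases hbD : b ∈ D
    swap
    · rw [ind_of_notMem hbD, zero_mul]
    rcases (h.compat D hD A hA).of_mem hbD hb with h' | h'
    · rw [ind_of_notMem fun hcD => hc (h' hcD), sub_zero]
      exact mul_nonneg (ind_nonneg _ _) (ind_nonneg _ _)
    · rw [ind_of_mem (h' ha), ind_of_mem hbD]
      unfold ind; split_ifs <;> norm_num
  refine le_trans (le_of_eq ?_) (Finset.single_le_sum hterm (Finset.mem_univ A))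
  rw [ind_of_mem ha, ind_of_mem hb, ind_of_notMem hc]; norm_num

/-- Together with `IsWeight.le_gram_sub_gram` this exhibits each edge length as a minimum of
differences of Gromov products. The set `A` need not be a cluster of `𝒜`, so that two different
hierarchies can be compared. -/
lemma IsWeight.exists_gram_sub_gram_le (hn : 3 ≤ n) (h : IsHierarchy r 𝒜) (hl : IsWeight 𝒜 l)
    (hr : r ∉ A) (hA : 1 < A.card) (hp : ∃ c, c ≠ r ∧ c ∉ A) :
    ∃ a b c, a ∈ A ∧ b ∈ A ∧ a ≠ b ∧ c ∉ A ∧ c ≠ r ∧ gram l a b - gram l b c ≤ l A := by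
  by_cases hcomp : ∀ B ∈ 𝒜, Compat A B
  · have h' := h.insert hr hA hp hcomp
    have hA' : A ∈ insert A 𝒜 := Finset.mem_insert_self _ _
    -- With a meeting pair of `A` and a marking `c` of its parent, every other cluster containing
    -- the pair contains `A` properly, hence the parent and `c`, so it contributes nothing positive.
    obtain ⟨p, hpm⟩ := h'.exists_isMeet hn (mem_withTop_of_mem hA')
    obtain ⟨P, hP⟩ := h'.exists_isParent hA'
    obtain ⟨c, hcP, hcA⟩ := Finset.exists_of_ssubset hP.ssubset
    refine ⟨p.1, p.2, c, hpm.fst_mem, hpm.snd_mem, hpm.ne, hcA, h'.ne_root hP.mem hcP, ?_⟩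
    rw [gram_sub_gram, ← Finset.sum_erase_add _ _ (Finset.mem_univ A), ind_of_mem hpm.fst_mem,
      ind_of_mem hpm.snd_mem, ind_of_notMem hcA, sub_zero, mul_one,
      Int.cast_one, mul_one, add_le_iff_nonpos_left]
    refine Finset.sum_nonpos fun D hD => ?_
    by_cases hD𝒜 : D ∈ 𝒜
    swap
    · rw [hl.support D hD𝒜, zero_mul]
    have hDi : D ∈ insert A 𝒜 := Finset.mem_insert_of_mem hD𝒜
    refine mul_nonpos_of_nonneg_of_nonpos (hl.nonneg D) ?_
    have : ind D p.2 * (ind D p.1 - ind D c) ≤ 0 := by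
      by_cases h2 : p.2 ∈ D
      swap
      · rw [ind_of_notMem h2, zero_mul]
      by_cases h1 : p.1 ∈ D
      · have hAD := hpm.min D hDi h1 h2
        have hcD := hP.min D (mem_withTop_of_mem hDi)
          (Finset.ssubset_iff_subset_ne.2 ⟨hAD, (Finset.ne_of_mem_erase hD).symm⟩) hcP
        rw [ind_of_mem h1, ind_of_mem hcD, sub_self, mul_zero]
      · rw [ind_of_notMem h1, zero_sub, mul_neg, neg_nonpos]
        exact mul_nonneg (ind_nonneg _ _) (ind_nonneg _ _)
    exact_mod_cast this
  · push Not at hcomp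
    obtain ⟨B, hB, hnc⟩ := hcomp
    -- A cluster `B` crossing `A` makes the difference nonpositive: every cluster containing both
    -- `a` and `b` contains `B` and hence `c`.
    obtain ⟨⟨b, hbA, hbB⟩, ⟨a, haA, haB⟩, ⟨c, hcB, hcA⟩⟩ := not_compat hnc
    refine ⟨a, b, c, haA, hbA, fun e => haB (e ▸ hbB), hcA,
      h.ne_root (mem_withTop_of_mem hB) hcB, ?_⟩
    refine le_trans ?_ (hl.nonneg A)
    rw [sub_nonpos]
    refine hl.gram_le fun D hD ha hb => ⟨hb, ?_⟩
    rcases (h.compat D hD B hB).of_mem hb hbB with h' | h'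
    · exact absurd (h' ha) haB
    · exact h' hcB

/-- The edge lengths are determined by the differences of Gromov products. -/
lemma IsWeight.eq_of_gram (hn : 3 ≤ n) (hA : IsHierarchy r 𝒜) (hB : IsHierarchy r ℬ)
    (hl : IsWeight 𝒜 l) (hm : IsWeight ℬ m)
    (h : ∀ a b c, a ≠ r → b ≠ r → c ≠ r → a ≠ b → b ≠ c →
      gram l a b - gram l b c = gram m a b - gram m b c) : l = m := by
  have key : ∀ (𝒜 ℬ : Finset (Finset (Fin n))) (l m : Finset (Fin n) → ℝ), IsHierarchy r 𝒜 →
      IsHierarchy r ℬ → IsWeight 𝒜 l → IsWeight ℬ m →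
      (∀ a b c, a ≠ r → b ≠ r → c ≠ r → a ≠ b → b ≠ c →
      gram l a b - gram l b c = gram m a b - gram m b c) → ∀ A, m A ≤ l A := by
    intro 𝒜 ℬ l m h𝒜 hℬ hl hm h A
    by_cases hAB : A ∈ ℬ
    swap
    · rw [hm.support A hAB]; exact hl.nonneg A
    obtain ⟨a, b, c, ha, hb, hab, hc, hcr, hle⟩ := hl.exists_gram_sub_gram_le hn h𝒜
      (hℬ.root_notMem A hAB) (hℬ.one_lt_card A hAB) (hℬ.proper A hAB)
    have hne := fun {i} => hℬ.ne_root (mem_withTop_of_mem hAB) (i := i)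
    rw [h a b c (hne ha) (hne hb) hcr hab fun e => hc (e ▸ hb)] at hle
    exact (hm.le_gram_sub_gram hℬ hAB ha hb hc).trans hle
  ext A
  exact le_antisymm (key ℬ 𝒜 m l hB hA hm hl (fun a b c h1 h2 h3 h4 h5 =>
    (h a b c h1 h2 h3 h4 h5).symm) A) (key 𝒜 ℬ l m hA hB hl hm h A)

/-- A tree with a maximal hierarchy has the smallest Gromov products among all trees with the same
Gromov products of the selected pairs. -/
theorem IsMaxHierarchy.gram_le (hn : 3 ≤ n) (hM : IsMaxHierarchy r 𝒜)
    {e : Finset (Fin n) → Fin n × Fin n} (he : IsSelection r 𝒜 e) (hl : IsWeight 𝒜 l)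
    (hB : IsHierarchy r ℬ) (hm : IsWeight ℬ m) {κ : ℝ}
    (hκ : ∀ A ∈ withTop r 𝒜, gram m (e A).1 (e A).2 = gram l (e A).1 (e A).2 + κ)
    {i j : Fin n} (hi : i ≠ r) (hj : j ≠ r) (hij : i ≠ j) :
    gram l i j + κ ≤ gram m i j := by
  have h := hM.1
  have hdepth : ∀ A ∈ withTop r 𝒜, ∀ i ∈ A, ∀ j ∈ A,
      gram l (e A).1 (e A).2 ≤ gram l i j := fun A hA i hi j hj =>
    hl.gram_le fun D hD h1 h2 => ⟨(he A hA).min D hD h1 h2 hi, (he A hA).min D hD h1 h2 hj⟩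
  -- Induction on the size of the cluster. Inside a branch the bound follows from the selected pair
  -- of that branch, whose Gromov product for `l` is at least that of `A`.
  have key : ∀ k, ∀ A ∈ withTop r 𝒜, A.card = k → ∀ i ∈ A, ∀ j ∈ A, i ≠ j →
      gram l (e A).1 (e A).2 + κ ≤ gram m i j := by
    intro k
    induction k using Nat.strong_induction_on with
    | _ k ih =>
    intro A hA hk
    obtain ⟨B, C, hbB, hcC, -, hunion⟩ := hM.exists_branches hn hA (he A hA)
    set δ := gram l (e A).1 (e A).2 + κ with hδ
    have hbr : ∀ b B, IsBranch 𝒜 A b B → ∀ i ∈ B, ∀ j ∈ B, i ≠ j → δ ≤ gram m i j := by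
      intro b B hB i hi j hj hij
      rcases hB.node with h' | rfl
      · have hB' := mem_withTop_of_mem (r := r) h'
        refine le_trans ?_ (ih _ (hk ▸ Finset.card_lt_card hB.ssubset) B hB' rfl i hi j hj hij)
        have := hdepth A hA _ (hB.ssubset.1 (he B hB').fst_mem) _ (hB.ssubset.1 (he B hB').snd_mem)
        linarith
      · rw [Finset.mem_singleton] at hi hj
        exact absurd (hi.trans hj.symm) hij
    have hbc : δ ≤ gram m (e A).1 (e A).2 := by rw [hκ A hA]
    -- For markings in different branches the ultrametric inequality is used twice, replacing the
    -- markings of the selected pair by `i` and `j` one at a time.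
    have hcross : ∀ i ∈ B, ∀ j ∈ C, δ ≤ gram m i j := by
      intro i hi j hj
      have h1 : δ ≤ gram m i (e A).2 := by
        by_cases hib : i = (e A).1
        · rw [hib]; exact hbc
        · have := hbr _ _ hbB i hi _ hbB.mem hib
          rcases hm.gram_ultra hB i (e A).1 (e A).2 with h' | h'
          · exact this.trans h'
          · exact hbc.trans h'
      by_cases hjc : j = (e A).2
      · rw [hjc]; exact h1
      · have := hbr _ _ hcC _ hcC.mem j hj (Ne.symm hjc)
        rcases hm.gram_ultra hB i (e A).2 j with h' | h'
        · exact h1.trans h'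
        · exact this.trans h'
    intro i hi j hj hij
    rw [← hunion, Finset.mem_union] at hi hj
    rcases hi with hi | hi <;> rcases hj with hj | hj
    · exact hbr _ _ hbB i hi j hj hij
    · exact hcross i hi j hj
    · rw [gram_comm]; exact hcross j hj i hi
    · exact hbr _ _ hcC i hi j hj hij
  obtain ⟨A, hA, hmeet⟩ := h.exists_meet hij hi hj
  refine le_trans ?_ (key _ A hA rfl i hmeet.fst_mem j hmeet.snd_mem hij)
  have : gram l i j ≤ gram l (e A).1 (e A).2 := hl.gram_le fun D hD h1 h2 =>
    ⟨hmeet.min D hD h1 h2 (he A hA).fst_mem, hmeet.min D hD h1 h2 (he A hA).snd_mem⟩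
  linarith

end Splits

/-! ### The polyhedral complex of all hierarchies -/

section Complex

variable {n : ℕ} {r : Fin n} {𝒜 ℬ : Finset (Finset (Fin n))} {A₀ A B C D P : Finset (Fin n)}

/-- The coordinates in `S` of the split vector of a cluster. -/
def splitVecOn (S : Finset (PairOfPairs n)) (A : Finset (Fin n)) : S → ℤ := fun q => splitVec A q.1

/-- `S` contains an ordering of each choice of two disjoint pairs. -/
def IsComplete (S : Finset (PairOfPairs n)) : Prop :=
  ∀ q : PairOfPairs n, ∃ q' ∈ S, q'.unordered = q.unordered

lemma isComplete_univ : IsComplete (Finset.univ : Finset (PairOfPairs n)) :=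
  fun q => ⟨q, Finset.mem_univ q, rfl⟩

variable {S : Finset (PairOfPairs n)} {l m : Finset (Fin n) → ℝ}

lemma IsComplete.exists_form (hS : IsComplete S) (q : PairOfPairs n) :
    ∃ z : S → ℤ, ∀ A, intPairing z (splitVecOn S A) = splitVec A q := by
  classical
  obtain ⟨q', hq', hu⟩ := hS q
  obtain ⟨ε, -, hε⟩ := exists_sign hu
  refine ⟨Pi.single ⟨q', hq'⟩ ε, fun A => ?_⟩
  rw [hε, intPairing_apply]
  simp [Pi.single_apply, splitVecOn]

/-- This is the unimodularity of all cones: on a fixed hierarchy each edge length is one of the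
double ratios, hence a coordinate of `S` up to sign. -/
lemma IsComplete.exists_isDual (hS : IsComplete S) (hn : 3 ≤ n) (h : IsHierarchy r 𝒜) :
    ∃ m, IsDual (splitVecOn S) 𝒜 m := by
  have : ∀ A : Finset (Fin n), ∃ z : S → ℤ, A ∈ 𝒜 → ∀ B ∈ 𝒜,
      intPairing z (splitVecOn S B) = if A = B then 1 else 0 := by
    intro A
    by_cases hA : A ∈ 𝒜
    · obtain ⟨q, hq⟩ := h.exists_dual_pairOfPairs hn hA
      obtain ⟨z, hz⟩ := hS.exists_form q
      refine ⟨z, fun _ B hB => ?_⟩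
      rw [hz, hq B hB]
      simp only [eq_comm]
    · exact ⟨0, fun h => absurd h hA⟩
  choose m hm using this
  exact ⟨m, fun A hA B hB => hm A hA B hB⟩

/-- All differences of Gromov products are integral linear forms in the double ratios. -/
lemma IsComplete.exists_gramForm (hS : IsComplete S) (r : Fin n) {i j k l : Fin n} (hi : i ≠ r)
    (hj : j ≠ r) (hk : k ≠ r) (hl : l ≠ r) (hij : i ≠ j) (hkl : k ≠ l) :
    ∃ z : S → ℤ, ∀ A, r ∉ A →
      intPairing z (splitVecOn S A) = ind A i * ind A j - ind A k * ind A l := by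
  have h1 : ∀ a b c : Fin n, a ≠ r → b ≠ r → c ≠ r → a ≠ b → b ≠ c → ∃ z : S → ℤ, ∀ A, r ∉ A →
      intPairing z (splitVecOn S A) = ind A a * ind A b - ind A b * ind A c := by
    intro a b c ha hb hc hab hbc
    by_cases hac : a = c
    · refine ⟨0, fun A _ => ?_⟩
      rw [hac, intPairing_apply]; simp; ring
    -- For the pairs (`a`, `c`) and (`b`, `r`) the root drops out, because it lies in no cluster.
    · obtain ⟨q, h0, h1, h2, h3⟩ := exists_pairOfPairs hac hab ha hbc.symm hc hb
      obtain ⟨z, hz⟩ := hS.exists_form q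
      refine ⟨z, fun A hA => ?_⟩
      rw [hz, splitVec, h0, h1, h2, h3, ind_of_notMem hA]; ring
  -- Pairs without a common marking are compared through the intermediate pair (`j`, `k`).
  by_cases hjk : j = k
  · subst hjk
    exact h1 i j l hi hj hl hij hkl
  · obtain ⟨z, hz⟩ := h1 i j k hi hj hk hij hjk
    obtain ⟨z', hz'⟩ := h1 j k l hj hk hl hjk hkl
    refine ⟨z + z', fun A hA => ?_⟩
    have : intPairing (z + z') (splitVecOn S A) =
        intPairing z (splitVecOn S A) + intPairing z' (splitVecOn S A) := by
      simp [intPairing_apply, add_mul, Finset.sum_add_distrib]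
    rw [this, hz A hA, hz' A hA]; ring

lemma pairing_comb_eq_gram (h : IsHierarchy r 𝒜) (hl : IsWeight 𝒜 l) {z : S → ℤ} {i j i' j' : Fin n}
    (hz : ∀ A, r ∉ A → intPairing z (splitVecOn S A) = ind A i * ind A j - ind A i' * ind A j') :
    pairing z (comb (splitVecOn S) l) = gram l i j - gram l i' j' := by
  rw [pairing_comb, gram, gram, ← Finset.sum_sub_distrib]
  refine Finset.sum_congr rfl fun A _ => ?_
  by_cases hA : A ∈ 𝒜
  · rw [← intPairing_apply, hz A (h.root_notMem A hA), ← mul_sub, Int.cast_sub]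
  · rw [hl.support A hA]; simp

lemma mem_coneOf_iff_isWeight {ι : Type} {v : Finset (Fin n) → ι → ℤ} {x : ι → ℝ} :
    x ∈ coneOf v 𝒜 ↔ ∃ l, IsWeight 𝒜 l ∧ comb v l = x :=
  ⟨fun ⟨l, h0, h1, h⟩ => ⟨l, ⟨h0, h1⟩, h⟩, fun ⟨l, hl, h⟩ => ⟨l, hl.nonneg, hl.support, h⟩⟩

/-- The edge lengths are determined by the double ratios. -/
lemma IsComplete.eq_of_comb_eq (hS : IsComplete S) (hn : 3 ≤ n) (hA : IsHierarchy r 𝒜)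
    (hB : IsHierarchy r ℬ) (hl : IsWeight 𝒜 l) (hm : IsWeight ℬ m)
    (h : comb (splitVecOn S) l = comb (splitVecOn S) m) : l = m := by
  refine hl.eq_of_gram hn hA hB hm fun a b c ha hb hc hab hbc => ?_
  obtain ⟨z, hz⟩ := hS.exists_gramForm r ha hb hb hc hab hbc
  rw [← pairing_comb_eq_gram hA hl hz, ← pairing_comb_eq_gram hB hm hz, h]

lemma exists_interior_weight (𝒜 : Finset (Finset (Fin n))) :
    ∃ l, IsWeight 𝒜 l ∧ ∀ A ∈ 𝒜, 0 < l A := by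
  classical
  refine ⟨fun A => if A ∈ 𝒜 then 1 else 0, ⟨fun A => ?_, fun A hA => if_neg hA⟩, fun A hA => ?_⟩
  · show (0 : ℝ) ≤ if A ∈ 𝒜 then 1 else 0
    split_ifs <;> norm_num
  · show (0 : ℝ) < if A ∈ 𝒜 then 1 else 0
    rw [if_pos hA]; exact one_pos

/-- A point with positive weights on all of `𝒜` remembers `𝒜` as the support of its unique weights.
-/
lemma IsComplete.coneOf_subset_iff (hS : IsComplete S) (hn : 3 ≤ n) (hA : IsHierarchy r 𝒜)
    (hB : IsHierarchy r ℬ) : coneOf (splitVecOn S) 𝒜 ⊆ coneOf (splitVecOn S) ℬ ↔ 𝒜 ⊆ ℬ := by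
  refine ⟨fun h A hAm => ?_, coneOf_mono⟩
  obtain ⟨l, hl, hpos⟩ := exists_interior_weight 𝒜
  obtain ⟨m, hm, hml⟩ := mem_coneOf_iff_isWeight.1 (h (mem_coneOf_iff_isWeight.2 ⟨l, hl, rfl⟩))
  by_contra hAB
  have := hm.support A hAB
  rw [hS.eq_of_comb_eq hn hB hA hm hl hml] at this
  exact (hpos A hAm).ne' this

lemma IsComplete.coneOf_injective (hS : IsComplete S) (hn : 3 ≤ n) (hA : IsHierarchy r 𝒜)
    (hB : IsHierarchy r ℬ) (h : coneOf (splitVecOn S) 𝒜 = coneOf (splitVecOn S) ℬ) : 𝒜 = ℬ :=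
  subset_antisymm ((hS.coneOf_subset_iff hn hA hB).1 h.le) ((hS.coneOf_subset_iff hn hB hA).1 h.ge)

/-- The polyhedral complex whose facets are the cones of the maximal hierarchies. -/
def hierarchyComplex (hn : 3 ≤ n) (r : Fin n) (hS : IsComplete S) : PolyComplex S (n - 3) where
  facets := {F | ∃ 𝒜, IsMaxHierarchy r 𝒜 ∧ F = coneOf (splitVecOn S) 𝒜}
  finite_facets := by
    refine (Set.finite_range fun 𝒜 => coneOf (splitVecOn S) 𝒜).subset ?_
    rintro _ ⟨𝒜, -, rfl⟩
    exact ⟨𝒜, rfl⟩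
  isPolyhedron := by
    rintro _ ⟨𝒜, h, rfl⟩
    obtain ⟨m, hm⟩ := hS.exists_isDual hn h.1
    exact hm.isRationalPolyhedron
  nonempty := by
    rintro _ ⟨𝒜, h, rfl⟩
    exact ⟨0, zero_mem_coneOf⟩
  dim_eq := by
    rintro _ ⟨𝒜, h, rfl⟩
    obtain ⟨m, hm⟩ := hS.exists_isDual hn h.1
    rw [hm.polyDim_coneOf, h.card_eq hn]
  inter_isFace := by
    classical
    intro T hT F hF
    obtain ⟨𝒜, h𝒜, rfl⟩ := hT hF
    -- The clusters common to all hierarchies of `T`. The weights of a common point are unique, so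
    -- they are supported on every one of these hierarchies.
    let 𝒞 := 𝒜.filter fun A => ∀ ℬ, IsMaxHierarchy r ℬ → coneOf (splitVecOn S) ℬ ∈ T → A ∈ ℬ
    have : ⋂₀ T = coneOf (splitVecOn S) 𝒞 := by
      refine subset_antisymm (fun x hx => ?_) fun x hx G hG => ?_
      · obtain ⟨l, hl, rfl⟩ := mem_coneOf_iff_isWeight.1 (hx _ hF)
        refine mem_coneOf_iff_isWeight.2 ⟨l, ⟨hl.nonneg, fun A hA => ?_⟩, rfl⟩
        by_cases hA𝒜 : A ∈ 𝒜
        · have h1 : ¬ ∀ ℬ, IsMaxHierarchy r ℬ → coneOf (splitVecOn S) ℬ ∈ T → A ∈ ℬ :=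
            fun h' => hA (Finset.mem_filter.2 ⟨hA𝒜, h'⟩)
          push Not at h1
          obtain ⟨ℬ, hℬ, hT', hAℬ⟩ := h1
          obtain ⟨m, hm, hml⟩ := mem_coneOf_iff_isWeight.1 (hx _ hT')
          rw [← hS.eq_of_comb_eq hn hℬ.1 h𝒜.1 hm hl hml]
          exact hm.support A hAℬ
        · exact hl.support A hA𝒜
      · obtain ⟨ℬ, hℬ, rfl⟩ := hT hG
        exact coneOf_mono (fun A (hA : A ∈ 𝒞) => (Finset.mem_filter.1 hA).2 ℬ hℬ hG) hx
    rw [this]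
    obtain ⟨m, hm⟩ := hS.exists_isDual hn h𝒜.1
    exact hm.isExposed_coneOf (Finset.filter_subset _ _)

variable {hn : 3 ≤ n} {hS : IsComplete S}

lemma mem_facets {F : Set (S → ℝ)} : F ∈ (hierarchyComplex hn r hS).facets ↔
    ∃ 𝒜, IsMaxHierarchy r 𝒜 ∧ F = coneOf (splitVecOn S) 𝒜 := Iff.rfl

lemma mem_support {x : S → ℝ} : x ∈ (hierarchyComplex hn r hS).support ↔
    ∃ 𝒜 l, IsHierarchy r 𝒜 ∧ IsWeight 𝒜 l ∧ comb (splitVecOn S) l = x := by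
  constructor
  · rintro ⟨_, ⟨𝒜, h, rfl⟩, hx⟩
    obtain ⟨l, hl, rfl⟩ := mem_coneOf_iff_isWeight.1 hx
    exact ⟨𝒜, l, h.1, hl, rfl⟩
  · rintro ⟨𝒜, l, h, hl, rfl⟩
    obtain ⟨ℬ, hle, hM⟩ := h.exists_isMaxHierarchy
    exact ⟨_, ⟨ℬ, hM, rfl⟩, mem_coneOf_iff_isWeight.2
      ⟨l, ⟨hl.nonneg, fun A hA => hl.support A fun h' => hA (hle h')⟩, rfl⟩⟩

/-- The ridges are the cones of the maximal hierarchies with one cluster removed. -/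
lemma exists_of_isRidge {E F : Set (S → ℝ)} (hE : (hierarchyComplex hn r hS).IsRidge E)
    (hF : F ∈ (hierarchyComplex hn r hS).adjacent E) :
    ∃ 𝒜 A₀, IsMaxHierarchy r 𝒜 ∧ A₀ ∈ 𝒜 ∧ F = coneOf (splitVecOn S) 𝒜 ∧
      E = coneOf (splitVecOn S) (𝒜.erase A₀) := by
  obtain ⟨hne, hdim, G, ⟨ℬ, hℬ, rfl⟩, hexp⟩ := hE
  obtain ⟨⟨𝒜, h𝒜, rfl⟩, hEF⟩ := hF
  obtain ⟨t, ht, rfl⟩ := exists_of_isExposed_coneOf hexp hne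
  obtain ⟨m, hm⟩ := hS.exists_isDual hn hℬ.1
  rw [(hm.mono ht).polyDim_coneOf] at hdim
  have htA := (hS.coneOf_subset_iff hn (hℬ.1.mono ht) h𝒜.1).1 hEF
  have hcard : (𝒜 \ t).card = 1 := by
    rw [Finset.card_sdiff_of_subset htA, h𝒜.card_eq hn]; omega
  obtain ⟨A₀, hA₀⟩ := Finset.card_eq_one.1 hcard
  have hmem : A₀ ∈ 𝒜 \ t := hA₀ ▸ Finset.mem_singleton_self A₀
  rw [Finset.mem_sdiff] at hmem
  refine ⟨𝒜, A₀, h𝒜, hmem.1, rfl, ?_⟩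
  congr 1
  ext A
  rw [Finset.mem_erase]
  constructor
  · exact fun hA => ⟨fun e => hmem.2 (e ▸ hA), htA hA⟩
  · rintro ⟨hne, hA⟩
    by_contra hAt
    exact hne (Finset.mem_singleton.1 (hA₀ ▸ Finset.mem_sdiff.2 ⟨hA, hAt⟩))

lemma exists_adjacent {E : Set (S → ℝ)} (hE : (hierarchyComplex hn r hS).IsRidge E) :
    ∃ F, F ∈ (hierarchyComplex hn r hS).adjacent E := by
  obtain ⟨hne, -, G, hG, hexp⟩ := hE
  exact ⟨G, hG, hexp.subset⟩

/-- An adjacent facet contains all clusters of the ridge and, since all maximal hierarchies have the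
same size, exactly one more; `IsTriple.eq_or_eq_or_eq` lists the possibilities. -/
lemma IsTriple.mem_adjacent_iff (hT : IsTriple r 𝒜 A₀ P A B C) (hM : IsMaxHierarchy r 𝒜)
    {G : Set (S → ℝ)} :
    G ∈ (hierarchyComplex hn r hS).adjacent (coneOf (splitVecOn S) (𝒜.erase A₀)) ↔
      G = coneOf (splitVecOn S) (insert A₀ (𝒜.erase A₀)) ∨
      G = coneOf (splitVecOn S) (insert (A ∪ C) (𝒜.erase A₀)) ∨
      G = coneOf (splitVecOn S) (insert (B ∪ C) (𝒜.erase A₀)) := by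
  have ht : IsHierarchy r (𝒜.erase A₀) := hM.1.mono (Finset.erase_subset _ _)
  constructor
  · rintro ⟨⟨ℬ, hℬ, rfl⟩, hsub⟩
    have hle := (hS.coneOf_subset_iff hn ht hℬ.1).1 hsub
    have hcard : (ℬ \ 𝒜.erase A₀).card = 1 := by
      have h1 := hM.card_eq hn
      have h2 := Finset.card_pos.2 ⟨A₀, hT.mem⟩
      rw [Finset.card_sdiff_of_subset hle, Finset.card_erase_of_mem hT.mem, hℬ.card_eq hn]
      omega
    obtain ⟨D, hD⟩ := Finset.card_eq_one.1 hcard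
    have hDm : D ∈ ℬ \ 𝒜.erase A₀ := hD ▸ Finset.mem_singleton_self D
    have hℬe : ℬ = insert D (𝒜.erase A₀) := by
      rw [← Finset.sdiff_union_of_subset hle, hD]; rfl
    rw [Finset.mem_sdiff] at hDm
    have h3 := hT.eq_or_eq_or_eq hM (hℬe ▸ hℬ.1) hDm.2
    rw [hℬe]
    rcases h3 with rfl | rfl | rfl
    · exact Or.inl rfl
    · exact Or.inr (Or.inl rfl)
    · exact Or.inr (Or.inr rfl)
  · have hsub : ∀ D, coneOf (splitVecOn S) (𝒜.erase A₀) ⊆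
        coneOf (splitVecOn S) (insert D (𝒜.erase A₀)) := fun D =>
      coneOf_mono (Finset.subset_insert _ _)
    rintro (rfl | rfl | rfl)
    · exact ⟨⟨_, (Finset.insert_erase hT.mem).symm ▸ hM, rfl⟩, hsub _⟩
    · exact ⟨⟨_, hT.isMaxHierarchy_exchange hn hM, rfl⟩, hsub _⟩
    · exact ⟨⟨_, hT.symm.isMaxHierarchy_exchange hn hM, rfl⟩, hsub _⟩

/-- The balancing relation between the three split vectors at a ridge. -/
lemma IsTriple.sum_mem_closure (hT : IsTriple r 𝒜 A₀ P A B C) :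
    splitVecOn S A₀ + splitVecOn S (A ∪ C) + splitVecOn S (B ∪ C) ∈
      AddSubgroup.closure (splitVecOn S '' (𝒜.erase A₀ : Finset (Finset (Fin n)))) := by
  -- A split vector is a product of two linear forms in the indicator function, so the three-term
  -- identity Q(a+b) + Q(a+c) + Q(b+c) = Q(a) + Q(b) + Q(c) + Q(a+b+c) of quadratic forms applies to
  -- the disjoint sets.
  have heq : splitVecOn S A₀ + splitVecOn S (A ∪ C) + splitVecOn S (B ∪ C) =
      splitVecOn S A + splitVecOn S B + splitVecOn S C + splitVecOn S P := by
    ext q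
    simp only [splitVecOn, Pi.add_apply, splitVec]
    rw [← hT.union_out]
    simp only [ind_union hT.disjoint_out, ind_union hT.disjoint_left_out,
      ind_union hT.symm.disjoint_left_out]
    rw [← hT.union]
    simp only [ind_union hT.disjoint]
    ring
  -- Each summand is a generator of the ridge or vanishes, being a leaf or the top cluster.
  have hnode : ∀ D, (D ∈ 𝒜 ∨ ∃ b, D = {b}) → D ≠ A₀ → splitVecOn S D ∈
      AddSubgroup.closure (splitVecOn S '' (𝒜.erase A₀ : Finset (Finset (Fin n)))) := by
    rintro D (h | ⟨b, rfl⟩) hne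
    · exact AddSubgroup.subset_closure ⟨D, Finset.mem_coe.2 (Finset.mem_erase.2 ⟨hne, h⟩), rfl⟩
    · have : splitVecOn S {b} = 0 := funext fun q => splitVec_singleton b q.1
      rw [this]; exact zero_mem _
  have hneA : ∀ A B, IsTriple r 𝒜 A₀ P A B C → A ≠ A₀ := by
    rintro A B hT rfl
    obtain ⟨b, hb⟩ := hT.nonempty_right
    exact Finset.disjoint_right.1 hT.disjoint hb (hT.right_subset hb)
  rw [heq]
  refine add_mem (add_mem (add_mem ?_ ?_) ?_) ?_
  · exact hnode A hT.node_left (hneA A B hT)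
  · exact hnode B hT.node_right (hneA B A hT.symm)
  · refine hnode C hT.node_out ?_
    rintro rfl
    obtain ⟨c, hc⟩ := hT.nonempty_out
    exact Finset.disjoint_left.1 hT.disjoint_out hc hc
  · rcases Finset.mem_insert.1 hT.parent.mem with h | h
    · have : splitVecOn S P = 0 := by rw [h]; exact funext fun q => splitVec_top q.1
      rw [this]; exact zero_mem _
    · exact hnode P (Or.inl h) hT.parent.ssubset.ne'

theorem isBalanced_hierarchyComplex : (hierarchyComplex hn r hS).IsBalanced := by
  intro E hE L hL
  obtain ⟨F, hF⟩ := exists_adjacent hE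
  obtain ⟨𝒜, A₀, hM, hA₀, -, rfl⟩ := exists_of_isRidge hE hF
  obtain ⟨e, he⟩ := hM.1.exists_isSelection hn
  obtain ⟨P, hP⟩ := hM.1.exists_isParent hA₀
  obtain ⟨A, B, C, hT, -, -⟩ := hM.exists_isTriple hn hA₀ hP he
  have hne : ∀ A B, IsTriple r 𝒜 A₀ P A B C → A₀ ≠ A ∪ C := fun A B hT e =>
    hT.not_compat_exchange (e ▸ Or.inl subset_rfl)
  let u : Fin 3 → Finset (Fin n) := ![A₀, A ∪ C, B ∪ C]
  have hu : ∀ i, u i ∉ 𝒜.erase A₀ ∧ IsHierarchy r (insert (u i) (𝒜.erase A₀)) := by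
    have h1 : ∀ A B, IsTriple r 𝒜 A₀ P A B C →
        A ∪ C ∉ 𝒜.erase A₀ ∧ IsHierarchy r (insert (A ∪ C) (𝒜.erase A₀)) := fun A B hT =>
      ⟨fun h => hT.exchange_notMem hM.1 (Finset.mem_of_mem_erase h), hT.isHierarchy_exchange hM.1⟩
    intro i
    fin_cases i
    · exact ⟨Finset.notMem_erase _ _, (Finset.insert_erase hA₀).symm ▸ hM.1⟩
    · exact h1 A B hT
    · exact h1 B A hT.symm
  have huinj : Function.Injective u := by
    have h1 := hne A B hT
    have h2 := hne B A hT.symm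
    have h3 := hT.exchange_ne
    intro i j hij
    fin_cases i <;> fin_cases j <;> simp_all [u]
  have hd : ∀ i, ∃ m, IsDual (splitVecOn S) (insert (u i) (𝒜.erase A₀)) m := fun i =>
    hS.exists_isDual hn (hu i).2
  choose m hm using hd
  refine exists_hasIntersectionNumber _ (u := u) (fun i => (hu i).1) hm ?_ ?_ ?_ ?_ L hL
  · have h1 := hM.card_eq hn
    rw [Finset.card_erase_add_one hA₀, h1]
  · intro i j hij
    have h1 := hS.coneOf_injective hn (hu i).2 (hu j).2 hij
    have h2 : u i ∈ insert (u j) (𝒜.erase A₀) := h1 ▸ Finset.mem_insert_self _ _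
    exact huinj ((Finset.mem_insert.1 h2).resolve_right (hu i).1)
  · ext G
    rw [hT.mem_adjacent_iff hM]
    simp [Fin.exists_fin_succ, u, eq_comm]
  · rw [Fin.sum_univ_three]
    exact hT.sum_mem_closure

end Complex

/-! ### The complex of all hierarchies is simply balanced -/

section SimplyBalanced

variable {n : ℕ} {r : Fin n} {𝒜 ℬ : Finset (Finset (Fin n))} {A₀ A B C D P : Finset (Fin n)}
variable {S : Finset (PairOfPairs n)} {hn : 3 ≤ n} {hS : IsComplete S}

/-- A cluster contains both markings of a meeting pair exactly when it contains their smallest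
cluster. -/
lemma IsMeet.ind_mul_ind {p : Fin n × Fin n} (h : IsMeet 𝒜 A p) (hB : B ∈ 𝒜) :
    ind B p.1 * ind B p.2 = if A ⊆ B then 1 else 0 := by
  split_ifs with hAB
  · rw [ind_of_mem (hAB h.fst_mem), ind_of_mem (hAB h.snd_mem), one_mul]
  · by_cases h1 : p.1 ∈ B
    · rw [ind_of_notMem fun h2 => hAB (h.min B hB h1 h2), mul_zero]
    · rw [ind_of_notMem h1, zero_mul]

lemma Separates.ind_mul_ind {p : Fin n × Fin n} (h : Separates p A B) (hD : Disjoint A D) :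
    ind D p.1 * ind D p.2 = 0 := by
  rcases h with h | h
  · rw [ind_of_notMem (Finset.disjoint_left.1 hD h.1), zero_mul]
  · rw [ind_of_notMem (Finset.disjoint_left.1 hD h.1), mul_zero]

lemma Separates.symm {p : Fin n × Fin n} (h : Separates p A B) : Separates p B A := by
  rcases h with h | h
  · exact Or.inr h.symm
  · exact Or.inl h.symm

lemma Separates.ind_mul_ind_union {p : Fin n × Fin n} (h : Separates p A B) :
    ind (A ∪ B) p.1 * ind (A ∪ B) p.2 = 1 := by
  rcases h with h | h
  · rw [ind_of_mem (Finset.mem_union_left _ h.1), ind_of_mem (Finset.mem_union_right _ h.2),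
      one_mul]
  · rw [ind_of_mem (Finset.mem_union_right _ h.2), ind_of_mem (Finset.mem_union_left _ h.1),
      one_mul]

lemma intPairing_sub {ι : Type} [Fintype ι] (z z' v : ι → ℤ) :
    intPairing (z - z') v = intPairing z v - intPairing z' v := by
  simp [intPairing_apply, sub_mul, Finset.sum_sub_distrib]

/-- Dual linear forms for the facet of `𝒜`, adapted to the facets adjacent to the ridge opposite to
`A₀`, together with a linear form that is minimal at the points of two of the facets. -/
theorem IsTriple.exists_adapted_forms (hn : 3 ≤ n) (hS : IsComplete S)
    (hT : IsTriple r 𝒜 A₀ P A B C)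
    (hM : IsMaxHierarchy r 𝒜) {e : Finset (Fin n) → Fin n × Fin n} (he : IsSelection r 𝒜 e)
    (h₀ : Separates (e A₀) A B) (hP : Separates (e P) A C) :
    ∃ m : Finset (Fin n) → S → ℤ, IsDual (splitVecOn S) 𝒜 m ∧
      intPairing (m A₀) (splitVecOn S (A ∪ C)) = -1 ∧
      intPairing (m A₀) (splitVecOn S (B ∪ C)) = 0 ∧
      ∃ f : (S → ℝ) →ₗ[ℝ] ℝ, ∀ x ∈ coneOf (splitVecOn S) 𝒜 ∪
        coneOf (splitVecOn S) (insert (A ∪ C) (𝒜.erase A₀)),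
        ∀ y ∈ (hierarchyComplex hn r hS).support,
          (∀ D ∈ 𝒜, pairing (m D) x = pairing (m D) y) → f x ≤ f y ∧ (f x = f y → x = y) := by
  classical
  have h := hM.1
  -- The pair of the top cluster is the reference: only differences of Gromov products are visible,
  -- and `W i j` measures (i|j) relative to this pair.
  set b := e (topCluster r) with hb
  have hbm := he _ (top_mem_withTop (𝒜 := 𝒜))
  have hb1 : b.1 ≠ r := h.ne_root top_mem_withTop hbm.fst_mem
  have hb2 : b.2 ≠ r := h.ne_root top_mem_withTop hbm.snd_mem
  have hW : ∀ i j : Fin n, ∃ z : S → ℤ, i ≠ r → j ≠ r → i ≠ j → ∀ A, r ∉ A →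
      intPairing z (splitVecOn S A) = ind A i * ind A j - ind A b.1 * ind A b.2 := by
    intro i j
    by_cases hij : i ≠ r ∧ j ≠ r ∧ i ≠ j
    · obtain ⟨z, hz⟩ := hS.exists_gramForm r hij.1 hij.2.1 hb1 hb2 hij.2.2 hbm.ne
      exact ⟨z, fun _ _ _ => hz⟩
    · exact ⟨0, fun h1 h2 h3 => absurd ⟨h1, h2, h3⟩ hij⟩
  choose W hW using hW
  have hpar : ∀ D, ∃ Q, D ∈ 𝒜 → IsParent r 𝒜 D Q := by
    intro D
    by_cases hD : D ∈ 𝒜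
    · obtain ⟨Q, hQ⟩ := h.exists_isParent hD
      exact ⟨Q, fun _ => hQ⟩
    · exact ⟨∅, fun h => absurd h hD⟩
  choose par hpar using hpar
  have hparP : par A₀ = P := by
    have hp := hpar A₀ hT.mem
    exact subset_antisymm (hp.min P hT.parent.mem hT.parent.ssubset)
      (hT.parent.min _ hp.mem hp.ssubset)
  have hWe : ∀ D ∈ withTop r 𝒜, ∀ A, r ∉ A → intPairing (W (e D).1 (e D).2) (splitVecOn S A) =
      ind A (e D).1 * ind A (e D).2 - ind A b.1 * ind A b.2 := fun D hD =>
    hW _ _ (h.ne_root hD (he D hD).fst_mem) (h.ne_root hD (he D hD).snd_mem) (he D hD).ne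
  -- On the cone of `𝒜`, the Gromov product of the pair of `D` minus that of the pair of its parent
  -- is the length of the edge of `D`.
  set m : Finset (Fin n) → S → ℤ := fun D =>
    W (e D).1 (e D).2 - W (e (par D)).1 (e (par D)).2 with hm
  have hmD : ∀ D ∈ 𝒜, ∀ A, r ∉ A → intPairing (m D) (splitVecOn S A) =
      ind A (e D).1 * ind A (e D).2 - ind A (e (par D)).1 * ind A (e (par D)).2 := by
    intro D hD A hA
    rw [hm, intPairing_sub, hWe D (mem_withTop_of_mem hD) A hA,
      hWe _ (hpar D hD).mem A hA]
    ring
  have hPtop := h.subset_top hT.parent.mem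
  have hrAC : r ∉ A ∪ C := fun hr => mem_topCluster.1 (hPtop (hT.exchange_subset hr)) rfl
  have hrBC : r ∉ B ∪ C := fun hr => mem_topCluster.1 (hPtop (hT.symm.exchange_subset hr)) rfl
  have hdBAC : Disjoint B (A ∪ C) :=
    Finset.disjoint_union_right.2 ⟨hT.disjoint.symm, hT.symm.disjoint_left_out⟩
  have hdABC : Disjoint A (B ∪ C) :=
    Finset.disjoint_union_right.2 ⟨hT.disjoint, hT.disjoint_left_out⟩
  refine ⟨m, ?_, ?_, ?_, ?_⟩
  · intro D hD E hE
    rw [← intPairing_apply, hmD D hD E (h.root_notMem E hE),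
      (he D (mem_withTop_of_mem hD)).ind_mul_ind hE, (he _ (hpar D hD).mem).ind_mul_ind hE]
    by_cases hDE : D = E
    · subst hDE
      rw [if_pos subset_rfl, if_neg (hpar D hD).ssubset.2, if_pos rfl, sub_zero]
    · rw [if_neg hDE]
      by_cases hsub : D ⊆ E
      · rw [if_pos hsub, if_pos ((hpar D hD).min E (mem_withTop_of_mem hE)
          (Finset.ssubset_iff_subset_ne.2 ⟨hsub, hDE⟩)), sub_self]
      · rw [if_neg hsub, if_neg fun h' => hsub ((hpar D hD).ssubset.1.trans h'), sub_self]
  · rw [hmD A₀ hT.mem _ hrAC, hparP, hP.ind_mul_ind_union, h₀.symm.ind_mul_ind hdBAC]; norm_num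
  · rw [hmD A₀ hT.mem _ hrBC, hparP, hP.ind_mul_ind hdABC, h₀.ind_mul_ind hdABC]; norm_num
  -- the linear form
  set I : Finset (Fin n × Fin n) :=
    Finset.univ.filter fun p => p.1 ≠ r ∧ p.2 ≠ r ∧ p.1 ≠ p.2 with hI
  have hImem : ∀ p, p ∈ I ↔ p.1 ≠ r ∧ p.2 ≠ r ∧ p.1 ≠ p.2 := fun p => by simp [hI]
  refine ⟨∑ p ∈ I, pairing (W p.1 p.2), fun x hx y hy hxy => ?_⟩
  -- Both facets are treated alike: each has a selection that uses only the pairs selected for `𝒜`.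
  obtain ⟨𝒢, l, e', h𝒢, hl, rfl, he', hee⟩ : ∃ 𝒢 l e', IsMaxHierarchy r 𝒢 ∧ IsWeight 𝒢 l ∧
      comb (splitVecOn S) l = x ∧ IsSelection r 𝒢 e' ∧
      ∀ D ∈ withTop r 𝒢, ∃ D' ∈ withTop r 𝒜, e' D = e D' := by
    rcases hx with hx | hx
    · obtain ⟨l, hl, rfl⟩ := mem_coneOf_iff_isWeight.1 hx
      exact ⟨𝒜, l, e, hM, hl, rfl, he, fun D hD => ⟨D, hD, rfl⟩⟩
    · obtain ⟨l, hl, rfl⟩ := mem_coneOf_iff_isWeight.1 hx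
      obtain ⟨e', he', hee⟩ := hT.exists_isSelection_exchange h he h₀ hP
      exact ⟨_, l, e', hT.isMaxHierarchy_exchange hn hM, hl, rfl, he', hee⟩
  obtain ⟨ℬ, l', hℬ, hl', rfl⟩ := mem_support.1 hy
  have hWx : ∀ p ∈ I, pairing (W p.1 p.2) (comb (splitVecOn S) l) =
      gram l p.1 p.2 - gram l b.1 b.2 := fun p hp =>
    pairing_comb_eq_gram h𝒢.1 hl (hW _ _ ((hImem p).1 hp).1 ((hImem p).1 hp).2.1
      ((hImem p).1 hp).2.2)
  have hWy : ∀ p ∈ I, pairing (W p.1 p.2) (comb (splitVecOn S) l') =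
      gram l' p.1 p.2 - gram l' b.1 b.2 := fun p hp =>
    pairing_comb_eq_gram hℬ hl' (hW _ _ ((hImem p).1 hp).1 ((hImem p).1 hp).2.1
      ((hImem p).1 hp).2.2)
  have heI : ∀ D ∈ withTop r 𝒜, e D ∈ I := fun D hD => (hImem _).2
    ⟨h.ne_root hD (he D hD).fst_mem, h.ne_root hD (he D hD).snd_mem, (he D hD).ne⟩
  set κ := gram l' b.1 b.2 - gram l b.1 b.2 with hκ
  -- Equality of the forms `m D` passes the agreement of selected Gromov products from parents to
  -- children, starting at the top. The constant `κ` is the discrepancy at the reference pair.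
  have hsel : ∀ k, ∀ D ∈ withTop r 𝒜, n - D.card = k →
      gram l' (e D).1 (e D).2 = gram l (e D).1 (e D).2 + κ := by
    intro k
    induction k using Nat.strong_induction_on with
    | _ k ih =>
    intro D hD hk
    rcases Finset.mem_insert.1 hD with hDt | hD𝒜
    · rw [hDt, ← hb, hκ]; ring
    · have hp := hpar D hD𝒜
      have hc1 := Finset.card_lt_card hp.ssubset
      have hc2 : (par D).card ≤ n := by simpa using Finset.card_le_univ (par D)
      have h1 := ih _ (by omega) (par D) hp.mem rfl
      have h2 := hxy D hD𝒜
      have hpm : ∀ x, pairing (m D) x = pairing (W (e D).1 (e D).2) x -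
          pairing (W (e (par D)).1 (e (par D)).2) x := by
        intro x
        simp [hm, pairing_apply, sub_mul, Finset.sum_sub_distrib]
      rw [hpm, hpm, hWx _ (heI D hD), hWx _ (heI _ hp.mem), hWy _ (heI D hD),
        hWy _ (heI _ hp.mem)] at h2
      linarith
  have hle : ∀ p ∈ I, pairing (W p.1 p.2) (comb (splitVecOn S) l) ≤
      pairing (W p.1 p.2) (comb (splitVecOn S) l') := by
    intro p hp
    rw [hWx p hp, hWy p hp]
    obtain ⟨hp1, hp2, hp3⟩ := (hImem p).1 hp
    have := h𝒢.gram_le hn he' hl hℬ hl' (κ := κ) (fun D hD => by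
      obtain ⟨D', hD', hDe⟩ := hee D hD
      rw [hDe]
      exact hsel _ D' hD' rfl) hp1 hp2 hp3
    rw [hκ] at this
    linarith
  simp only [LinearMap.sum_apply]
  refine ⟨Finset.sum_le_sum hle, fun heq => ?_⟩
  -- Equality of the sums forces equality of every Gromov product up to `κ`, and these determine the
  -- weights.
  have hall := (Finset.sum_eq_sum_iff_of_le hle).1 heq
  have : l = l' := by
    refine hl.eq_of_gram hn h𝒢.1 hℬ hl' fun a b' c ha hb' hc hab hbc => ?_
    have h1 := hall (a, b') ((hImem _).2 ⟨ha, hb', hab⟩)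
    have h2 := hall (b', c) ((hImem _).2 ⟨hb', hc, hbc⟩)
    rw [hWx _ ((hImem _).2 ⟨ha, hb', hab⟩), hWy _ ((hImem _).2 ⟨ha, hb', hab⟩)] at h1
    rw [hWx _ ((hImem _).2 ⟨hb', hc, hbc⟩), hWy _ ((hImem _).2 ⟨hb', hc, hbc⟩)] at h2
    simp only at h1 h2
    linarith
  rw [this]

/-- A pair of points which are not distinguished by the forms `m D`. -/
lemma IsTriple.exists_ne (hn : 3 ≤ n) (hS : IsComplete S) (hT : IsTriple r 𝒜 A₀ P A B C)
    (hM : IsMaxHierarchy r 𝒜) {m : Finset (Fin n) → S → ℤ} (hd : IsDual (splitVecOn S) 𝒜 m)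
    (h₂ : intPairing (m A₀) (splitVecOn S (B ∪ C)) = 0) :
    ∃ x ∈ coneOf (splitVecOn S) 𝒜, ∃ y ∈ (hierarchyComplex hn r hS).support,
      (∀ D ∈ 𝒜, pairing (m D) x = pairing (m D) y) ∧ x ≠ y := by
  classical
  set c : Finset (Fin n) → ℝ := fun D => (intPairing (m D) (splitVecOn S (B ∪ C)) : ℝ) with hc
  -- The vector of `B ∪ C` minus its projection to the span of `𝒜` is killed by all `m D`. Adding
  -- `K` times the generators of the ridge makes the coefficients of both end points nonnegative.
  set K : ℝ := ∑ D, |c D| with hK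
  have hK0 : 0 ≤ K := Finset.sum_nonneg fun _ _ => abs_nonneg _
  have hKc : ∀ D, 0 ≤ K + c D := fun D => by
    have h1 := Finset.single_le_sum (f := fun D => |c D|) (fun _ _ => abs_nonneg _)
      (Finset.mem_univ D)
    have h2 := neg_abs_le (c D)
    linarith
  set l : Finset (Fin n) → ℝ := fun D => if D ∈ 𝒜.erase A₀ then K + c D else 0 with hl
  set l₀ : Finset (Fin n) → ℝ := fun D => if D ∈ 𝒜.erase A₀ then K else 0 with hl₀
  have hBC : B ∪ C ∉ 𝒜 := hT.symm.exchange_notMem hM.1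
  have hlw : IsWeight 𝒜 l := by
    refine ⟨fun D => ?_, fun D hD => if_neg fun h => hD (Finset.mem_of_mem_erase h)⟩
    simp only [hl]
    split_ifs
    · exact hKc D
    · exact le_rfl
  have hl0s : ∀ D, D ∉ 𝒜 → l₀ D = 0 := fun D hD =>
    if_neg fun h => hD (Finset.mem_of_mem_erase h)
  have hmw : IsWeight (insert (B ∪ C) (𝒜.erase A₀)) (l₀ + Pi.single (B ∪ C) 1) := by
    refine ⟨fun D => ?_, fun D hD => ?_⟩
    · refine add_nonneg ?_ ?_
      · simp only [hl₀]; split_ifs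
        · exact hK0
        · exact le_rfl
      · rw [Pi.single_apply]; split_ifs <;> norm_num
    · rw [Finset.mem_insert, not_or] at hD
      rw [Pi.add_apply, Pi.single_eq_of_ne hD.1, add_zero]
      exact if_neg hD.2
  refine ⟨_, mem_coneOf_iff_isWeight.2 ⟨l, hlw, rfl⟩, _, mem_support.2
    ⟨_, _, hT.symm.isHierarchy_exchange hM.1, hmw, rfl⟩, fun D hD => ?_, fun heq => ?_⟩
  · rw [hd.pairing_comb hlw.support hD, map_add, map_add, hd.pairing_comb hl0s hD, comb_single,
      one_smul, pairing_rvec']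
    by_cases hDA : D = A₀
    · subst hDA
      simp [hl, hl₀, h₂]
    · have : D ∈ 𝒜.erase A₀ := Finset.mem_erase.2 ⟨hDA, hD⟩
      simp only [hl, hl₀, if_pos this, hc]
  · have h1 := hS.eq_of_comb_eq hn hM.1 (hT.symm.isHierarchy_exchange hM.1) hlw hmw heq
    have h2 := congrFun h1 (B ∪ C)
    rw [hlw.support _ hBC, Pi.add_apply, hl0s _ hBC, Pi.single_eq_same] at h2
    norm_num at h2

theorem isSimplyBalanced_hierarchyComplex : (hierarchyComplex hn r hS).IsSimplyBalanced := by
  refine ⟨isBalanced_hierarchyComplex, fun E hE F hF => ?_⟩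
  obtain ⟨𝒜, A₀, hM, hA₀, rfl, rfl⟩ := exists_of_isRidge hE hF
  obtain ⟨e, he⟩ := hM.1.exists_isSelection hn
  obtain ⟨P, hP⟩ := hM.1.exists_isParent hA₀
  obtain ⟨A, B, C, hT, h₀, hPs⟩ := hM.exists_isTriple hn hA₀ hP he
  obtain ⟨m, hd, h₁, h₂, f, hf⟩ := hT.exists_adapted_forms hn hS hM he h₀ hPs
  have hins := Finset.insert_erase hA₀
  have hcard : (𝒜.erase A₀).card + 1 = n - 3 := by
    rw [Finset.card_erase_add_one hA₀, hM.card_eq hn]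
  obtain ⟨L, hL, hfreq, hone, hdir, hev⟩ := exists_testSpace (hierarchyComplex hn r hS)
    (v := splitVecOn S) (t := 𝒜.erase A₀) (m := m) (Finset.notMem_erase A₀ 𝒜) (hins.symm ▸ hd) hcard
    ((hT.mem_adjacent_iff hM).2 (Or.inl rfl))
    (fun G hG => (hT.mem_adjacent_iff hM).1 hG) h₁ h₂
    (fun L hL => isBalanced_hierarchyComplex _ hE L hL)
  rw [hins] at hfreq hdir hev
  refine ⟨L, hL, hfreq, hone, ?_⟩
  -- The third facet is not transversal to `L`: it provides two points whose difference is a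
  -- direction of `L`, and `f` takes different values on them. This shows that `f` is not constant
  -- on `L`.
  obtain ⟨x₀, hx₀, y₀, hy₀, hxy, hne⟩ := hT.exists_ne hn hS hM hd h₂
  have hsupp : ∀ x ∈ coneOf (splitVecOn S) 𝒜 ∪
      coneOf (splitVecOn S) (insert (A ∪ C) (𝒜.erase A₀)),
      x ∈ (hierarchyComplex hn r hS).support := by
    rintro x (hx | hx)
    · exact ⟨_, ⟨𝒜, hM, rfl⟩, hx⟩
    · exact ⟨_, ⟨_, hT.isMaxHierarchy_exchange hn hM, rfl⟩, hx⟩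
  filter_upwards [hev] with w hw
  obtain ⟨x, hx, hxw⟩ := hw
  have hcoord : ∀ y ∈ translate L w, ∀ D ∈ 𝒜, pairing (m D) x = pairing (m D) y := by
    intro y hy D hD
    have h1 : (x - w) - (y - w) ∈ L.direction := AffineSubspace.vsub_mem_direction hxw hy
    rw [hdir] at h1
    have h2 := mem_coordKer.1 h1 D hD
    rw [sub_sub_sub_cancel_right, map_sub] at h2
    linarith
  refine ⟨f, f x, ⟨x₀ - y₀, ?_, fun h0 => ?_⟩, fun y hy => ?_, x, ⟨⟨hsupp x hx, hxw⟩, rfl⟩,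
    fun y hy => ?_⟩
  · rw [hdir, mem_coordKer]
    intro D hD
    rw [map_sub, hxy D hD, sub_self]
  · rw [map_sub, sub_eq_zero] at h0
    exact hne ((hf x₀ (Or.inl hx₀) y₀ hy₀ hxy).2 h0)
  · exact (hf x hx y hy.1 (hcoord y hy.2)).1
  · exact ((hf x hx y hy.1.1 (hcoord y hy.1.2)).2 hy.2.symm).symm

end SimplyBalanced

/-! ### Rooted trees -/

section Rooted

variable {V : Type*} {G : SimpleGraph V} {ρ : V} {par : V → V} {dep : V → ℕ}

/-- The edges of the graph join the vertices different from the root `ρ` to their parents. -/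
structure IsRooted (G : SimpleGraph V) (ρ : V) (par : V → V) (dep : V → ℕ) : Prop where
  adj_iff : ∀ v w, G.Adj v w ↔ (v ≠ ρ ∧ par v = w) ∨ (w ≠ ρ ∧ par w = v)
  dep_par : ∀ v, v ≠ ρ → dep (par v) < dep v

/-- `Below ρ par u v` means that `v` is an ancestor of `u`, or equal to `u`. -/
def Below (ρ : V) (par : V → V) : V → V → Prop :=
  Relation.ReflTransGen fun u v => u ≠ ρ ∧ par u = v

lemma Below.refl (v : V) : Below ρ par v v := Relation.ReflTransGen.refl

lemma Below.trans {u v w : V} (h : Below ρ par u v) (h' : Below ρ par v w) : Below ρ par u w :=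
  Relation.ReflTransGen.trans h h'

lemma below_par {v : V} (hv : v ≠ ρ) : Below ρ par v (par v) :=
  Relation.ReflTransGen.single ⟨hv, rfl⟩

lemma below_iff {u v : V} : Below ρ par u v ↔ u = v ∨ (u ≠ ρ ∧ Below ρ par (par u) v) := by
  constructor
  · intro h
    rcases Relation.ReflTransGen.cases_head h with h | ⟨w, ⟨hu, rfl⟩, h⟩
    · exact Or.inl h
    · exact Or.inr ⟨hu, h⟩
  · rintro (rfl | ⟨hu, h⟩)
    · exact Below.refl _
    · exact (below_par hu).trans h

lemma Below.total {u v w : V} (h : Below ρ par u v) (h' : Below ρ par u w) :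
    Below ρ par v w ∨ Below ρ par w v :=
  Relation.ReflTransGen.total_of_right_unique
    (fun _ _ _ hb hc => hb.2.symm.trans hc.2) h h'

lemma eq_root_of_below {v : V} (h : Below ρ par ρ v) : v = ρ := by
  rcases below_iff.1 h with h | ⟨h, -⟩
  · exact h.symm
  · exact absurd rfl h

namespace IsRooted

variable (hG : IsRooted G ρ par dep)
include hG

lemma below_root (v : V) : Below ρ par v ρ := by
  induction hk : dep v using Nat.strong_induction_on generalizing v with
  | _ k ih =>
  by_cases hv : v = ρ
  · rw [hv]; exact Below.refl _
  · exact (below_par hv).trans (ih _ (hk ▸ hG.dep_par v hv) _ rfl)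

lemma eq_or_dep_lt {u v : V} (h : Below ρ par u v) : u = v ∨ dep v < dep u := by
  induction h with
  | refl => exact Or.inl rfl
  | @tail b c _ hb ih =>
    obtain ⟨hb, rfl⟩ := hb
    have := hG.dep_par b hb
    rcases ih with rfl | ih
    · exact Or.inr this
    · exact Or.inr (this.trans ih)

lemma below_antisymm {u v : V} (h : Below ρ par u v) (h' : Below ρ par v u) : u = v := by
  rcases hG.eq_or_dep_lt h with h1 | h1
  · exact h1
  · rcases hG.eq_or_dep_lt h' with h2 | h2
    · exact h2.symm
    · omega

lemma not_below_of_par {v : V} (hv : v ≠ ρ) : ¬ Below ρ par (par v) v := fun h => by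
  rcases hG.eq_or_dep_lt h with h1 | h1 <;> have := hG.dep_par v hv
  · rw [h1] at this; exact lt_irrefl _ this
  · omega

lemma adj_par {v : V} (hv : v ≠ ρ) : G.Adj v (par v) := (hG.adj_iff _ _).2 (Or.inl ⟨hv, rfl⟩)

lemma sym2_inj {u v : V} (hu : u ≠ ρ) (hv : v ≠ ρ) (h : s(u, par u) = s(v, par v)) : u = v := by
  rcases Sym2.eq_iff.1 h with h | ⟨h1, h2⟩
  · exact h.1
  · have h3 := hG.dep_par u hu
    have h4 := hG.dep_par v hv
    rw [← h1] at h4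
    rw [h2] at h3
    omega

/-- The only edge leaving the set of vertices below `v` is the one from `v` to its parent. -/
lemma below_iff_of_adj {u w v : V} (h : (G.deleteEdges {s(v, par v)}).Adj u w) :
    Below ρ par u v ↔ Below ρ par w v := by
  have key : ∀ u w, (G.deleteEdges {s(v, par v)}).Adj u w → u ≠ ρ → par u = w →
      (Below ρ par u v ↔ Below ρ par w v) := by
    rintro u _ h hu rfl
    rw [below_iff]
    constructor
    · rintro (rfl | ⟨-, h'⟩)
      · rw [SimpleGraph.deleteEdges_adj] at h
        exact absurd rfl h.2
      · exact h'
    · exact fun h' => Or.inr ⟨hu, h'⟩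
  rcases (hG.adj_iff u w).1 (SimpleGraph.deleteEdges_adj.1 h).1 with ⟨h1, h2⟩ | ⟨h1, h2⟩
  · exact key u w h h1 h2
  · exact (key w u h.symm h1 h2).symm

lemma below_iff_of_reachable {u w v : V} (h : (G.deleteEdges {s(v, par v)}).Reachable u w) :
    Below ρ par u v ↔ Below ρ par w v := by
  obtain ⟨p⟩ := h
  induction p with
  | nil => rfl
  | cons h p ih => exact (hG.below_iff_of_adj h).trans ih

/-- The vertices that are separated from the root by an edge are those below the edge. -/
lemma reachable_root_iff {u v : V} (hv : v ≠ ρ) :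
    (G.deleteEdges {s(v, par v)}).Reachable u ρ ↔ ¬ Below ρ par u v := by
  constructor
  · intro h h'
    exact hv (eq_root_of_below ((hG.below_iff_of_reachable h).1 h'))
  · intro h
    induction hk : dep u using Nat.strong_induction_on generalizing u with
    | _ k ih =>
    by_cases hu : u = ρ
    · rw [hu]
    · have h1 : ¬ Below ρ par (par u) v := fun h' => h ((below_par hu).trans h')
      refine SimpleGraph.Reachable.trans (SimpleGraph.Adj.reachable ?_)
        (ih _ (hk ▸ hG.dep_par u hu) h1 rfl)
      rw [SimpleGraph.deleteEdges_adj]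
      refine ⟨hG.adj_par hu, fun he => h ?_⟩
      rw [hG.sym2_inj hu hv he]
      exact Below.refl _

/-- Iterating `par` connects every vertex to the root since the depth drops. Every edge is a bridge,
because deleting it separates the vertices below it from the rest. -/
lemma isTree : G.IsTree := by
  have hreach : ∀ v, G.Reachable v ρ := by
    intro v
    induction hk : dep v using Nat.strong_induction_on generalizing v with
    | _ k ih =>
    by_cases hv : v = ρ
    · rw [hv]
    · exact (hG.adj_par hv).reachable.trans (ih _ (hk ▸ hG.dep_par v hv) _ rfl)
  have : Nonempty V := ⟨ρ⟩
  refine ⟨⟨fun u v => (hreach u).trans (hreach v).symm⟩, ?_⟩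
  rw [SimpleGraph.isAcyclic_iff_forall_adj_isBridge]
  have key : ∀ v, v ≠ ρ → ¬ (G.deleteEdges {s(v, par v)}).Reachable v (par v) := fun v hv h =>
    hG.not_below_of_par hv ((hG.below_iff_of_reachable h).1 (Below.refl v))
  intro v w hvw
  rw [SimpleGraph.isBridge_iff]
  rcases (hG.adj_iff v w).1 hvw with ⟨h1, rfl⟩ | ⟨h1, rfl⟩
  · exact key v h1
  · rw [Sym2.eq_swap]
    exact fun h => key w h1 h.symm

lemma exists_of_mem_edgeSet {e : Sym2 V} (he : e ∈ G.edgeSet) : ∃ v, v ≠ ρ ∧ e = s(v, par v) := by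
  induction e using Sym2.ind with | _ v w
  rcases (hG.adj_iff v w).1 he with ⟨h1, rfl⟩ | ⟨h1, rfl⟩
  · exact ⟨v, h1, rfl⟩
  · exact ⟨w, h1, Sym2.eq_swap⟩

end IsRooted

/-- Every tree can be rooted at any vertex. -/
lemma exists_isRooted (hG : G.IsTree) (ρ : V) : ∃ par dep, IsRooted G ρ par dep := by
  choose P hP hPu using fun v => hG.existsUnique_path v ρ
  have hcons : ∀ v, v ≠ ρ → ∃ h : G.Adj v (P v).snd, P v = SimpleGraph.Walk.cons h (P (P v).snd) := by
    intro v hv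
    have hnil : ¬ (P v).Nil := SimpleGraph.Walk.not_nil_of_ne hv
    refine ⟨(P v).adj_snd hnil, ?_⟩
    conv_lhs => rw [← SimpleGraph.Walk.cons_tail_eq (P v) hnil]
    congr 1
    exact hPu _ _ (hP v).tail
  -- The parent is the second vertex on the path to the root, and the depth is the length of this
  -- path. For an edge between `v` and `w`, the path from one of them starts with that edge,
  -- according to whether `v` lies on the path from `w`.
  refine ⟨fun v => (P v).snd, fun v => (P v).length, ⟨fun v w => ⟨fun h => ?_, ?_⟩, fun v hv => ?_⟩⟩
  · by_cases hvs : v ∈ (P w).support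
    · refine Or.inr ?_
      have hw : w ≠ ρ := by
        rintro rfl
        have h1 : SimpleGraph.Walk.nil = P w := hPu w _ SimpleGraph.Walk.IsPath.nil
        rw [← h1, SimpleGraph.Walk.support_nil, List.mem_singleton] at hvs
        exact h.ne hvs
      classical
      refine ⟨hw, ?_⟩
      have h2 : (P w).takeUntil v hvs = SimpleGraph.Walk.cons h.symm SimpleGraph.Walk.nil :=
        (hG.existsUnique_path w v).unique ((hP w).takeUntil hvs)
          (SimpleGraph.Walk.IsPath.nil.cons (by simpa using h.ne'))
      have h3 := SimpleGraph.Walk.take_spec (P w) hvs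
      rw [← h3, h2]
      simp
    · refine Or.inl ⟨?_, ?_⟩
      · rintro rfl
        exact hvs (SimpleGraph.Walk.end_mem_support _)
      · have h1 : SimpleGraph.Walk.cons h (P w) = P v := hPu v _ ((hP w).cons hvs)
        rw [← h1]; simp
  · rintro (⟨hv, rfl⟩ | ⟨hw, rfl⟩)
    · exact (hcons v hv).1
    · exact (hcons w hw).1.symm
  · obtain ⟨h, hc⟩ := hcons v hv
    have := congrArg SimpleGraph.Walk.length hc
    rw [SimpleGraph.Walk.length_cons] at this
    omega

end Rooted

/-! ### Paths and sides of edges -/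

section Sides

variable {V : Type*} {G : SimpleGraph V}

lemma not_reachable_dart (hG : G.IsTree) (d : G.Dart) :
    ¬ (G.deleteEdges {d.edge}).Reachable d.fst d.snd :=
  SimpleGraph.isBridge_iff.1
    (SimpleGraph.isAcyclic_iff_forall_adj_isBridge.1 hG.isAcyclic d.adj)

lemma reachable_or (hG : G.IsTree) (d : G.Dart) (v : V) :
    (G.deleteEdges {d.edge}).Reachable v d.fst ∨ (G.deleteEdges {d.edge}).Reachable v d.snd := by
  obtain ⟨p⟩ := hG.connected.preconnected v d.fst
  revert p
  generalize hx : d.fst = x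
  intro p
  induction p with
  | nil => exact Or.inl (SimpleGraph.Reachable.refl _)
  | @cons a b c h p ih =>
    subst hx
    by_cases he : s(a, b) = d.edge
    · rcases Sym2.eq_iff.1 he with ⟨h1, -⟩ | ⟨h1, -⟩
      · rw [h1]; exact Or.inl (SimpleGraph.Reachable.refl _)
      · rw [h1]; exact Or.inr (SimpleGraph.Reachable.refl _)
    · have : (G.deleteEdges {d.edge}).Adj a b := by
        rw [SimpleGraph.deleteEdges_adj]
        exact ⟨h, he⟩
      exact (ih rfl).imp this.reachable.trans this.reachable.trans

lemma reachable_snd_iff (hG : G.IsTree) (d : G.Dart) (v : V) :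
    (G.deleteEdges {d.edge}).Reachable v d.snd ↔
      ¬ (G.deleteEdges {d.edge}).Reachable v d.fst :=
  ⟨fun h h' => not_reachable_dart hG d (h'.symm.trans h), (reachable_or hG d v).resolve_left⟩

/-- A path traverses an oriented edge iff the edge separates its end points. -/
lemma mem_darts_iff (hG : G.IsTree) (d : G.Dart) {a b : V} (p : G.Walk a b) (hp : p.IsPath) :
    d ∈ p.darts ↔ (G.deleteEdges {d.edge}).Reachable a d.fst ∧
      ¬ (G.deleteEdges {d.edge}).Reachable b d.fst := by
  induction p with
  | nil => simp
  | @cons a a' b h p ih =>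
    rw [SimpleGraph.Walk.cons_isPath_iff] at hp
    have ha : ∀ d' ∈ p.darts, d'.fst ≠ a ∧ d'.snd ≠ a := fun d' hd' =>
      ⟨fun e => hp.2 (e ▸ p.dart_fst_mem_support_of_mem_darts hd'),
        fun e => hp.2 (e ▸ p.dart_snd_mem_support_of_mem_darts hd')⟩
    -- If the path starts with the deleted edge, it cannot use it again, so the rest of the path
    -- survives the deletion.
    have hedge : s(a, a') = d.edge → (G.deleteEdges {d.edge}).Reachable a' b := by
      intro he
      refine ⟨p.transfer _ fun e hep => ?_⟩
      rw [SimpleGraph.edgeSet_deleteEdges]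
      refine ⟨p.edges_subset_edgeSet hep, fun h' => hp.2 ?_⟩
      rw [Set.mem_singleton_iff] at h'
      rw [h', ← he] at hep
      exact p.fst_mem_support_of_mem_edges hep
    rw [SimpleGraph.Walk.darts_cons, List.mem_cons]
    by_cases he : s(a, a') = d.edge
    · have hr := hedge he
      have hnd : d ∉ p.darts := fun hd => by
        rcases Sym2.eq_iff.1 he with ⟨h1, -⟩ | ⟨h1, -⟩
        · exact (ha d hd).1 h1.symm
        · exact (ha d hd).2 h1.symm
      rcases Sym2.eq_iff.1 he with ⟨h1, h2⟩ | ⟨h1, h2⟩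
      · have hdd : d = ⟨(a, a'), h⟩ := by
          rw [SimpleGraph.Dart.ext_iff]; exact Prod.ext h1.symm h2.symm
        refine iff_of_true (Or.inl hdd) ⟨?_, ?_⟩
        · rw [h1]
        · rw [← reachable_snd_iff hG]
          exact h2 ▸ hr.symm
      · refine iff_of_false ?_ ?_
        · rintro (rfl | h')
          · exact h.ne h1
          · exact hnd h'
        · rintro ⟨h', -⟩
          rw [h1] at h'
          exact not_reachable_dart hG d h'.symm
    · have hadj : (G.deleteEdges {d.edge}).Adj a a' := by
        rw [SimpleGraph.deleteEdges_adj]; exact ⟨h, he⟩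
      have hne : d ≠ ⟨(a, a'), h⟩ := by rintro rfl; exact he rfl
      rw [or_iff_right hne, ih hp.1]
      refine and_congr_left fun _ => ⟨hadj.reachable.trans, hadj.reachable.symm.trans⟩

end Sides

/-! ### The hierarchy of a stable tree -/

namespace StableTree

variable {n : ℕ} {Γ : StableTree n} {r : Fin n}

instance (Γ : StableTree n) : Finite Γ.V := Γ.finite

instance (Γ : StableTree n) : Finite Γ.Edge := inferInstanceAs (Finite Γ.graph.edgeSet)

instance (Γ : StableTree n) : Fintype Γ.Edge := Fintype.ofFinite _

open Classical in
/-- The markings which are separated from the marking `r` by the edge `e`. -/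
def cluster (Γ : StableTree n) (r : Fin n) (e : Sym2 Γ.V) : Finset (Fin n) :=
  Finset.univ.filter fun i => ¬ (Γ.graph.deleteEdges {e}).Reachable (Γ.mark i) (Γ.mark r)

lemma mem_cluster {e : Sym2 Γ.V} {i : Fin n} :
    i ∈ Γ.cluster r e ↔ ¬ (Γ.graph.deleteEdges {e}).Reachable (Γ.mark i) (Γ.mark r) := by
  simp [cluster]

open Classical in
/-- The clusters of all edges. -/
def clusters (Γ : StableTree n) (r : Fin n) : Finset (Finset (Fin n)) :=
  Finset.univ.image fun e : Γ.Edge => Γ.cluster r e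

open Classical in
/-- The markings below the vertex `v`. -/
def below (Γ : StableTree n) (r : Fin n) (par : Γ.V → Γ.V) (v : Γ.V) : Finset (Fin n) :=
  Finset.univ.filter fun i => i ≠ r ∧ Below (Γ.mark r) par (Γ.mark i) v

variable {par : Γ.V → Γ.V} {dep : Γ.V → ℕ}

lemma mem_below {v : Γ.V} {i : Fin n} :
    i ∈ Γ.below r par v ↔ i ≠ r ∧ Below (Γ.mark r) par (Γ.mark i) v := by
  simp [below]

lemma below_subset {v w : Γ.V} (h : Below (Γ.mark r) par v w) :
    Γ.below r par v ⊆ Γ.below r par w := fun i hi => by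
  rw [mem_below] at hi ⊢
  exact ⟨hi.1, hi.2.trans h⟩

section

variable (hΓ : IsRooted Γ.graph (Γ.mark r) par dep)
include hΓ

lemma below_root : Γ.below r par (Γ.mark r) = topCluster r := by
  ext i
  rw [mem_below, mem_topCluster, and_iff_left (hΓ.below_root _)]

lemma cluster_eq_below {v : Γ.V} (hv : v ≠ Γ.mark r) :
    Γ.cluster r s(v, par v) = Γ.below r par v := by
  ext i
  rw [mem_cluster, mem_below, hΓ.reachable_root_iff hv, not_not]
  refine ⟨fun h => ⟨?_, h⟩, And.right⟩
  rintro rfl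
  exact hv (eq_root_of_below h)

/-- Of the at least three edges and leaves at `v`, at most one leads towards the root: the edge to
the parent, or the leaf `r` itself. -/
lemma two_le_branches (v : Γ.V) :
    2 ≤ {w | w ≠ Γ.mark r ∧ par w = v}.ncard + {i | i ≠ r ∧ Γ.mark i = v}.ncard := by
  have hs := Γ.stable v
  by_cases hv : v = Γ.mark r
  · have h1 : (Γ.graph.neighborSet v).ncard ≤ {w | w ≠ Γ.mark r ∧ par w = v}.ncard := by
      refine Set.ncard_le_ncard (fun w hw => ?_) (Set.toFinite _)
      rcases (hΓ.adj_iff v w).1 hw with h | h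
      · exact absurd hv h.1
      · exact h
    have h2 : {i | Γ.mark i = v}.ncard ≤ (insert r {i | i ≠ r ∧ Γ.mark i = v}).ncard := by
      refine Set.ncard_le_ncard (fun i hi => ?_) (Set.toFinite _)
      by_cases hir : i = r
      · exact Or.inl hir
      · exact Or.inr ⟨hir, hi⟩
    have h3 := Set.ncard_insert_le r {i | i ≠ r ∧ Γ.mark i = v}
    omega
  · have h1 : (Γ.graph.neighborSet v).ncard ≤
        (insert (par v) {w | w ≠ Γ.mark r ∧ par w = v}).ncard := by
      refine Set.ncard_le_ncard (fun w hw => ?_) (Set.toFinite _)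
      rcases (hΓ.adj_iff v w).1 hw with h | h
      · exact Or.inl h.2.symm
      · exact Or.inr h
    have h2 : {i | Γ.mark i = v}.ncard ≤ {i | i ≠ r ∧ Γ.mark i = v}.ncard := by
      refine Set.ncard_le_ncard (fun i hi => ⟨?_, hi⟩) (Set.toFinite _)
      rintro rfl
      exact hv hi.symm
    have h3 := Set.ncard_insert_le (par v) {w | w ≠ Γ.mark r ∧ par w = v}
    omega

lemma below_nonempty (v : Γ.V) : (Γ.below r par v).Nonempty := by
  induction hk : {u | Below (Γ.mark r) par u v}.ncard using Nat.strong_induction_on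
    generalizing v with
  | _ k ih =>
  have h2 := two_le_branches hΓ v
  by_cases hc : {w | w ≠ Γ.mark r ∧ par w = v}.Nonempty
  · obtain ⟨w, hw, rfl⟩ := hc
    refine (ih _ ?_ w rfl).mono (below_subset (below_par hw))
    rw [← hk]
    refine Set.ncard_lt_ncard ⟨fun u hu => Below.trans hu (below_par hw), fun h => ?_⟩
      (Set.toFinite _)
    exact hΓ.not_below_of_par hw (h (Below.refl _))
  · rw [Set.not_nonempty_iff_eq_empty.1 hc, Set.ncard_empty, zero_add] at h2
    have : {i | i ≠ r ∧ Γ.mark i = v}.Nonempty := by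
      rw [← Set.ncard_pos]; omega
    obtain ⟨i, hi, rfl⟩ := this
    exact ⟨i, mem_below.2 ⟨hi, Below.refl _⟩⟩

/-- Every vertex is the meeting point of two markings. -/
lemma exists_meet (v : Γ.V) : ∃ i j, i ≠ j ∧ i ∈ Γ.below r par v ∧ j ∈ Γ.below r par v ∧
    ∀ w, i ∈ Γ.below r par w → j ∈ Γ.below r par w → Below (Γ.mark r) par v w := by
  choose f hf using below_nonempty hΓ
  -- One marking is chosen in each branch at `v`, a branch being a child or a leaf. Distinct
  -- branches have no marking in common, so two chosen markings meet exactly at `v`.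
  let g : {w | w ≠ Γ.mark r ∧ par w = v} ⊕ {i | i ≠ r ∧ Γ.mark i = v} → Fin n :=
    Sum.elim (fun w => f w.1) (fun i => i.1)
  have hg : ∀ x, g x ∈ Γ.below r par v := by
    rintro (⟨w, hw, rfl⟩ | ⟨i, hi, rfl⟩)
    · exact below_subset (below_par hw) (hf w)
    · exact mem_below.2 ⟨hi, Below.refl _⟩
  have key : ∀ (c : {w | w ≠ Γ.mark r ∧ par w = v}) x, g x ∈ Γ.below r par c.1 → x = Sum.inl c := by
    rintro ⟨c, hc, rfl⟩ (⟨w, hw, hw'⟩ | ⟨i, hi, hi'⟩) hx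
    · have h1 : Below (Γ.mark r) par (Γ.mark (f w)) w := (mem_below.1 (hf w)).2
      have hwc : ∀ w c, w ≠ Γ.mark r → c ≠ Γ.mark r → par w = par c →
          Below (Γ.mark r) par w c → w = c := by
        intro w c hw hc hw' h
        rcases below_iff.1 h with h | ⟨-, h⟩
        · exact h
        · exact absurd (hw' ▸ h) (hΓ.not_below_of_par hc)
      have hwc' : w = c := by
        rcases h1.total (mem_below.1 hx).2 with h | h
        · exact hwc w c hw hc hw' h
        · exact (hwc c w hc hw hw'.symm h).symm
      subst hwc'
      rfl
    · exact absurd (hi' ▸ (mem_below.1 hx).2) (hΓ.not_below_of_par hc)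
  have hinj : Function.Injective g := by
    rintro (c | i) y hxy
    · exact (key c y (hxy ▸ hf c.1)).symm
    · rcases y with c | j
      · exact key c _ (hxy ▸ hf c.1)
      · exact congrArg _ (Subtype.ext hxy)
  have h2 := two_le_branches hΓ v
  rw [← Nat.card_coe_set_eq, ← Nat.card_coe_set_eq, ← Nat.card_sum] at h2
  have := Finite.one_lt_card_iff_nontrivial.1 h2
  obtain ⟨x, y, hxy⟩ := exists_pair_ne ({w | w ≠ Γ.mark r ∧ par w = v} ⊕ {i | i ≠ r ∧ Γ.mark i = v})
  refine ⟨g x, g y, hinj.ne hxy, hg x, hg y, fun w hx hy => ?_⟩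
  rcases (mem_below.1 hx).2.total (mem_below.1 (hg x)).2 with h | h
  · rcases Relation.ReflTransGen.cases_tail h with rfl | ⟨c, h', hc⟩
    · exact Below.refl _
    · have h3 := below_subset h'
      exact absurd ((key ⟨c, hc⟩ x (h3 hx)).trans (key ⟨c, hc⟩ y (h3 hy)).symm) hxy
  · exact h

lemma below_subset_iff {v w : Γ.V} :
    Γ.below r par v ⊆ Γ.below r par w ↔ Below (Γ.mark r) par v w := by
  refine ⟨fun h => ?_, below_subset⟩
  obtain ⟨i, j, -, hi, hj, hm⟩ := exists_meet hΓ v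
  exact hm w (h hi) (h hj)

lemma below_injective : Function.Injective (Γ.below r par) := fun _ _ h =>
  hΓ.below_antisymm ((below_subset_iff hΓ).1 h.le) ((below_subset_iff hΓ).1 h.ge)

lemma mem_clusters {A : Finset (Fin n)} :
    A ∈ Γ.clusters r ↔ ∃ v, v ≠ Γ.mark r ∧ Γ.below r par v = A := by
  simp only [clusters, Finset.mem_image, Finset.mem_univ, true_and]
  constructor
  · rintro ⟨⟨e, he⟩, rfl⟩
    obtain ⟨v, hv, rfl⟩ := hΓ.exists_of_mem_edgeSet he
    exact ⟨v, hv, (cluster_eq_below hΓ hv).symm⟩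
  · rintro ⟨v, hv, rfl⟩
    exact ⟨⟨_, hΓ.adj_par hv⟩, cluster_eq_below hΓ hv⟩

lemma mem_withTop_clusters {A : Finset (Fin n)} :
    A ∈ withTop r (Γ.clusters r) ↔ ∃ v, Γ.below r par v = A := by
  rw [withTop, Finset.mem_insert, mem_clusters hΓ]
  constructor
  · rintro (rfl | ⟨v, -, hv⟩)
    · exact ⟨_, below_root hΓ⟩
    · exact ⟨v, hv⟩
  · rintro ⟨v, rfl⟩
    by_cases hv : v = Γ.mark r
    · exact Or.inl (hv ▸ below_root hΓ)
    · exact Or.inr ⟨v, hv, rfl⟩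

end

lemma isHierarchy_clusters (Γ : StableTree n) (r : Fin n) : IsHierarchy r (Γ.clusters r) := by
  obtain ⟨par, dep, hΓ⟩ := exists_isRooted Γ.isTree (Γ.mark r)
  refine ⟨?_, ?_, ?_, ?_⟩
  · rintro _ hA hr
    obtain ⟨v, hv, rfl⟩ := (mem_clusters hΓ).1 hA
    exact (mem_below.1 hr).1 rfl
  · rintro _ hA
    obtain ⟨v, hv, rfl⟩ := (mem_clusters hΓ).1 hA
    obtain ⟨i, j, hij, hi, hj, -⟩ := exists_meet hΓ v
    exact Finset.one_lt_card.2 ⟨i, hi, j, hj, hij⟩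
  · rintro _ hA
    obtain ⟨v, hv, rfl⟩ := (mem_clusters hΓ).1 hA
    by_contra hcon
    push Not at hcon
    refine hv (eq_root_of_below ((below_subset_iff hΓ).1 fun i hi => ?_))
    exact hcon i (mem_below.1 hi).1
  · rintro _ hA _ hB
    obtain ⟨v, hv, rfl⟩ := (mem_clusters hΓ).1 hA
    obtain ⟨w, hw, rfl⟩ := (mem_clusters hΓ).1 hB
    by_cases hd : Disjoint (Γ.below r par v) (Γ.below r par w)
    · exact Or.inr (Or.inr hd)
    · obtain ⟨i, hi, hj⟩ := Finset.not_disjoint_iff.1 hd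
      rcases (mem_below.1 hi).2.total (mem_below.1 hj).2 with h | h
      · exact Or.inl (below_subset h)
      · exact Or.inr (Or.inl (below_subset h))

lemma cluster_injective (Γ : StableTree n) (r : Fin n) :
    Function.Injective fun e : Γ.Edge => Γ.cluster r e := by
  obtain ⟨par, dep, hΓ⟩ := exists_isRooted Γ.isTree (Γ.mark r)
  rintro ⟨e, he⟩ ⟨e', he'⟩ h
  obtain ⟨v, hv, rfl⟩ := hΓ.exists_of_mem_edgeSet he
  obtain ⟨w, hw, rfl⟩ := hΓ.exists_of_mem_edgeSet he'
  have h' : Γ.below r par v = Γ.below r par w := by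
    rw [← cluster_eq_below hΓ hv, ← cluster_eq_below hΓ hw]; exact h
  obtain rfl := below_injective hΓ h'
  rfl

lemma card_clusters (Γ : StableTree n) (r : Fin n) :
    (Γ.clusters r).card = Fintype.card Γ.Edge := by
  classical
  rw [clusters, Finset.card_image_of_injective _ (Γ.cluster_injective r), Finset.card_univ]

lemma cluster_mem_clusters (e : Γ.Edge) : Γ.cluster r e ∈ Γ.clusters r := by
  classical
  exact Finset.mem_image_of_mem _ (Finset.mem_univ e)

/-- A stable tree is trivalent iff it has the maximal number of edges. -/
lemma isTrivalent_iff (hn : 3 ≤ n) : Γ.IsTrivalent ↔ Fintype.card Γ.Edge = n - 3 := by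
  classical
  have := Fintype.ofFinite Γ.V
  have h1 := Γ.graph.sum_degrees_eq_twice_card_edges
  have h2 := Γ.isTree.card_edgeFinset
  obtain ⟨c, hc'⟩ : ∃ c, Nat.card Γ.Edge = c := ⟨_, rfl⟩
  have hc : Fintype.card Γ.Edge = c := Nat.card_eq_fintype_card.symm.trans hc'
  have h3 : ∀ _ : Fintype Γ.graph.edgeSet, Γ.graph.edgeFinset.card = c := by
    intro _
    rw [SimpleGraph.edgeFinset, Set.toFinset_card, ← Nat.card_eq_fintype_card]
    exact hc'
  rw [h3] at h1 h2
  have h4 : ∑ v, {i | Γ.mark i = v}.ncard = n := by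
    have := Finset.card_eq_sum_card_fiberwise (f := Γ.mark) (s := Finset.univ) (t := Finset.univ)
      (fun _ _ => Finset.mem_coe.2 (Finset.mem_univ _))
    rw [Finset.card_univ, Fintype.card_fin] at this
    conv_rhs => rw [this]
    refine Finset.sum_congr rfl fun v _ => ?_
    rw [← Set.ncard_coe_finset]
    congr 1
    ext i
    simp
  have h5 : ∀ v, (Γ.graph.neighborSet v).ncard = Γ.graph.degree v := fun v => by
    rw [← SimpleGraph.card_neighborSet_eq_degree, ← Nat.card_eq_fintype_card, ← Nat.card_coe_set_eq]
  -- With `c` bounded edges there are `c + 1` vertices and the valences add up to `2c + n`. All of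
  -- them equal three exactly when `2c + n = 3(c + 1)`.
  have h6 : ∑ v, ((Γ.graph.neighborSet v).ncard + {i | Γ.mark i = v}.ncard) =
      2 * c + n := by
    rw [Finset.sum_add_distrib, h4, Finset.sum_congr rfl fun v _ => h5 v, h1]
  have h7 : ∑ _v : Γ.V, 3 = 3 * Fintype.card Γ.V := by
    rw [Finset.sum_const, Finset.card_univ, smul_eq_mul, mul_comm]
  have h8 := Finset.sum_eq_sum_iff_of_le fun (v : Γ.V) (_ : v ∈ Finset.univ) => Γ.stable v
  rw [h6, h7] at h8
  rw [hc]
  constructor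
  · intro h
    have := h8.2 fun v _ => (h v).symm
    omega
  · intro h v
    exact (h8.1 (by omega) v (Finset.mem_univ v)).symm

lemma isTrivalent_iff_isMaxHierarchy (hn : 3 ≤ n) (r : Fin n) :
    Γ.IsTrivalent ↔ IsMaxHierarchy r (Γ.clusters r) := by
  rw [isTrivalent_iff hn, ← Γ.card_clusters r]
  exact ⟨(Γ.isHierarchy_clusters r).isMaxHierarchy hn, fun h => h.card_eq hn⟩

end StableTree

/-! ### Double ratios in terms of clusters -/

section Weight

variable {n : ℕ} {Γ : StableTree n} {r : Fin n} {S : Finset (PairOfPairs n)}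

open Classical in
/-- The weights on the clusters given by weights on the edges. -/
def StableTree.edgeWeight (Γ : StableTree n) (r : Fin n) (l : Γ.Edge → ℝ) (A : Finset (Fin n)) : ℝ :=
  ∑ e : Γ.Edge, if Γ.cluster r e = A then l e else 0

lemma StableTree.edgeWeight_cluster (l : Γ.Edge → ℝ) (e : Γ.Edge) :
    Γ.edgeWeight r l (Γ.cluster r e) = l e := by
  classical
  rw [edgeWeight, Finset.sum_eq_single e, if_pos rfl]
  · exact fun e' _ he => if_neg fun h => he (Γ.cluster_injective r h)
  · exact fun h => absurd (Finset.mem_univ e) h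

lemma StableTree.edgeWeight_of_notMem (l : Γ.Edge → ℝ) {A : Finset (Fin n)}
    (hA : A ∉ Γ.clusters r) : Γ.edgeWeight r l A = 0 := by
  classical
  refine Finset.sum_eq_zero fun e _ => if_neg ?_
  rintro rfl
  exact hA (Γ.cluster_mem_clusters e)

lemma StableTree.isWeight_edgeWeight {l : Γ.Edge → ℝ} (hl : ∀ e, 0 ≤ l e) :
    IsWeight (Γ.clusters r) (Γ.edgeWeight r l) := by
  classical
  refine ⟨fun A => Finset.sum_nonneg fun e _ => ?_, fun A hA => Γ.edgeWeight_of_notMem l hA⟩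
  split_ifs
  · exact hl e
  · exact le_rfl

lemma StableTree.comb_edgeWeight (l : Γ.Edge → ℝ) (q : S) :
    comb (splitVecOn S) (Γ.edgeWeight r l) q = ∑ e : Γ.Edge, l e * splitVec (Γ.cluster r e) q.1 := by
  classical
  rw [comb_apply, Finset.sum_apply]
  simp only [Pi.smul_apply, smul_eq_mul, edgeWeight, Finset.sum_mul]
  rw [Finset.sum_comm]
  refine Finset.sum_congr rfl fun e _ => ?_
  rw [Finset.sum_eq_single (Γ.cluster r e)]
  · rw [if_pos rfl]; rfl
  · exact fun A _ hA => by rw [if_neg hA.symm, zero_mul]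
  · exact fun h => absurd (Finset.mem_univ _) h

/-- The propositions say on which side of an edge the four leaves lie. The two summands belong to
the two orientations of the edge, and the case distinction reproduces the sign convention of double
ratios. -/
lemma orientation_sum (a b c d : Prop) [Decidable a] [Decidable b] [Decidable c] [Decidable d]
    (x : ℝ) :
    (if a ∧ ¬ b then if c ∧ ¬ d then x else if ¬ c ∧ d then -x else 0 else 0) +
    (if ¬ a ∧ b then if ¬ c ∧ d then x else if c ∧ ¬ d then -x else 0 else 0) =
    x * ((((if a then 1 else 0) - (if b then 1 else 0)) *
      ((if c then 1 else 0) - (if d then 1 else 0)) : ℤ) : ℝ) := by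
  by_cases ha : a <;> by_cases hb : b <;> by_cases hc : c <;> by_cases hd : d <;>
    simp [ha, hb, hc, hd]

open Classical in
/-- The contribution of the two orientations of an edge to a double ratio. -/
lemma StableTree.dart_contribution (Γ : StableTree n) (r : Fin n) (d : Γ.graph.Dart)
    (q : PairOfPairs n) (x : ℝ) :
    (if d ∈ (Γ.path (Γ.mark (q 0)) (Γ.mark (q 1))).darts then
      if d ∈ (Γ.path (Γ.mark (q 2)) (Γ.mark (q 3))).darts then x
      else if d.symm ∈ (Γ.path (Γ.mark (q 2)) (Γ.mark (q 3))).darts then -x else 0 else 0) +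
    (if d.symm ∈ (Γ.path (Γ.mark (q 0)) (Γ.mark (q 1))).darts then
      if d.symm ∈ (Γ.path (Γ.mark (q 2)) (Γ.mark (q 3))).darts then x
      else if d ∈ (Γ.path (Γ.mark (q 2)) (Γ.mark (q 3))).darts then -x else 0 else 0) =
    x * splitVec (Γ.cluster r d.edge) q := by
  have h1 : ∀ i j, d ∈ (Γ.path (Γ.mark i) (Γ.mark j)).darts ↔
      (Γ.graph.deleteEdges {d.edge}).Reachable (Γ.mark i) d.fst ∧
      ¬ (Γ.graph.deleteEdges {d.edge}).Reachable (Γ.mark j) d.fst := fun i j =>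
    mem_darts_iff Γ.isTree d _ (Γ.path_isPath _ _)
  have h2 : ∀ i j, d.symm ∈ (Γ.path (Γ.mark i) (Γ.mark j)).darts ↔
      ¬ (Γ.graph.deleteEdges {d.edge}).Reachable (Γ.mark i) d.fst ∧
      (Γ.graph.deleteEdges {d.edge}).Reachable (Γ.mark j) d.fst := fun i j => by
    rw [mem_darts_iff Γ.isTree d.symm _ (Γ.path_isPath _ _), SimpleGraph.Dart.edge_symm]
    show _ ∧ ¬ (Γ.graph.deleteEdges {d.edge}).Reachable _ d.snd ↔ _
    rw [reachable_snd_iff Γ.isTree d, not_not]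
    exact and_congr_left fun _ => reachable_snd_iff Γ.isTree d _
  simp only [h1, h2]
  -- The cluster is the side of the edge away from `r`, which may be either side of the dart. The
  -- resulting sign enters both factors of the split vector and cancels.
  obtain ⟨ε, hε, h3⟩ : ∃ ε : ℤ, ε * ε = 1 ∧ ∀ i j, ind (Γ.cluster r d.edge) i -
      ind (Γ.cluster r d.edge) j =
      ε * ((if (Γ.graph.deleteEdges {d.edge}).Reachable (Γ.mark i) d.fst then 1 else 0) -
        (if (Γ.graph.deleteEdges {d.edge}).Reachable (Γ.mark j) d.fst then 1 else 0)) := by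
    by_cases hr : (Γ.graph.deleteEdges {d.edge}).Reachable (Γ.mark r) d.fst
    · refine ⟨-1, by norm_num, fun i j => ?_⟩
      have : ∀ i, i ∈ Γ.cluster r d.edge ↔
          ¬ (Γ.graph.deleteEdges {d.edge}).Reachable (Γ.mark i) d.fst := fun i => by
        rw [mem_cluster]
        exact not_congr ⟨fun h => h.trans hr, fun h => h.trans hr.symm⟩
      simp only [ind, this]
      split_ifs <;> norm_num
    · refine ⟨1, by norm_num, fun i j => ?_⟩
      have : ∀ i, i ∈ Γ.cluster r d.edge ↔
          (Γ.graph.deleteEdges {d.edge}).Reachable (Γ.mark i) d.fst := fun i => by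
        rw [← reachable_snd_iff Γ.isTree] at hr
        rw [mem_cluster, ← not_iff_not, not_not, ← reachable_snd_iff Γ.isTree]
        exact ⟨fun h => h.trans hr, fun h => h.trans hr.symm⟩
      simp only [ind, this]
      split_ifs <;> norm_num
  rw [splitVec, h3, h3, mul_mul_mul_comm, hε, one_mul]
  exact orientation_sum _ _ _ _ x

/-- The double ratios are the linear combinations of the split vectors of the edges. -/
lemma Curve.doubleRatio_eq (X : Curve n) (r : Fin n) (q : PairOfPairs n) :
    X.doubleRatio q = ∑ e, X.length e * splitVec (X.type.cluster r e) q := by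
  classical
  have := Fintype.ofFinite X.type.V
  have hnodup : (X.type.path (X.type.mark (q 0)) (X.type.mark (q 1))).darts.Nodup :=
    List.Nodup.of_map _ (X.type.path_isPath _ _).isTrail.edges_nodup
  rw [Curve.doubleRatio, ← List.sum_toFinset _ hnodup]
  have h1 : ∀ f : X.type.graph.Dart → ℝ,
      ∑ d ∈ (X.type.path (X.type.mark (q 0)) (X.type.mark (q 1))).darts.toFinset, f d =
      ∑ d, if d ∈ (X.type.path (X.type.mark (q 0)) (X.type.mark (q 1))).darts then f d else 0 := by
    intro f
    rw [← Finset.sum_filter]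
    congr 1
    ext d
    simp
  -- The sum over darts is grouped by edges; each edge carries exactly two opposite darts.
  rw [h1, ← Finset.sum_fiberwise Finset.univ
    (fun d : X.type.graph.Dart => (⟨d.edge, d.edge_mem⟩ : X.type.Edge))]
  refine Finset.sum_congr rfl fun e _ => ?_
  obtain ⟨e, he⟩ := e
  induction e using Sym2.ind with | _ v w
  let d : X.type.graph.Dart := ⟨(v, w), he⟩
  have h2 : (Finset.univ.filter fun d' : X.type.graph.Dart =>
      (⟨d'.edge, d'.edge_mem⟩ : X.type.Edge) = ⟨s(v, w), he⟩) = {d, d.symm} := by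
    ext d'
    rw [Finset.mem_filter, Finset.mem_insert, Finset.mem_singleton, Subtype.mk.injEq]
    exact (and_iff_right (Finset.mem_univ _)).trans (SimpleGraph.dart_edge_eq_iff d' d)
  rw [h2, Finset.sum_pair d.symm_ne.symm]
  have h3 := X.type.dart_contribution r d q (X.length ⟨d.edge, d.edge_mem⟩)
  simp only [SimpleGraph.Dart.edge_symm, SimpleGraph.Dart.symm_symm]
  exact h3

lemma Curve.doubleRatio_eq_comb (X : Curve n) (r : Fin n) (q : S) :
    X.doubleRatio q = comb (splitVecOn S) (X.type.edgeWeight r X.length) q := by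
  rw [X.doubleRatio_eq r, StableTree.comb_edgeWeight]

lemma doubleRatioMap_mk (X : Curve n) (r : Fin n) :
    doubleRatioMap S (Quotient.mk (Curve.setoid n) X) =
      comb (splitVecOn S) (X.type.edgeWeight r X.length) :=
  funext fun q => X.doubleRatio_eq_comb r q

/-- Two curves with the same weighted clusters are isomorphic. -/
lemma Curve.iso_of_edgeWeight_eq {X Y : Curve n} (r : Fin n)
    (h : X.type.edgeWeight r X.length = Y.type.edgeWeight r Y.length) : Curve.Iso X Y := by
  have hpos : ∀ (Z : Curve n) A, A ∈ Z.type.clusters r ↔ Z.type.edgeWeight r Z.length A ≠ 0 := by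
    classical
    intro Z A
    refine ⟨fun hA => ?_, not_imp_comm.1 fun hA => Z.type.edgeWeight_of_notMem _ hA⟩
    obtain ⟨e, -, rfl⟩ := Finset.mem_image.1 hA
    rw [StableTree.edgeWeight_cluster]
    exact (Z.length_pos e).ne'
  have hc : X.type.clusters r = Y.type.clusters r := by
    ext A
    rw [hpos, hpos, h]
  obtain ⟨par, dep, hX⟩ := exists_isRooted X.type.isTree (X.type.mark r)
  obtain ⟨par', dep', hY⟩ := exists_isRooted Y.type.isTree (Y.type.mark r)
  -- Lengths are positive, so both trees have the same clusters. A vertex is determined by the set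
  -- of markings below it, which gives the bijection of vertices; inclusion of clusters recovers
  -- ancestry and hence parents.
  have hXY : ∀ v, ∃ w, Y.type.below r par' w = X.type.below r par v := fun v => by
    rw [← StableTree.mem_withTop_clusters hY, ← hc]
    exact (StableTree.mem_withTop_clusters hX).2 ⟨v, rfl⟩
  have hYX : ∀ w, ∃ v, X.type.below r par v = Y.type.below r par' w := fun w => by
    rw [← StableTree.mem_withTop_clusters hX, hc]
    exact (StableTree.mem_withTop_clusters hY).2 ⟨w, rfl⟩
  choose f hf using hXY
  choose g hg using hYX
  have hgf : ∀ v, g (f v) = v := fun v => StableTree.below_injective hX ((hg _).trans (hf _))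
  have hfg : ∀ w, f (g w) = w := fun w => StableTree.below_injective hY ((hf _).trans (hg _))
  have hB : ∀ v w, Below (Y.type.mark r) par' (f v) (f w) ↔ Below (X.type.mark r) par v w := by
    intro v w
    rw [← StableTree.below_subset_iff hY, ← StableTree.below_subset_iff hX, hf, hf]
  have hroot : f (X.type.mark r) = Y.type.mark r := by
    have := (hB (g (Y.type.mark r)) _).2 (hX.below_root _)
    rw [hfg] at this
    exact eq_root_of_below this
  have hne : ∀ v, f v ≠ Y.type.mark r ↔ v ≠ X.type.mark r := fun v => by
    rw [← hroot, Ne, Ne, (Function.LeftInverse.injective hgf).eq_iff]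
  have hpar : ∀ v, v ≠ X.type.mark r → par' (f v) = f (par v) := by
    intro v hv
    have hstep : ∀ {Z : Type} {ρ : Z} {p : Z → Z} {a b : Z}, Below ρ p a b → a ≠ b →
        Below ρ p (p a) b := fun h hne => ((below_iff.1 h).resolve_left hne).2
    refine hY.below_antisymm (hstep ((hB _ _).2 (below_par hv)) fun e => ?_) ?_
    · exact (hX.adj_par hv).ne (Function.LeftInverse.injective hgf e)
    · rw [← hfg (par' (f v)), hB]
      refine hstep ?_ fun e => ?_
      · rw [← hB, hfg]
        exact below_par ((hne v).2 hv)
      · have := congrArg f e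
        rw [hfg] at this
        exact (hY.adj_par ((hne v).2 hv)).ne this
  have hadj : ∀ v w, (w ≠ X.type.mark r ∧ par w = v) ↔ (f w ≠ Y.type.mark r ∧ par' (f w) = f v) := by
    intro v w
    rw [hne]
    refine and_congr_right fun hw => ?_
    rw [hpar w hw, (Function.LeftInverse.injective hgf).eq_iff]
  refine ⟨⟨⟨f, g, hgf, hfg⟩, ?_⟩, fun i => ?_, ?_⟩
  · intro v w
    show Y.type.graph.Adj (f v) (f w) ↔ X.type.graph.Adj v w
    rw [hX.adj_iff, hY.adj_iff, hadj, hadj]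
  · show f (X.type.mark i) = Y.type.mark i
    by_cases hi : i = r
    · rw [hi, hroot]
    · refine hY.below_antisymm ?_ ?_
      · rw [← hfg (Y.type.mark i), hB]
        refine (StableTree.mem_below.1 (?_ : i ∈ X.type.below r par _)).2
        rw [hg]
        exact StableTree.mem_below.2 ⟨hi, Below.refl _⟩
      · refine (StableTree.mem_below.1 (?_ : i ∈ Y.type.below r par' _)).2
        rw [hf]
        exact StableTree.mem_below.2 ⟨hi, Below.refl _⟩
  · rintro ⟨e, he⟩
    obtain ⟨v, hv, rfl⟩ := hX.exists_of_mem_edgeSet he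
    rw [← StableTree.edgeWeight_cluster (r := r) Y.length,
      ← StableTree.edgeWeight_cluster (r := r) X.length, h]
    congr 1
    show Y.type.cluster r s(f v, f (par v)) = X.type.cluster r s(v, par v)
    rw [← hpar v hv, StableTree.cluster_eq_below hY ((hne v).2 hv),
      StableTree.cluster_eq_below hX hv, hf]

lemma IsComplete.doubleRatioMap_injective (hS : IsComplete S) (hn : 3 ≤ n) :
    Function.Injective (doubleRatioMap S : Moduli n → S → ℝ) := by
  intro x y
  induction x using Quotient.ind with | _ X
  induction y using Quotient.ind with | _ Y
  let r : Fin n := ⟨0, by omega⟩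
  intro h
  rw [doubleRatioMap_mk X r, doubleRatioMap_mk Y r] at h
  refine Quotient.sound (Curve.iso_of_edgeWeight_eq r ?_)
  exact hS.eq_of_comb_eq hn (X.type.isHierarchy_clusters r) (Y.type.isHierarchy_clusters r)
    (X.type.isWeight_edgeWeight fun e => (X.length_pos e).le)
    (Y.type.isWeight_edgeWeight fun e => (Y.length_pos e).le) h

end Weight

/-! ### The stable tree of a hierarchy -/

section Canonical

variable {n : ℕ} {r : Fin n} {𝒜 : Finset (Finset (Fin n))}

lemma mem_of_ne_top {A : Finset (Fin n)} (hA : A ∈ withTop r 𝒜) (h : A ≠ topCluster r) : A ∈ 𝒜 :=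
  (Finset.mem_insert.1 hA).resolve_left h

lemma IsHierarchy.mem_of_ssubset (h : IsHierarchy r 𝒜) {A B : Finset (Fin n)}
    (hA : A ∈ withTop r 𝒜) (hB : B ∈ withTop r 𝒜) (hAB : A ⊂ B) : A ∈ 𝒜 := by
  refine mem_of_ne_top hA ?_
  rintro rfl
  exact hAB.2 (h.subset_top hB)

lemma IsHierarchy.exists_min_mem (h : IsHierarchy r 𝒜) {i : Fin n} (hi : i ≠ r) :
    ∃ A ∈ withTop r 𝒜, i ∈ A ∧ ∀ D ∈ withTop r 𝒜, i ∈ D → A ⊆ D := by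
  classical
  obtain ⟨A, hA, hmin⟩ := Finset.exists_min_image ((withTop r 𝒜).filter fun D => i ∈ D)
    Finset.card ⟨topCluster r, Finset.mem_filter.2 ⟨top_mem_withTop, mem_topCluster.2 hi⟩⟩
  rw [Finset.mem_filter] at hA
  refine ⟨A, hA.1, hA.2, fun D hD hiD => ?_⟩
  rcases (h.compat_withTop hA.1 hD).of_mem hA.2 hiD with h' | h'
  · exact h'
  · exact (Finset.eq_of_subset_of_card_le h' (hmin D (Finset.mem_filter.2 ⟨hD, hiD⟩))).ge

lemma IsBranch.isParent (h : IsHierarchy r 𝒜) {A B P : Finset (Fin n)} {b : Fin n}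
    (hB : IsBranch 𝒜 A b B) (hA : A ∈ withTop r 𝒜) (hP : IsParent r 𝒜 B P) : P = A := by
  have h1 : P ⊆ A := hP.min A hA hB.ssubset
  by_contra hne
  have h2 : P ⊂ A := Finset.ssubset_iff_subset_ne.2 ⟨h1, hne⟩
  exact hP.ssubset.2 (hB.max P (h.mem_of_ssubset hP.mem hA h2) (hP.ssubset.1 hB.mem) h2)

lemma three_le_ncard_add_ncard {α β : Type*} [Finite α] [Finite β] {s : Set α} {t : Set β}
    {x y z : α ⊕ β} (hx : Sum.elim (· ∈ s) (· ∈ t) x) (hy : Sum.elim (· ∈ s) (· ∈ t) y)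
    (hz : Sum.elim (· ∈ s) (· ∈ t) z) (hxy : x ≠ y) (hxz : x ≠ z) (hyz : y ≠ z) :
    3 ≤ s.ncard + t.ncard := by
  have h1 : (Sum.inl '' s ∪ Sum.inr '' t : Set (α ⊕ β)).ncard = s.ncard + t.ncard := by
    rw [Set.ncard_union_eq, Set.ncard_image_of_injective _ Sum.inl_injective,
      Set.ncard_image_of_injective _ Sum.inr_injective]
    rw [Set.disjoint_left]
    rintro _ ⟨a, -, rfl⟩ ⟨b, -, h⟩
    exact Sum.inr_ne_inl h
  have h2 : ∀ w : α ⊕ β, Sum.elim (· ∈ s) (· ∈ t) w → w ∈ (Sum.inl '' s ∪ Sum.inr '' t) := by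
    rintro (a | b) hw
    · exact Or.inl ⟨a, hw, rfl⟩
    · exact Or.inr ⟨b, hw, rfl⟩
  rw [← h1, Nat.succ_le_iff, Set.two_lt_ncard_iff (Set.toFinite _)]
  exact ⟨x, y, z, h2 x hx, h2 y hy, h2 z hz, hxy, hxz, hyz⟩

/-- Every hierarchy is the hierarchy of a stable tree. -/
lemma IsHierarchy.exists_stableTree (hn : 3 ≤ n) (h : IsHierarchy r 𝒜) :
    ∃ Γ : StableTree n, Γ.clusters r = 𝒜 := by
  classical
  -- The vertices are the clusters together with the top one, each joined to its parent. A marking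
  -- is attached to the smallest cluster containing it, and the root marking to the top.
  let V := {A // A ∈ withTop r 𝒜}
  let ρ : V := ⟨topCluster r, top_mem_withTop⟩
  have hmem : ∀ A : V, A ≠ ρ ↔ A.1 ∈ 𝒜 := fun A =>
    ⟨fun hA => mem_of_ne_top A.2 fun e => hA (Subtype.ext e), fun hA e => h.top_notMem (by
      rw [e] at hA; exact hA)⟩
  have hpar : ∀ A : V, ∃ P : V, A ≠ ρ → IsParent r 𝒜 A.1 P.1 := by
    intro A
    by_cases hA : A = ρ
    · exact ⟨A, fun h => absurd hA h⟩
    · obtain ⟨P, hP⟩ := h.exists_isParent ((hmem A).1 hA)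
      exact ⟨⟨P, hP.mem⟩, fun _ => hP⟩
  choose par hpar using hpar
  have hmark : ∀ i : Fin n, ∃ M : V, (i = r → M = ρ) ∧ (i ≠ r → i ∈ M.1 ∧
      ∀ D ∈ withTop r 𝒜, i ∈ D → M.1 ⊆ D) := by
    intro i
    by_cases hi : i = r
    · exact ⟨ρ, fun _ => rfl, fun h => absurd hi h⟩
    · obtain ⟨A, hA, h1, h2⟩ := h.exists_min_mem hi
      exact ⟨⟨A, hA⟩, fun h => absurd h hi, fun _ => ⟨h1, h2⟩⟩
  choose mark hmr hmark using hmark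
  have hne : ∀ A, A ≠ ρ → par A ≠ A := fun A hA e => by
    have := (hpar A hA).ssubset
    rw [e] at this
    exact this.2 subset_rfl
  let G : SimpleGraph V :=
    { Adj := fun A B => (A ≠ ρ ∧ par A = B) ∨ (B ≠ ρ ∧ par B = A)
      symm := ⟨fun A B h => h.symm⟩
      loopless := ⟨fun A h => by
        rcases h with h | h <;> exact hne A h.1 h.2⟩ }
  have hG : IsRooted G ρ par (fun A => n - A.1.card) := by
    refine ⟨fun A B => Iff.rfl, fun A hA => ?_⟩
    have h1 := Finset.card_lt_card (hpar A hA).ssubset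
    have h2 := Finset.card_le_univ (par A).1
    rw [Fintype.card_fin] at h2
    omega
  have hbelow : ∀ A B : V, Below ρ par A B ↔ A.1 ⊆ B.1 := by
    intro A B
    constructor
    · intro hAB
      induction hAB with
      | refl => exact subset_rfl
      | tail _ hb ih =>
        obtain ⟨hb, rfl⟩ := hb
        exact ih.trans (hpar _ hb).ssubset.1
    · intro hAB
      induction hk : n - A.1.card using Nat.strong_induction_on generalizing A with
      | _ k ih =>
      by_cases hA : A = B
      · rw [hA]; exact Below.refl _
      · have h1 : A.1 ⊂ B.1 :=
          Finset.ssubset_iff_subset_ne.2 ⟨hAB, fun e => hA (Subtype.ext e)⟩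
        have h2 : A ≠ ρ := (hmem A).2 (h.mem_of_ssubset A.2 B.2 h1)
        exact (below_par h2).trans
          (ih _ (hk ▸ hG.dep_par A h2) (par A) ((hpar A h2).min B.1 B.2 h1) rfl)
  have hbranch : ∀ A : V, ∀ b ∈ A.1, ∃ x : V ⊕ Fin n,
      (∃ B : V, x = Sum.inl B ∧ b ∈ B.1 ∧ B ≠ ρ ∧ par B = A) ∨ (x = Sum.inr b ∧ mark b = A) := by
    intro A b hb
    obtain ⟨B, hB⟩ := h.exists_isBranch (h.one_lt_card_withTop hn A.2) hb
    by_cases hB' : B ∈ 𝒜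
    · have h1 : (⟨B, mem_withTop_of_mem hB'⟩ : V) ≠ ρ := (hmem _).2 hB'
      exact ⟨Sum.inl ⟨B, mem_withTop_of_mem hB'⟩, Or.inl ⟨_, rfl, hB.mem, h1,
        Subtype.ext (hB.isParent h A.2 (hpar _ h1))⟩⟩
    · obtain rfl := hB.node.resolve_left hB'
      refine ⟨Sum.inr b, Or.inr ⟨rfl, ?_⟩⟩
      obtain ⟨h1, h2⟩ := hmark b (h.ne_root A.2 hb)
      by_contra hne
      have h3 : (mark b).1 ⊂ A.1 := Finset.ssubset_iff_subset_ne.2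
        ⟨h2 A.1 A.2 hb, fun e => hne (Subtype.ext e)⟩
      -- A smaller cluster containing `b` would lie inside the branch `{b}`, but clusters have at
      -- least two elements.
      have h4 := Finset.card_le_card (hB.max _ (h.mem_of_ssubset (mark b).2 A.2 h3) h1 h3)
      have h5 := h.one_lt_card_withTop hn (mark b).2
      rw [Finset.card_singleton] at h4
      omega
  have hstable : ∀ A : V, 3 ≤ (G.neighborSet A).ncard + {i | mark i = A}.ncard := by
    intro A
    -- The three edges or leaves at `A`: the branches of the two markings of a meeting pair, and the
    -- one towards the root, which is the leaf `r` at the top and the edge to the parent elsewhere.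
    obtain ⟨p, hp⟩ := h.exists_isMeet hn A.2
    obtain ⟨x, hx⟩ := hbranch A _ hp.fst_mem
    obtain ⟨y, hy⟩ := hbranch A _ hp.snd_mem
    have hT : ∀ b x, ((∃ B : V, x = Sum.inl B ∧ b ∈ B.1 ∧ B ≠ ρ ∧ par B = A) ∨
        (x = Sum.inr b ∧ mark b = A)) →
        Sum.elim (· ∈ G.neighborSet A) (· ∈ {i | mark i = A}) x := by
      rintro b x (⟨B, rfl, -, h1, h2⟩ | ⟨rfl, h1⟩)
      · exact Or.inr ⟨h1, h2⟩
      · exact h1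
    have hxy : x ≠ y := by
      rcases hx with ⟨B, rfl, h1, h2, h3⟩ | ⟨rfl, h1⟩
      · rcases hy with ⟨C, rfl, h1', -⟩ | ⟨rfl, -⟩
        · intro e
          rw [← Sum.inl_injective e] at h1'
          have h4 := hp.min B.1 ((hmem B).1 h2) h1 h1'
          rw [← h3] at h4
          exact (hpar B h2).ssubset.2 h4
        · exact Sum.inl_ne_inr
      · rcases hy with ⟨C, rfl, -⟩ | ⟨rfl, -⟩
        · exact Sum.inr_ne_inl
        · exact fun e => hp.ne (Sum.inr_injective e)
    by_cases hA : A = ρ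
    · have hz : ∀ b ∈ A.1, ∀ x, ((∃ B : V, x = Sum.inl B ∧ b ∈ B.1 ∧ B ≠ ρ ∧ par B = A) ∨
          (x = Sum.inr b ∧ mark b = A)) → x ≠ Sum.inr r := by
        rintro b hb x (⟨B, rfl, -⟩ | ⟨rfl, -⟩)
        · exact Sum.inl_ne_inr
        · exact fun e => h.ne_root A.2 hb (Sum.inr_injective e)
      exact three_le_ncard_add_ncard (hT _ x hx) (hT _ y hy) (z := Sum.inr r)
        ((hmr r rfl).trans hA.symm) hxy (hz _ hp.fst_mem x hx) (hz _ hp.snd_mem y hy)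
    · have hz : ∀ b, ∀ x, ((∃ B : V, x = Sum.inl B ∧ b ∈ B.1 ∧ B ≠ ρ ∧ par B = A) ∨
          (x = Sum.inr b ∧ mark b = A)) → x ≠ Sum.inl (par A) := by
        rintro b x (⟨B, rfl, -, h1, h2⟩ | ⟨rfl, -⟩)
        · intro e
          have h3 := (hpar A hA).ssubset
          rw [← Sum.inl_injective e] at h3
          have h4 := (hpar B h1).ssubset
          rw [h2] at h4
          exact h3.2 h4.1
        · exact Sum.inr_ne_inl
      exact three_le_ncard_add_ncard (hT _ x hx) (hT _ y hy) (z := Sum.inl (par A))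
        (Or.inl ⟨hA, rfl⟩) hxy (hz _ x hx) (hz _ y hy)
  let Γ : StableTree n := ⟨V, inferInstance, G, hG.isTree, mark, hstable⟩
  have hΓ : IsRooted Γ.graph (Γ.mark r) par (fun A => n - A.1.card) := by
    show IsRooted G (mark r) par _
    rw [hmr r rfl]
    exact hG
  have hb : ∀ A : V, Γ.below r par A = A.1 := by
    intro A
    ext i
    rw [StableTree.mem_below]
    show i ≠ r ∧ Below (mark r) par (mark i) A ↔ _
    rw [hmr r rfl, hbelow]
    constructor
    · exact fun hi => hi.2 (hmark i hi.1).1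
    · exact fun hi => ⟨h.ne_root A.2 hi, (hmark i (h.ne_root A.2 hi)).2 A.1 A.2 hi⟩
  refine ⟨Γ, ?_⟩
  ext A
  rw [StableTree.mem_clusters hΓ]
  constructor
  · rintro ⟨B, hB, rfl⟩
    have hB' : B ≠ mark r := hB
    rw [hmr r rfl] at hB'
    rw [hb]
    exact (hmem B).1 hB'
  · intro hA
    refine ⟨(⟨A, mem_withTop_of_mem hA⟩ : V), ?_, hb _⟩
    show _ ≠ mark r
    rw [hmr r rfl]
    exact (hmem _).2 hA

end Canonical

/-! ### Contraction of edges -/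

/-- Contracting other edges does not change the two sides of a surviving edge, because in a tree no
second edge joins the same two components (`eq_of_component_eq`). -/
lemma reachable_map_iff {V : Type*} {G H : SimpleGraph V} (hG : G.IsTree) (hHG : H ≤ G) {v w : V}
    (hvw : G.Adj v w) (hH : ¬ H.Adj v w) (a b : V) :
    ((G.map H.connectedComponentMk).deleteEdges
      {s(H.connectedComponentMk v, H.connectedComponentMk w)}).Reachable
      (H.connectedComponentMk a) (H.connectedComponentMk b) ↔
    (G.deleteEdges {s(v, w)}).Reachable a b := by
  constructor
  · rintro ⟨p⟩
    exact reachable_lift hHG hH p a b rfl rfl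
  · rintro ⟨p⟩
    induction p with
    | nil => exact SimpleGraph.Reachable.refl _
    | @cons x y z h p ih =>
      refine SimpleGraph.Reachable.trans ?_ ih
      by_cases hxy : H.connectedComponentMk x = H.connectedComponentMk y
      · rw [hxy]
      · rw [SimpleGraph.deleteEdges_adj] at h
        refine SimpleGraph.Adj.reachable ?_
        rw [SimpleGraph.deleteEdges_adj]
        refine ⟨⟨hxy, x, y, h.1, rfl, rfl⟩, fun he => h.2 ?_⟩
        rw [Set.mem_singleton_iff]
        rcases Sym2.eq_iff.1 (Set.mem_singleton_iff.1 he) with ⟨h1, h2⟩ | ⟨h1, h2⟩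
        · obtain ⟨rfl, rfl⟩ := eq_of_component_eq hG hHG hvw hH h.1 h1.symm h2.symm
          rfl
        · obtain ⟨rfl, rfl⟩ := eq_of_component_eq hG hHG hvw hH h.1.symm h2.symm h1.symm
          exact Sym2.eq_swap

namespace StableTree

variable {n : ℕ} {Γ : StableTree n} {r : Fin n} (ℓ : Γ.Edge → ℝ≥0)

/-- The map from the vertices of `Γ` to the vertices of the contracted tree. -/
def contractMap (v : Γ.V) : (Γ.contract ℓ).type.V := Γ.collapse ℓ v

lemma cluster_contract (e : Γ.Edge) (he : ℓ e ≠ 0) :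
    (Γ.contract ℓ).type.cluster r (Sym2.map (contractMap ℓ) e.1) = Γ.cluster r e := by
  obtain ⟨e, h⟩ := e
  induction e using Sym2.ind with | _ v w
  ext i
  rw [mem_cluster, mem_cluster]
  exact not_congr (reachable_map_iff Γ.isTree (Γ.zeroGraph_le ℓ) h (fun h' => he h'.2) _ _)

/-- In terms of weights on clusters, contraction does nothing: surviving edges keep their clusters
and lengths, and contracted ones had weight zero. This makes the cone maps linear in the double
ratio coordinates. -/
lemma edgeWeight_contract :
    (Γ.contract ℓ).type.edgeWeight r (Γ.contract ℓ).length =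
      Γ.edgeWeight r fun e => (ℓ e : ℝ) := by
  classical
  have hspec : ∀ e : (Γ.contract ℓ).type.Edge, ∃ e' : Γ.Edge, Sym2.map (contractMap ℓ) e'.1 = e.1 ∧
      ℓ e' ≠ 0 ∧ (Γ.contract ℓ).length e = ℓ e' := fun e =>
    ⟨_, (Γ.exists_edge_contractType ℓ e).choose_spec.1,
      (Γ.exists_edge_contractType ℓ e).choose_spec.2.ne', rfl⟩
  funext A
  by_cases hA : A ∈ (Γ.contract ℓ).type.clusters r
  · obtain ⟨e, -, rfl⟩ := Finset.mem_image.1 hA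
    obtain ⟨e', h1, h2, h3⟩ := hspec e
    rw [edgeWeight_cluster, h3, ← h1, cluster_contract ℓ e' h2, edgeWeight_cluster]
  · rw [edgeWeight_of_notMem _ hA]
    by_cases hA' : A ∈ Γ.clusters r
    · obtain ⟨e, -, rfl⟩ := Finset.mem_image.1 hA'
      rw [edgeWeight_cluster]
      by_contra hne
      have he : ℓ e ≠ 0 := fun h => hne (by rw [h]; rfl)
      refine hA ?_
      rw [← cluster_contract ℓ e he]
      refine cluster_mem_clusters (Γ := (Γ.contract ℓ).type) ⟨_, ?_⟩
      obtain ⟨e, h⟩ := e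
      induction e using Sym2.ind with | _ v w
      exact ⟨not_reachable_of_adj Γ.isTree (Γ.zeroGraph_le ℓ) h fun h' => he h'.2,
        v, w, h, rfl, rfl⟩
    · rw [edgeWeight_of_notMem _ hA']

variable {S : Finset (PairOfPairs n)}

lemma doubleRatioMap_cone (r : Fin n) :
    doubleRatioMap S (Γ.cone ℓ) = comb (splitVecOn S) (Γ.edgeWeight r fun e => (ℓ e : ℝ)) := by
  rw [← edgeWeight_contract]
  exact doubleRatioMap_mk (Γ.contract ℓ) r

lemma edgeWeight_of_isWeight {l : Finset (Fin n) → ℝ} (hl : IsWeight (Γ.clusters r) l) :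
    Γ.edgeWeight r (fun e => l (Γ.cluster r e)) = l := by
  classical
  funext A
  by_cases hA : A ∈ Γ.clusters r
  · obtain ⟨e, -, rfl⟩ := Finset.mem_image.1 hA
    rw [edgeWeight_cluster]
  · rw [edgeWeight_of_notMem _ hA, hl.support A hA]

lemma range_doubleRatioMap_cone (Γ : StableTree n) (r : Fin n) :
    Set.range (fun ℓ => doubleRatioMap S (Γ.cone ℓ)) = coneOf (splitVecOn S) (Γ.clusters r) := by
  ext x
  rw [mem_coneOf_iff_isWeight]
  constructor
  · rintro ⟨ℓ, rfl⟩
    exact ⟨_, Γ.isWeight_edgeWeight fun e => (ℓ e).2, (doubleRatioMap_cone ℓ r).symm⟩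
  · rintro ⟨l, hl, rfl⟩
    refine ⟨fun e => Real.toNNReal (l (Γ.cluster r e)), ?_⟩
    show doubleRatioMap S (Γ.cone _) = _
    rw [doubleRatioMap_cone _ r]
    simp only [Real.coe_toNNReal _ (hl.nonneg _)]
    rw [edgeWeight_of_isWeight hl]

end StableTree

/-! ### The topology of the moduli space -/

section Embedding

variable {n : ℕ} {S : Finset (PairOfPairs n)}

lemma StableTree.continuous_doubleRatioMap_cone (Γ : StableTree n) (r : Fin n) :
    Continuous fun ℓ => doubleRatioMap S (Γ.cone ℓ) := by
  refine continuous_pi fun q => ?_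
  have h : ∀ ℓ, doubleRatioMap S (Γ.cone ℓ) q =
      ∑ e : Γ.Edge, (ℓ e : ℝ) * splitVec (Γ.cluster r e) q.1 := fun ℓ => by
    rw [StableTree.doubleRatioMap_cone ℓ r, StableTree.comb_edgeWeight]
  simp only [h]
  fun_prop

lemma StableTree.continuous_cone (Γ : StableTree n) : Continuous Γ.cone :=
  continuous_iff_coinduced_le.2 (le_iSup (fun Γ : StableTree n =>
    TopologicalSpace.coinduced Γ.cone inferInstance) Γ)

lemma continuous_doubleRatioMap (r : Fin n) :
    Continuous (doubleRatioMap S : Moduli n → S → ℝ) :=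
  continuous_iSup_dom.2 fun Γ => continuous_coinduced_dom.2 (Γ.continuous_doubleRatioMap_cone r)

namespace IsComplete

variable (hS : IsComplete S) (hn : 3 ≤ n)
include hS hn

/-- The dual forms recover the edge lengths continuously, which gives a continuous left inverse;
truncation at zero extends it to all of the ambient space. -/
lemma isClosedEmbedding_cone (Γ : StableTree n) (r : Fin n) :
    Topology.IsClosedEmbedding fun ℓ => doubleRatioMap S (Γ.cone ℓ) := by
  obtain ⟨m, hm⟩ := hS.exists_isDual hn (Γ.isHierarchy_clusters r)
  refine Function.LeftInverse.isClosedEmbedding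
    (f := fun x (e : Γ.Edge) => (pairing (m (Γ.cluster r e)) x).toNNReal) (fun ℓ => ?_) ?_
    (Γ.continuous_doubleRatioMap_cone r)
  · funext e
    rw [StableTree.doubleRatioMap_cone ℓ r]
    show (pairing (m (Γ.cluster r e)) _).toNNReal = ℓ e
    rw [hm.pairing_comb (l := Γ.edgeWeight r fun e => (ℓ e : ℝ))
      (fun A hA => Γ.edgeWeight_of_notMem _ hA) (Γ.cluster_mem_clusters e),
      StableTree.edgeWeight_cluster, Real.toNNReal_coe]
  · exact continuous_pi fun e => continuous_real_toNNReal.comp (continuous_pairing _)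

/-- The statement holds for any tree with the right clusters, so that one fixed representative per
hierarchy, hence finitely many cones, covers the moduli space. -/
lemma exists_cone (r : Fin n) (x : Moduli n) : ∃ (𝒜 : Finset (Finset (Fin n))),
    IsHierarchy r 𝒜 ∧ ∀ Γ : StableTree n, Γ.clusters r = 𝒜 → ∃ ℓ, x = Γ.cone ℓ := by
  induction x using Quotient.ind with | _ X
  refine ⟨X.type.clusters r, X.type.isHierarchy_clusters r, fun Γ hΓ => ?_⟩
  have h : doubleRatioMap S (Quotient.mk (Curve.setoid n) X) ∈
      Set.range (fun ℓ => doubleRatioMap S (Γ.cone ℓ)) := by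
    rw [Γ.range_doubleRatioMap_cone r, hΓ, mem_coneOf_iff_isWeight]
    exact ⟨_, X.type.isWeight_edgeWeight fun e => (X.length_pos e).le,
      (doubleRatioMap_mk X r).symm⟩
  obtain ⟨ℓ, hℓ⟩ := h
  exact ⟨ℓ, hS.doubleRatioMap_injective hn hℓ.symm⟩

lemma isClosedEmbedding_doubleRatioMap (r : Fin n) :
    Topology.IsClosedEmbedding (doubleRatioMap S : Moduli n → S → ℝ) := by
  refine Topology.IsClosedEmbedding.of_continuous_injective_isClosedMap
    (continuous_doubleRatioMap r) (hS.doubleRatioMap_injective hn) fun K hK => ?_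
  -- One representative type per hierarchy, with an arbitrary default `Γ₀` for families that are not
  -- hierarchies. The image of a closed set is then a finite union of closed sets.
  have hex : ∀ 𝒜 : Finset (Finset (Fin n)), ∃ Γ : StableTree n,
      IsHierarchy r 𝒜 → Γ.clusters r = 𝒜 := by
    obtain ⟨Γ₀, -⟩ := IsHierarchy.exists_stableTree (r := r) (𝒜 := ∅) hn
      ⟨by simp, by simp, by simp, by simp⟩
    intro 𝒜
    by_cases h : IsHierarchy r 𝒜
    · obtain ⟨Γ, hΓ⟩ := h.exists_stableTree hn
      exact ⟨Γ, fun _ => hΓ⟩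
    · exact ⟨Γ₀, fun h' => absurd h' h⟩
  choose T hT using hex
  have h : doubleRatioMap S '' K =
      ⋃ 𝒜, (fun ℓ => doubleRatioMap S ((T 𝒜).cone ℓ)) '' ((T 𝒜).cone ⁻¹' K) := by
    ext y
    rw [Set.mem_iUnion]
    constructor
    · rintro ⟨x, hx, rfl⟩
      obtain ⟨𝒜, h, hx'⟩ := hS.exists_cone hn r x
      obtain ⟨ℓ, rfl⟩ := hx' (T 𝒜) (hT 𝒜 h)
      exact ⟨𝒜, ℓ, hx, rfl⟩
    · rintro ⟨𝒜, ℓ, hℓ, rfl⟩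
      exact ⟨_, hℓ, rfl⟩
  rw [h]
  refine isClosed_iUnion_of_finite fun 𝒜 => ?_
  exact (hS.isClosedEmbedding_cone hn (T 𝒜) r).isClosedMap _ (hK.preimage (T 𝒜).continuous_cone)

lemma range_doubleRatioMap (r : Fin n) :
    Set.range (doubleRatioMap S : Moduli n → S → ℝ) = (hierarchyComplex hn r hS).support := by
  ext y
  rw [mem_support]
  constructor
  · rintro ⟨x, rfl⟩
    induction x using Quotient.ind with | _ X
    exact ⟨_, _, X.type.isHierarchy_clusters r,
      X.type.isWeight_edgeWeight fun e => (X.length_pos e).le, (doubleRatioMap_mk X r).symm⟩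
  · rintro ⟨𝒜, l, h, hl, rfl⟩
    obtain ⟨Γ, rfl⟩ := h.exists_stableTree hn
    have h' : comb (splitVecOn S) l ∈ coneOf (splitVecOn S) (Γ.clusters r) :=
      mem_coneOf_iff_isWeight.2 ⟨l, hl, rfl⟩
    rw [← Γ.range_doubleRatioMap_cone r] at h'
    obtain ⟨ℓ, hℓ⟩ := h'
    exact ⟨_, hℓ⟩

lemma facets_hierarchyComplex (r : Fin n) : (hierarchyComplex hn r hS).facets =
    {F | ∃ Γ : StableTree n, Γ.IsTrivalent ∧
      F = Set.range (fun ℓ => doubleRatioMap S (Γ.cone ℓ))} := by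
  ext F
  rw [mem_facets, Set.mem_ofPred_eq]
  constructor
  · rintro ⟨𝒜, hM, rfl⟩
    obtain ⟨Γ, rfl⟩ := hM.1.exists_stableTree hn
    exact ⟨Γ, (StableTree.isTrivalent_iff_isMaxHierarchy hn r).2 hM,
      (Γ.range_doubleRatioMap_cone r).symm⟩
  · rintro ⟨Γ, hΓ, rfl⟩
    exact ⟨_, (StableTree.isTrivalent_iff_isMaxHierarchy hn r).1 hΓ,
      Γ.range_doubleRatioMap_cone r⟩

end IsComplete

end Embedding

/-! ### Laurent polynomials and regular functions -/

section Laurent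

variable {ι κ : Type} [Fintype ι] [Fintype κ]

/-- Repeated exponents are allowed here; monomials with the same exponent are merged by keeping the
largest coefficient. -/
lemma isLaurentPolynomial_sup' {α : Type*} {B : Finset α} (hB : B.Nonempty) (j : α → ι → ℤ)
    (a : α → ℝ) :
    IsLaurentPolynomial fun x : ι → ℝ => B.sup' hB fun k => a k + ∑ i, (j k i : ℝ) * x i := by
  classical
  have hfin : ∀ z, (a '' {k | k ∈ B ∧ j k = z}).Finite := fun z =>
    Set.Finite.image _ (B.finite_toSet.subset fun k hk => hk.1)
  refine ⟨B.image j, hB.image j, fun z => sSup (a '' {k | k ∈ B ∧ j k = z}), fun x => ?_⟩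
  refine le_antisymm (Finset.sup'_le _ _ fun k hk => ?_) (Finset.sup'_le _ _ fun z hz => ?_)
  · refine le_trans ?_ (Finset.le_sup' _ (Finset.mem_image_of_mem j hk))
    exact add_le_add_left (le_csSup (hfin _).bddAbove ⟨k, ⟨hk, rfl⟩, rfl⟩) _
  · obtain ⟨k, hk, rfl⟩ := Finset.mem_image.1 hz
    have hne : (a '' {k' | k' ∈ B ∧ j k' = j k}).Nonempty := ⟨_, k, ⟨hk, rfl⟩, rfl⟩
    obtain ⟨k', ⟨hk', hj⟩, h'⟩ := hne.csSup_mem (hfin _)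
    show sSup (a '' {k' | k' ∈ B ∧ j k' = j k}) + ∑ i, (j k i : ℝ) * x i ≤ _
    rw [← h', ← hj]
    exact Finset.le_sup' (fun k => a k + ∑ i, (j k i : ℝ) * x i) hk'

lemma IsLaurentPolynomial.continuous {p : (ι → ℝ) → ℝ} (hp : IsLaurentPolynomial p) :
    Continuous p := by
  obtain ⟨A, hA, a, h⟩ := hp
  rw [funext h]
  refine Continuous.finset_sup'_apply hA fun j _ => ?_
  fun_prop

/-- An integral linear substitution may make exponents coincide, which is why
`isLaurentPolynomial_sup'` is needed. -/
lemma IsLaurentPolynomial.comp {p : (ι → ℝ) → ℝ} (hp : IsLaurentPolynomial p) (t : ι → κ → ℤ) :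
    IsLaurentPolynomial fun x : κ → ℝ => p fun i => ∑ k, (t i k : ℝ) * x k := by
  obtain ⟨A, hA, a, h⟩ := hp
  simp only [h]
  convert isLaurentPolynomial_sup' hA (fun j k => ∑ i, j i * t i k) a using 2 with x
  refine Finset.sup'_congr hA rfl fun j _ => ?_
  push_cast
  simp only [Finset.mul_sum, Finset.sum_mul]
  rw [Finset.sum_comm]
  simp only [mul_assoc]

lemma isLaurentPolynomial_apply (i : ι) : IsLaurentPolynomial fun x : ι → ℝ => x i := by
  classical
  refine ⟨{Pi.single i 1}, Finset.singleton_nonempty _, fun _ => 0, fun x => ?_⟩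
  rw [Finset.sup'_singleton, zero_add, Finset.sum_eq_single i]
  · simp
  · intro k _ hk
    simp [Pi.single_eq_of_ne hk]
  · exact fun h => absurd (Finset.mem_univ i) h

lemma isOpenEmbedding_realToTrop : Topology.IsOpenEmbedding realToTrop := by
  refine Topology.IsOpenEmbedding.of_comp realToTrop
    (g := (Subtype.val : Trop → EReal)) ?_ EReal.isOpenEmbedding_coe
  exact IsOpen.isOpenEmbedding_subtypeVal (isOpen_ne)

lemma isOpenEmbedding_vecToTrop : Topology.IsOpenEmbedding (vecToTrop : (ι → ℝ) → ι → Trop) :=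
  Topology.IsOpenEmbedding.piMap fun _ => isOpenEmbedding_realToTrop

/-- A Laurent polynomial is regular on the real points. -/
lemma IsLaurentPolynomial.exists_isRegularOn {p : (ι → ℝ) → ℝ} (hp : IsLaurentPolynomial p) :
    ∃ g, IsRegularOn g (Set.range (vecToTrop : (ι → ℝ) → ι → Trop)) ∧
      ∀ x, g (vecToTrop x) = realToTrop (p x) := by
  have hv := isOpenEmbedding_vecToTrop (ι := ι)
  -- The value at nonreal points is irrelevant, since regularity is only claimed on the open set of
  -- real points.
  let g : (ι → Trop) → Trop := Function.extend vecToTrop (fun x => realToTrop (p x)) fun _ => realToTrop 0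
  have hg : ∀ x, g (vecToTrop x) = realToTrop (p x) := fun x =>
    hv.injective.extend_apply _ _ x
  refine ⟨g, ⟨hv.isOpen_range, ?_, p, hp, fun x _ => hg x⟩, hg⟩
  rintro _ ⟨x, rfl⟩
  refine ContinuousAt.continuousWithinAt ?_
  rw [← hv.continuousAt_iff]
  have : g ∘ vecToTrop = fun x => realToTrop (p x) := funext hg
  rw [this]
  exact (isOpenEmbedding_realToTrop.continuous.comp hp.continuous).continuousAt

end Laurent

/-! ### Pulling back the regular sheaf -/

section Sheaf

open TopologicalSpace

variable {X Y : Type*} [TopologicalSpace X] [TopologicalSpace Y] {ι κ : Type} [Fintype ι] [Fintype κ]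

lemma pullbackSheaf_iff {φ : X → ι → Trop} {U : Opens X} {f : U → Trop} :
    (pullbackSheaf φ).pred (U := U) f ↔ ∀ x : U, ∃ (V : Opens X) (hV : V ≤ U), x.1 ∈ V ∧
      ∃ W g, IsRegularOn g W ∧ ∀ y : V, φ y.1 ∈ W ∧ f ⟨y.1, hV y.2⟩ = g (φ y.1) := by
  constructor
  · intro h x
    obtain ⟨V, hx, i, W, g, hg, hW⟩ := h x
    exact ⟨V, i.le, hx, W, g, hg, hW⟩
  · intro h x
    obtain ⟨V, hV, hx, W, g, hg, hW⟩ := h x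
    exact ⟨V, hx, CategoryTheory.homOfLE hV, W, g, hg, hW⟩

/-- The real points form an open subset of 𝕋^ι, so for a map into them regular functions are locally
just Laurent polynomials. -/
lemma pullbackSheaf_vecToTrop_iff {ψ : X → ι → ℝ} {U : Opens X} {f : U → Trop} :
    (pullbackSheaf (vecToTrop ∘ ψ)).pred (U := U) f ↔
      ∀ x : U, ∃ (V : Opens X) (hV : V ≤ U), x.1 ∈ V ∧
        ∃ p, IsLaurentPolynomial p ∧ ∀ y : V, f ⟨y.1, hV y.2⟩ = realToTrop (p (ψ y.1)) := by
  rw [pullbackSheaf_iff]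
  refine forall_congr' fun x => exists_congr fun V => exists_congr fun hV => and_congr_right fun _ => ?_
  constructor
  · rintro ⟨W, g, ⟨-, -, p, hp, hg⟩, h⟩
    exact ⟨p, hp, fun y => (h y).2.trans (hg _ (h y).1)⟩
  · rintro ⟨p, hp, h⟩
    obtain ⟨g, hg, hgp⟩ := hp.exists_isRegularOn
    exact ⟨_, g, hg, fun y => ⟨⟨_, rfl⟩, (h y).trans (hgp _).symm⟩⟩

/-- Coordinates that are integral linear combinations of other coordinates give fewer regular
functions. -/
lemma pullbackSheaf_of_linear {ψ : X → ι → ℝ} {χ : X → κ → ℝ} (t : ι → κ → ℤ)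
    (h : ∀ x i, ψ x i = ∑ k, (t i k : ℝ) * χ x k) {U : Opens X} {f : U → Trop}
    (hf : (pullbackSheaf (vecToTrop ∘ ψ)).pred (U := U) f) :
    (pullbackSheaf (vecToTrop ∘ χ)).pred (U := U) f := by
  rw [pullbackSheaf_vecToTrop_iff] at hf ⊢
  intro x
  obtain ⟨V, hV, hx, p, hp, hfp⟩ := hf x
  refine ⟨V, hV, hx, _, hp.comp t, fun y => ?_⟩
  rw [hfp y, funext (h y.1)]

/-- Pulling back along an open embedding is compatible with restriction. -/
lemma pullbackSheaf_comp_iff {j : X → Y} (hj : Topology.IsOpenEmbedding j) {φ : Y → ι → Trop}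
    {U : Opens X} {W : Opens Y} (hW : (W : Set Y) ⊆ Set.range j) (hU : ∀ x, x ∈ U ↔ j x ∈ W)
    {f : W → Trop} {f' : U → Trop} (hf : ∀ x : U, f' x = f ⟨j x.1, (hU _).1 x.2⟩) :
    (pullbackSheaf φ).pred (U := W) f ↔ (pullbackSheaf (φ ∘ j)).pred (U := U) f' := by
  rw [pullbackSheaf_iff, pullbackSheaf_iff]
  constructor
  · intro h x
    obtain ⟨V, hV, hx, W', g, hg, hgV⟩ := h ⟨j x.1, (hU _).1 x.2⟩
    refine ⟨⟨j ⁻¹' V, V.2.preimage hj.continuous⟩, fun y hy => (hU y).2 (hV hy), hx, W', g, hg,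
      fun y => ?_⟩
    rw [hf]
    exact hgV ⟨j y.1, y.2⟩
  · rintro h ⟨y, hy⟩
    obtain ⟨x, rfl⟩ := hW hy
    obtain ⟨V, hV, hx, W', g, hg, hgV⟩ := h ⟨x, (hU x).2 hy⟩
    refine ⟨⟨j '' V, hj.isOpenMap _ V.2⟩, ?_, ⟨x, hx, rfl⟩, W', g, hg, ?_⟩
    · rintro _ ⟨z, hz, rfl⟩
      exact (hU z).1 (hV hz)
    · rintro ⟨_, z, hz, rfl⟩
      have := hgV ⟨z, hz⟩
      rw [hf] at this
      exact this

end Sheaf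

/-! ### The moduli space as a tropical variety -/

/-- A space with a closed embedding onto the real points of a simply balanced complex is a tropical
variety. -/
lemma isTropicalVariety_of_isClosedEmbedding {X : Type*} [TopologicalSpace X] {ι : Type} [Fintype ι]
    {k : ℕ} {C : PolyComplex ι k} (hC : C.IsSimplyBalanced) {ψ : X → ι → ℝ}
    (hψ : Topology.IsClosedEmbedding ψ) (hr : Set.range ψ = C.support) :
    IsTropicalVariety k (pullbackSheaf (vecToTrop ∘ ψ)) := by
  intro x
  have : Nonempty X := ⟨x⟩
  have hv := isOpenEmbedding_vecToTrop (ι := ι)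
  let j : X → C.tropSupport := fun y => ⟨vecToTrop (ψ y),
    subset_closure ⟨ψ y, hr ▸ ⟨y, rfl⟩, rfl⟩⟩
  have hj : Topology.IsOpenEmbedding j := by
    refine ⟨Topology.IsEmbedding.of_comp ?_ continuous_subtype_val
      (hv.isEmbedding.comp hψ.isEmbedding), ?_⟩
    · exact (hv.continuous.comp hψ.continuous).subtype_mk _
    -- The support is closed in ℝ^ι, so taking the closure in 𝕋^ι adds no real points, and the image
    -- is the open set of real points of the closure.
    · have : Set.range j = Subtype.val ⁻¹' Set.range (vecToTrop : (ι → ℝ) → ι → Trop) := by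
        ext ⟨y, hy⟩
        constructor
        · rintro ⟨z, hz⟩
          exact ⟨ψ z, congrArg Subtype.val hz⟩
        · rintro ⟨z, hz⟩
          have hz' : vecToTrop z = y := hz
          subst hz'
          have h1 : z ∈ closure C.support := by
            rw [hv.isInducing.closure_eq_preimage_closure_image]
            exact hy
          rw [← hr, hψ.isClosed_range.closure_eq] at h1
          obtain ⟨u, rfl⟩ := h1
          exact ⟨u, rfl⟩
      rw [this]
      exact hv.isOpen_range.preimage continuous_subtype_val
  refine ⟨ι, inferInstance, C, hj.toOpenPartialHomeomorph j, hC, Set.mem_univ _, fun W hW f => ?_⟩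
  refine pullbackSheaf_comp_iff hj (fun y hy => ?_) (fun y => ?_) (fun y => rfl)
  · obtain ⟨z, -, hz⟩ := hW hy
    exact ⟨z, hz⟩
  · exact and_iff_right (Set.mem_univ _)

variable {n : ℕ} {S : Finset (PairOfPairs n)}

lemma IsComplete.exists_linear (hS : IsComplete S) (r : Fin n) (q : PairOfPairs n) :
    ∃ t : S → ℤ, ∀ x, doubleRatio q x = ∑ k, (t k : ℝ) * doubleRatioMap S x k := by
  classical
  obtain ⟨q', hq', hu⟩ := hS q
  obtain ⟨ε, -, hε⟩ := exists_sign hu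
  refine ⟨Pi.single ⟨q', hq'⟩ ε, fun x => ?_⟩
  rw [Finset.sum_eq_single ⟨q', hq'⟩]
  · induction x using Quotient.ind with | _ X
    show X.doubleRatio q = _ * X.doubleRatio q'
    rw [X.doubleRatio_eq r, X.doubleRatio_eq r, Finset.mul_sum, Pi.single_eq_same]
    refine Finset.sum_congr rfl fun e _ => ?_
    rw [hε]
    push_cast
    ring
  · intro k _ hk
    rw [Pi.single_eq_of_ne hk, Int.cast_zero, zero_mul]
  · exact fun h => absurd (Finset.mem_univ _) h

/-- Every double ratio is plus or minus a coordinate of a complete `S`. Applied in both directions,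
this shows that all complete choices define the same sheaf. -/
lemma IsComplete.pullbackSheaf_imp (hS : IsComplete S) (r : Fin n) (T : Finset (PairOfPairs n))
    {U : TopologicalSpace.Opens (Moduli n)} {f : U → Trop}
    (hf : (pullbackSheaf (vecToTrop ∘ doubleRatioMap T)).pred (U := U) f) :
    (pullbackSheaf (vecToTrop ∘ doubleRatioMap S)).pred (U := U) f := by
  choose t ht using hS.exists_linear r
  exact pullbackSheaf_of_linear (fun q : T => t q.1) (fun x q => ht q.1 x) hf

/-- Edge lengths are double ratios. -/
lemma StableTree.exists_isEdgeLength (Γ : StableTree n) (hn : 3 ≤ n) (r : Fin n) (e : Γ.Edge) :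
    ∃ q, Γ.IsEdgeLength e (doubleRatio q) := by
  obtain ⟨q, hq⟩ := (Γ.isHierarchy_clusters r).exists_dual_pairOfPairs hn (Γ.cluster_mem_clusters e)
  refine ⟨q, fun ℓ hℓ => ?_⟩
  show Curve.doubleRatio ⟨Γ, ℓ, hℓ⟩ q = _
  rw [Curve.doubleRatio_eq _ r, Finset.sum_eq_single e]
  · show ℓ e * (splitVec (Γ.cluster r e) q : ℝ) = _
    rw [hq _ (Γ.cluster_mem_clusters e), if_pos rfl, Int.cast_one, mul_one]
  · intro e' _ he
    show ℓ e' * (splitVec (Γ.cluster r e') q : ℝ) = _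
    rw [hq _ (Γ.cluster_mem_clusters e'), if_neg fun h => he (Γ.cluster_injective r h),
      Int.cast_zero, mul_zero]
  · exact fun h => absurd (Finset.mem_univ e) h

lemma isRegularWithin_doubleRatio {q : PairOfPairs n} (hq : q ∈ S) (A : Set (Moduli n)) :
    IsRegularWithin (pullbackSheaf (vecToTrop ∘ doubleRatioMap S)) A (doubleRatio q) := by
  intro x _
  refine ⟨⊤, fun y => realToTrop (doubleRatio q y.1), Set.mem_univ x, ?_, fun y _ => rfl⟩
  rw [pullbackSheaf_vecToTrop_iff]
  intro y
  exact ⟨⊤, le_rfl, Set.mem_univ _, _, isLaurentPolynomial_apply ⟨q, hq⟩, fun z => rfl⟩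

end TropMod

end

theorem theorem1 (n : ℕ) (hn : 3 ≤ n) :
    ∃ 𝒪 : TropMod.TropSheaf (TropMod.Moduli n),
      TropMod.IsTropicalVariety (n - 3) 𝒪 ∧
      (∀ (Γ : TropMod.StableTree n) (e : Γ.Edge), ∃ f : TropMod.Moduli n → ℝ,
        Γ.IsEdgeLength e f ∧ TropMod.IsRegularWithin 𝒪 Γ.stratum f) ∧
      ∀ S : Finset (TropMod.PairOfPairs n),
        (∀ q : TropMod.PairOfPairs n, ∃ q' ∈ S, q'.unordered = q.unordered) →
        ∃ C : TropMod.PolyComplex S (n - 3),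
          C.IsSimplyBalanced ∧
          TropMod.IsTropicalEmbedding 𝒪 C (TropMod.doubleRatioMap S) ∧
          C.facets = {F | ∃ Γ : TropMod.StableTree n, Γ.IsTrivalent ∧
            F = Set.range (fun ℓ => TropMod.doubleRatioMap S (Γ.cone ℓ))} := by
  let r : Fin n := ⟨0, by omega⟩
  -- The sheaf is defined by all double ratios at once; the root marking `r` only serves the
  -- description by clusters and does not enter the definition.
  refine ⟨TropMod.pullbackSheaf (TropMod.vecToTrop ∘ TropMod.doubleRatioMap Finset.univ), ?_, ?_, ?_⟩
  · exact TropMod.isTropicalVariety_of_isClosedEmbedding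
      (TropMod.isSimplyBalanced_hierarchyComplex (hn := hn) (r := r))
      (TropMod.isComplete_univ.isClosedEmbedding_doubleRatioMap hn r)
      (TropMod.isComplete_univ.range_doubleRatioMap hn r)
  · intro Γ e
    obtain ⟨q, hq⟩ := Γ.exists_isEdgeLength hn r e
    exact ⟨_, hq, TropMod.isRegularWithin_doubleRatio (Finset.mem_univ q) _⟩
  · intro S h
    have hS : TropMod.IsComplete S := h
    refine ⟨TropMod.hierarchyComplex hn r hS, TropMod.isSimplyBalanced_hierarchyComplex,
      ⟨(hS.isClosedEmbedding_doubleRatioMap hn r).isEmbedding, hS.range_doubleRatioMap hn r,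
        fun U f => ⟨hS.pullbackSheaf_imp r _, TropMod.isComplete_univ.pullbackSheaf_imp r _⟩⟩,
      hS.facets_hierarchyComplex hn r⟩
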